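/- **Conventions.** Let $\mathbb{H}$ denote the quaternions. Identify $x\in\mathbb{R}^4$ with $x_1+x_2\mathbf i+x_3\mathbf j+x_4\mathbf k\in\mathbb{H}$, $su(2)$ with the imaginary quaternions (bracket $[p,q]=pq-qp$) and $SU(2)$ with the unit quaternions, where $\mathbf i,\mathbf j,\mathbf k$ are the complex $2\times2$ matrices $\begin{pmatrix}i&0\\0&-i\end{pmatrix},\begin{pmatrix}0&1\\-1&0\end{pmatrix},\begin{pmatrix}0&i\\i&0\end{pmatrix}$; $\mathrm{tr}$ is the matrix trace, so $\mathrm{tr}(q)=2\,\mathrm{Re}\,q$, and $|p|^2=\mathrm{tr}(p\bar p)$, so $|\mathbf i|^2=|\mathbf j|^2=|\mathbf k|^2=2$. A smooth $su(2)$-connection form on $\mathbb{R}^4$ is a smooth $su(2)$-valued 1-form $A$; its curvature is $F_A(X,Y)=dA(X,Y)+[A(X),A(Y)]$, with $|F_A|^2=\sum_{1\le i<j\le 4}|F_A(\partial_{x_i},\partial_{x_j})|^2$ and Yang–Mills energy $YM(A)=\int_{\mathbb{R}^4}|F_A|^2\,dx$. $P_+$ and $P_-$ are the orthogonal projections of 2-forms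 onto the self-dual and the anti-self-dual ones, for the Euclidean metric and the orientation $dx_1\wedge dx_2\wedge dx_3\wedge dx_4$. $B_r$ is the open ball of radius $r$ centred at $0$. Connection forms $A$ and $B$ are gauge equivalent on a set $S$ if $B=g^{-1}Ag+g^{-1}dg$ on $S$ for some smooth $SU(2)$-valued $g$ defined on an open neighbourhood of $S$. For $\lambda>0$, $$SD_\lambda(x)=\mathrm{Im}\left(\frac{\lambda^2x\,d\bar x}{1+\lambda^2|x|^2}\right),\qquad ASD_\lambda(x)=\mathrm{Im}\left(\frac{\lambda^2\bar x\,dx}{1+\lambda^2|x|^2}\right)$$ are the standard self-dual and anti-self-dual instantons centred at $0$. **Theorem.** There are universal constants $\tau\in(0.3,0.4)$ and $\varepsilon_0>0$ such that the following holds for every smooth $su(2)$-connection form $A$ on $\mathbb{R}^4$ with $YM(A)<\infty$ and $F_A(0)\neq0$. (i) If $|P_+F_A(0)|\le|P_-F_A(0)|$, then there is $\rho_0=\rho_0(A)>0$ such that for every $0<\rho<\rho_0$ there is a smooth $su(2)$-connection form $\hat A$ on $\mathbb{R}^4$ with $YM(\hat A)<\infty$ such that: $A$ and $\hat A$ are gauge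 equivalent on $\mathbb{R}^4\setminus B_\rho$; $\hat A$ is gauge equivalent on $B_{\tau\rho}$ to the self-dual instanton $SD_\lambda$ for some $\lambda>0$; $$\int_{\mathbb{R}^4}\mathrm{tr}(F_{\hat A}\wedge F_{\hat A})=\int_{\mathbb{R}^4}\mathrm{tr}(F_A\wedge F_A)-8\pi^2;$$ and $$YM(\hat A)\le YM(A)+8\pi^2-\varepsilon_0\,|F_A(0)|^2\rho^4.$$ (ii) If $|P_+F_A(0)|\ge|P_-F_A(0)|$, the same holds with $SD_\lambda$ replaced by the anti-self-dual instanton $ASD_\lambda$ and with $$\int_{\mathbb{R}^4}\mathrm{tr}(F_{\hat A}\wedge F_{\hat A})=\int_{\mathbb{R}^4}\mathrm{tr}(F_A\wedge F_A)+8\pi^2.$$ -/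

import Mathlib

open MeasureTheory
open scoped Quaternion ContDiff

noncomputable section

namespace YangMills4

/-- Euclidean `ℝ⁴`; the coordinates `x₁, x₂, x₃, x₄` are `x 0, x 1, x 2, x 3`. -/
abbrev R4 : Type := EuclideanSpace ℝ (Fin 4)

/-- The identification of `ℝ⁴` with the quaternions, `x = x₁ + x₂ i + x₃ j + x₄ k`. -/
def toQuat (x : R4) : ℍ[ℝ] := ⟨x 0, x 1, x 2, x 3⟩

theorem toQuat_add (v w : R4) : toQuat (v + w) = toQuat v + toQuat w := by
  ext <;> rfl

theorem toQuat_smul (c : ℝ) (v : R4) : toQuat (c • v) = c • toQuat v := by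
  ext <;> rfl

/-! The quaternions are identified with the real span of the complex `2 × 2` matrices
`1`, `i = diag(i, -i)`, `j = [[0, 1], [-1, 0]]`, `k = [[0, i], [i, 0]]`.  Under this (multiplicative)
identification the group `SU(2)` is the group of quaternions of modulus one, the Lie algebra
`su(2)` is the space of purely imaginary quaternions with the commutator as bracket, the adjoint of
a matrix is the conjugate quaternion, and the matrix trace is twice the real part. -/

/-- The trace of the complex `2 × 2` matrix that corresponds to a quaternion. -/
def quatTrace (q : ℍ[ℝ]) : ℝ := 2 * q.re

/-- The squared norm `|p|² = tr (p p̄)`, for which `|1|² = |i|² = |j|² = |k|² = 2`. -/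
def quatNormSq (p : ℍ[ℝ]) : ℝ := quatTrace (p * star p)

/-- One-forms on `ℝ⁴` with quaternionic values. -/
abbrev OneForm : Type := R4 → R4 →L[ℝ] ℍ[ℝ]

/-- Smooth `su(2)`-connection forms on `ℝ⁴`: smooth one-forms with values in the purely imaginary
quaternions. -/
def IsConnectionForm (A : OneForm) : Prop :=
  ContDiff ℝ ∞ A ∧ ∀ x v, (A x v).re = 0

/-- A two-covector on `ℝ⁴` with quaternionic values, given by its components `α i j = α(e_i, e_j)`,
so that `α = ∑_{i < j} α i j dx_i ∧ dx_j`; all two-covectors used below are antisymmetric. -/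
abbrev TwoCovector : Type := Fin 4 → Fin 4 → ℍ[ℝ]

/-- The curvature `F_A(x)(X, Y) = dA(x)(X, Y) + [A(x) X, A(x) Y]`. -/
def curvatureForm (A : OneForm) (x X Y : R4) : ℍ[ℝ] :=
  (fderiv ℝ A x X Y - fderiv ℝ A x Y X) + (A x X * A x Y - A x Y * A x X)

/-- The components `F_A(x)(e_i, e_j)` of the curvature in the standard basis. -/
def curvature (A : OneForm) (x : R4) : TwoCovector := fun i j =>
  curvatureForm A x (EuclideanSpace.single i 1) (EuclideanSpace.single j 1)

/-- The norm `|α| = (∑_{i < j} |α(e_i, e_j)|²)^{1/2}`. -/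
def covNorm (α : TwoCovector) : ℝ :=
  √(∑ i : Fin 4, ∑ j ∈ Finset.Ioi i, quatNormSq (α i j))

/-- The totally antisymmetric symbol on four indices, with `ε 0 1 2 3 = 1`. -/
def epsSymbol (i j k l : Fin 4) : ℤ :=
  Int.sign (((j : ℤ) - i) * ((k : ℤ) - i) * ((l : ℤ) - i) *
    ((k : ℤ) - j) * ((l : ℤ) - j) * ((l : ℤ) - k))

/-- The Hodge star on two-covectors for the Euclidean metric and the orientation
`dx₁ ∧ dx₂ ∧ dx₃ ∧ dx₄`. -/
def hodgeStar (α : TwoCovector) : TwoCovector := fun i j =>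
  (1 / 2 : ℝ) • ∑ k : Fin 4, ∑ l : Fin 4, (epsSymbol i j k l : ℝ) • α k l

/-- The orthogonal projection onto the self-dual two-covectors. -/
def projPlus (α : TwoCovector) : TwoCovector := (1 / 2 : ℝ) • (α + hodgeStar α)

/-- The orthogonal projection onto the anti-self-dual two-covectors. -/
def projMinus (α : TwoCovector) : TwoCovector := (1 / 2 : ℝ) • (α - hodgeStar α)

/-- The coefficient of `dx₁ ∧ dx₂ ∧ dx₃ ∧ dx₄` in `tr (α ∧ β)`. -/
def traceWedge (α β : TwoCovector) : ℝ :=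
  (1 / 4) * ∑ i : Fin 4, ∑ j : Fin 4, ∑ k : Fin 4, ∑ l : Fin 4,
    (epsSymbol i j k l : ℝ) * quatTrace (α i j * β k l)

/-- `A` has finite Yang-Mills energy: `∫ |F_A|² dx < ∞`. -/
def FiniteEnergy (A : OneForm) : Prop :=
  Integrable (fun x : R4 => covNorm (curvature A x) ^ 2) volume

/-- The Yang-Mills energy `∫ |F_A|² dx`. -/
def energy (A : OneForm) : ℝ := ∫ x : R4, covNorm (curvature A x) ^ 2

/-- The Chern number (without normalization) `∫ tr (F_A ∧ F_A)`. For connection forms of finite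
energy the integrand is integrable, since it is dominated by `|F_A|²`. -/
def chernIntegral (A : OneForm) : ℝ :=
  ∫ x : R4, traceWedge (curvature A x) (curvature A x)

/-- Gauge equivalence of `A` and `B` over a set `S`: there is a smooth `SU(2)`-valued map `g`,
defined on an open neighbourhood of `S`, with `B = g⁻¹ A g + g⁻¹ dg` on `S`. -/
def GaugeEquivOn (S : Set R4) (A B : OneForm) : Prop :=
  ∃ (U : Set R4) (g : R4 → ℍ[ℝ]), IsOpen U ∧ S ⊆ U ∧ ContDiffOn ℝ ∞ g U ∧
    (∀ x ∈ U, ‖g x‖ = 1) ∧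
    ∀ x ∈ S, ∀ v, B x v = (g x)⁻¹ * A x v * g x + (g x)⁻¹ * fderiv ℝ g x v

/-- The self-dual instanton of scale `lam`, centred at the origin:
`SD(x) = Im (lam² x dx̄ / (1 + lam² |x|²))`. -/
def sdInstanton (lam : ℝ) : OneForm := fun x =>
  LinearMap.toContinuousLinearMap
    { toFun := fun v =>
        (lam ^ 2 / (1 + lam ^ 2 * ‖x‖ ^ 2)) • (toQuat x * star (toQuat v)).im
      map_add' := by
        intro v w
        simp [toQuat_add, mul_add]
      map_smul' := by
        intro c v
        simp [toQuat_smul, smul_smul, mul_comm] }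

/-- The anti-self-dual instanton of scale `lam`, centred at the origin:
`ASD(x) = Im (lam² x̄ dx / (1 + lam² |x|²))`. -/
def asdInstanton (lam : ℝ) : OneForm := fun x =>
  LinearMap.toContinuousLinearMap
    { toFun := fun v =>
        (lam ^ 2 / (1 + lam ^ 2 * ‖x‖ ^ 2)) • (star (toQuat x) * toQuat v).im
      map_add' := by
        intro v w
        simp [toQuat_add, mul_add]
      map_smul' := by
        intro c v
        simp [toQuat_smul, smul_smul, mul_comm] }

end YangMills4

end

open YangMills4

/-!
The glued form is a superposition, in the gauge in which the instanton decays, of `A` cut off near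
the origin and an instanton of small scale cut off near the unit sphere, after `A` has been rescaled
from the ball of radius `ρ` to the unit ball (`singularForm`). The gauge transformation by
`x̄ / ‖x‖` (`gluedForm_eq_gauge`) makes it smooth: near the origin it becomes the self-dual
instanton, and outside the unit ball it is gauge equivalent to `A`.

*Topology.* `tr (F ∧ F)` is the divergence of the Chern–Simons field. Since the Chern–Simons fields
of the glued form, of the instanton and of `A` differ by a smooth field of compact support, the
integrals of `tr (F ∧ F)` add up (`chernIntegral_gluedForm`). As
`|F|² = -tr (F ∧ F) + 2 |P₋F|²`, the change of the energy is `8π²` plus twice the change of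
`∫ |P₋F|²` over the unit ball (`energy_gluedForm`).

*Interaction.* The instanton is self-dual, so `P₋F` of the glued form consists of the
contribution of `A` and of the terms with the derivatives of the cut-offs. For an instanton with
`λ⁻² = s ρ²` all of this scales like `ρ²`, and after division by `ρ²` it converges as `ρ → 0`
(`exists_continuous_excess`) to an expression in the derivative of `A` at the origin, whose energy
is computed in polar coordinates (`integral_leadingPart`). It is a quadratic polynomial in `s`
without constant term apart from the cost of cutting off `A`, and its linear coefficient is
`-4π²` times the trace of the matrix of `P₋F_A(0)`. Conjugation by a constant makes this
trace at least `|P₋F_A(0)| / √3` (`exists_rotation`), and then an appropriate `s` gives a definite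
decrease, as long as the cut-offs are cheap enough (`exists_cutoffPair`). For this the form must
first be brought into a gauge in which it vanishes at the origin and has antisymmetric derivative
there (`exists_adapted_gauge`).

The statement for anti-self-dual instantons follows by quaternionic conjugation `x ↦ x̄`, which
reverses the orientation and exchanges the two kinds of instantons.
-/

open scoped Topology

namespace YangMills4

noncomputable section

/-! ### Two-covectors in self-dual and anti-self-dual components -/

/-- The anti-self-dual components `α₀₁ - α₂₃`, `α₀₂ + α₁₃`, `α₀₃ - α₁₂` of a two-covector. -/
def asdPart (α : TwoCovector) : Fin 3 → ℍ[ℝ] :=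
  ![α 0 1 - α 2 3, α 0 2 + α 1 3, α 0 3 - α 1 2]

/-- The self-dual components `α₀₁ + α₂₃`, `α₀₂ - α₁₃`, `α₀₃ + α₁₂` of a two-covector. -/
def sdPart (α : TwoCovector) : Fin 3 → ℍ[ℝ] :=
  ![α 0 1 + α 2 3, α 0 2 - α 1 3, α 0 3 + α 1 2]

/-- The square norm `∑ₐ ‖qₐ‖²` of a triple of quaternions. -/
def tripleNormSq (q : Fin 3 → ℍ[ℝ]) : ℝ := ∑ a, ‖q a‖ ^ 2

/-- The real part of a quaternion, as a continuous linear form. -/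
def reL : ℍ[ℝ] →L[ℝ] ℝ :=
  LinearMap.toContinuousLinearMap
    { toFun := fun q => q.re, map_add' := fun _ _ => rfl, map_smul' := fun _ _ => rfl }

@[simp] theorem reL_apply (q : ℍ[ℝ]) : reL q = q.re := rfl

theorem eq_zero_of_eq_neg {q : ℍ[ℝ]} (h : q = -q) : q = 0 := by
  have h2 : (2 : ℝ) • q = 0 := by rw [two_smul]; nth_rewrite 2 [h]; simp
  exact (smul_eq_zero.1 h2).resolve_left two_ne_zero

theorem quatNormSq_eq (p : ℍ[ℝ]) : quatNormSq p = 2 * ‖p‖ ^ 2 := by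
  rw [quatNormSq, quatTrace, Quaternion.self_mul_star, Quaternion.normSq_eq_norm_mul_self]
  simp [sq]

theorem norm_sq_eq (q : ℍ[ℝ]) : ‖q‖ ^ 2 = q.re ^ 2 + q.imI ^ 2 + q.imJ ^ 2 + q.imK ^ 2 := by
  rw [sq, ← Quaternion.normSq_eq_norm_mul_self, Quaternion.normSq_def']

theorem covNorm_sq (α : TwoCovector) : covNorm α ^ 2 =
    2 * (‖α 0 1‖ ^ 2 + ‖α 0 2‖ ^ 2 + ‖α 0 3‖ ^ 2 + ‖α 1 2‖ ^ 2 + ‖α 1 3‖ ^ 2 + ‖α 2 3‖ ^ 2) := by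
  have h : ∀ i : Fin 4, 0 ≤ ∑ j ∈ Finset.Ioi i, quatNormSq (α i j) := fun i =>
    Finset.sum_nonneg fun j _ => by rw [quatNormSq_eq]; positivity
  rw [covNorm, Real.sq_sqrt (Finset.sum_nonneg fun i _ => h i)]
  have h0 : Finset.Ioi (0 : Fin 4) = {1, 2, 3} := by decide
  have h1 : Finset.Ioi (1 : Fin 4) = {2, 3} := by decide
  have h2 : Finset.Ioi (2 : Fin 4) = {3} := by decide
  have h3 : Finset.Ioi (3 : Fin 4) = ∅ := by decide
  simp [Fin.sum_univ_four, h0, h1, h2, h3, quatNormSq_eq]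
  ring

theorem hodgeStar_components {α : TwoCovector} (h : ∀ i j, α j i = -α i j) :
    hodgeStar α 0 1 = α 2 3 ∧ hodgeStar α 0 2 = -α 1 3 ∧ hodgeStar α 0 3 = α 1 2 ∧
    hodgeStar α 1 2 = α 0 3 ∧ hodgeStar α 1 3 = -α 0 2 ∧ hodgeStar α 2 3 = α 0 1 := by
  have e1 := h 0 1
  have e2 := h 0 2
  have e3 := h 0 3
  have e4 := h 1 2
  have e5 := h 1 3
  have e6 := h 2 3
  refine ⟨?_, ?_, ?_, ?_, ?_, ?_⟩ <;>
  · simp [hodgeStar, epsSymbol, Fin.sum_univ_four, e1, e2, e3, e4, e5, e6,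
      show Int.sign 2 = 1 from rfl, show Int.sign 3 = 1 from rfl]
    ext <;> simp <;> ring

theorem hodgeStar_antisymm (α : TwoCovector) (i j : Fin 4) :
    hodgeStar α j i = -hodgeStar α i j := by
  have : ∀ k l : Fin 4, epsSymbol j i k l = - epsSymbol i j k l := by
    revert i j; decide
  simp [hodgeStar, this]

theorem covNorm_projMinus_sq {α : TwoCovector} (h : ∀ i j, α j i = -α i j) :
    covNorm (projMinus α) ^ 2 = tripleNormSq (asdPart α) := by
  obtain ⟨e1, e2, e3, e4, e5, e6⟩ := hodgeStar_components h
  simp only [covNorm_sq, projMinus, tripleNormSq, asdPart, Fin.sum_univ_three, Pi.smul_apply,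
    Pi.sub_apply, e1, e2, e3, e4, e5, e6, norm_sq_eq]
  simp
  ring

theorem covNorm_projPlus_sq {α : TwoCovector} (h : ∀ i j, α j i = -α i j) :
    covNorm (projPlus α) ^ 2 = tripleNormSq (sdPart α) := by
  obtain ⟨e1, e2, e3, e4, e5, e6⟩ := hodgeStar_components h
  simp only [covNorm_sq, projPlus, tripleNormSq, sdPart, Fin.sum_univ_three, Pi.smul_apply,
    Pi.add_apply, e1, e2, e3, e4, e5, e6, norm_sq_eq]
  simp
  ring

theorem covNorm_sq_eq_sd_add_asd (α : TwoCovector) :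
    covNorm α ^ 2 = tripleNormSq (sdPart α) + tripleNormSq (asdPart α) := by
  simp only [covNorm_sq, tripleNormSq, sdPart, asdPart, Fin.sum_univ_three, norm_sq_eq]
  simp
  ring

theorem traceWedge_eq_hodgeStar (α β : TwoCovector) :
    traceWedge α β = (1 / 2) * ∑ i, ∑ j, quatTrace (α i j * hodgeStar β i j) := by
  have : ∀ i j, quatTrace (α i j * hodgeStar β i j) =
      (1 / 2) * ∑ k, ∑ l, (epsSymbol i j k l : ℝ) * quatTrace (α i j * β k l) := by
    intro i j
    have hre : ∀ f : Fin 4 → ℍ[ℝ], (∑ k, f k).re = ∑ k, (f k).re := fun f =>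
      map_sum reL f Finset.univ
    simp only [hodgeStar, quatTrace, mul_smul_comm, Finset.mul_sum, Quaternion.re_smul, hre,
      smul_eq_mul]
    refine Finset.sum_congr rfl fun k _ => Finset.sum_congr rfl fun l _ => by ring
  simp only [traceWedge, this, Finset.mul_sum]
  refine Finset.sum_congr rfl fun i _ => Finset.sum_congr rfl fun j _ =>
    Finset.sum_congr rfl fun k _ => Finset.sum_congr rfl fun l _ => by ring

theorem traceWedge_self {α : TwoCovector} (h : ∀ i j, α j i = -α i j) :
    traceWedge α α = 4 * (α 0 1 * α 2 3 - α 0 2 * α 1 3 + α 0 3 * α 1 2).re := by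
  obtain ⟨e1, e2, e3, e4, e5, e6⟩ := hodgeStar_components h
  have hd : ∀ i, α i i = 0 := fun i => eq_zero_of_eq_neg (h i i)
  have hs := hodgeStar_antisymm α
  rw [traceWedge_eq_hodgeStar]
  simp only [Fin.sum_univ_four, hd, h 0 1, h 0 2, h 0 3, h 1 2, h 1 3, h 2 3, hs 0 1, hs 0 2,
    hs 0 3, hs 1 2, hs 1 3, hs 2 3, e1, e2, e3, e4, e5, e6, quatTrace]
  simp
  ring

theorem traceWedge_self_eq_asd_sub_sd {α : TwoCovector} (h : ∀ i j, α j i = -α i j)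
    (him : ∀ i j, (α i j).re = 0) :
    traceWedge α α = tripleNormSq (asdPart α) - tripleNormSq (sdPart α) := by
  rw [traceWedge_self h]
  simp only [tripleNormSq, sdPart, asdPart, Fin.sum_univ_three, norm_sq_eq]
  simp [him]
  ring

/-! ### Curvature -/

/-- The standard basis vectors of `ℝ⁴`. -/
abbrev stdVec (i : Fin 4) : R4 := EuclideanSpace.single i 1

theorem curvature_antisymm (A : OneForm) (x : R4) (i j : Fin 4) :
    curvature A x j i = -curvature A x i j := by
  simp only [curvature, curvatureForm]
  abel

theorem IsConnectionForm.differentiable {A : OneForm} (hA : IsConnectionForm A) :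
    Differentiable ℝ A := hA.1.differentiable (by simp)

theorem fderiv_re {A : OneForm} (hA : IsConnectionForm A) (x X Y : R4) :
    (fderiv ℝ A x X Y).re = 0 := by
  have h1 : HasFDerivAt (fun y => (A y Y).re)
      ((reL).comp
        ((ContinuousLinearMap.apply ℝ ℍ[ℝ] Y).comp (fderiv ℝ A x))) x :=
    ((reL).hasFDerivAt.comp x
      ((ContinuousLinearMap.apply ℝ ℍ[ℝ] Y).hasFDerivAt.comp x
        (hA.differentiable x).hasFDerivAt))
  have h2 : (fun y => (A y Y).re) = fun _ => (0 : ℝ) := by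
    funext y; exact hA.2 y Y
  rw [h2] at h1
  have := h1.unique (hasFDerivAt_const (0 : ℝ) x)
  simpa using congrArg (fun l => l X) this

theorem curvature_re {A : OneForm} (hA : IsConnectionForm A) (x : R4) (i j : Fin 4) :
    (curvature A x i j).re = 0 := by
  simp only [curvature, curvatureForm]
  simp [fderiv_re hA, hA.2]
  ring

theorem covNorm_curvature_sq {A : OneForm} (hA : IsConnectionForm A) (x : R4) :
    covNorm (curvature A x) ^ 2 = -traceWedge (curvature A x) (curvature A x) +
      2 * tripleNormSq (asdPart (curvature A x)) := by
  rw [covNorm_sq_eq_sd_add_asd,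
    traceWedge_self_eq_asd_sub_sd (curvature_antisymm A x) (curvature_re hA x)]
  ring

/-! ### Gauge transformations -/

theorem hasFDerivAt_eval {A : OneForm} {x : R4} (hA : DifferentiableAt ℝ A x)
    (Y : R4) : HasFDerivAt (fun y => A y Y) ((fderiv ℝ A x).flip Y) x := by
  have := hA.hasFDerivAt.clm_apply (hasFDerivAt_const Y x)
  refine this.congr_fderiv ?_
  ext v : 1
  simp

/-- The curvature of a gauge transform is conjugate to that of the form itself. -/
theorem curvatureForm_gauge {A B : OneForm} {g : R4 → ℍ[ℝ]} {x : R4} (hA : DifferentiableAt ℝ A x)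
    (hB : DifferentiableAt ℝ B x) (hg : ContDiffAt ℝ 2 g x) (hx : g x ≠ 0)
    (h : ∀ᶠ y in 𝓝 x, ∀ v, B y v = (g y)⁻¹ * A y v * g y + (g y)⁻¹ * fderiv ℝ g y v)
    (X Y : R4) : curvatureForm B x X Y = (g x)⁻¹ * curvatureForm A x X Y * g x := by
  have hg1 : HasFDerivAt g (fderiv ℝ g x) x := (hg.differentiableAt (by simp)).hasFDerivAt
  have hi : HasFDerivAt (fun y => (g y)⁻¹) _ x := (hasFDerivAt_inv' (𝕜 := ℝ) hx).comp x hg1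
  have hg2 : DifferentiableAt ℝ (fderiv ℝ g) x :=
    (hg.fderiv_right (m := 1) (by norm_num)).differentiableAt (by simp)
  have key : ∀ V W : R4, fderiv ℝ B x V W =
      -((g x)⁻¹ * fderiv ℝ g x V * (g x)⁻¹) * A x W * g x
      + (g x)⁻¹ * fderiv ℝ A x V W * g x + (g x)⁻¹ * A x W * fderiv ℝ g x V
      - ((g x)⁻¹ * fderiv ℝ g x V * (g x)⁻¹) * fderiv ℝ g x W
      + (g x)⁻¹ * fderiv ℝ (fderiv ℝ g) x V W := by
    intro V W
    have e1 := (((hi.mul' (hasFDerivAt_eval hA W)).mul' hg1).add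
      (hi.mul' (hasFDerivAt_eval hg2 W)))
    have e2 := (hasFDerivAt_eval hB W)
    have e3 := e1.congr_of_eventuallyEq (f₁ := fun y => B y W) (h.mono fun y hy => hy W)
    have := congrArg (fun l => l V) (e2.unique e3)
    simp at this
    rw [this]
    noncomm_ring
  have hs : fderiv ℝ (fderiv ℝ g) x X Y = fderiv ℝ (fderiv ℝ g) x Y X :=
    (hg.isSymmSndFDerivAt (by simp)).eq X Y
  have hh := h.self_of_nhds
  have c1 : ∀ q, g x * ((g x)⁻¹ * q) = q := fun q => by rw [← mul_assoc, mul_inv_cancel₀ hx, one_mul]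
  simp only [curvatureForm, key, hs, hh]
  simp only [mul_add, add_mul, mul_sub, sub_mul, mul_assoc, c1, neg_mul]
  abel

theorem re_mul_comm' (p q : ℍ[ℝ]) : (p * q).re = (q * p).re := by
  simp; ring

theorem re_conj {q : ℍ[ℝ]} (hq : q ≠ 0) (p : ℍ[ℝ]) : (q⁻¹ * p * q).re = p.re := by
  rw [re_mul_comm', ← mul_assoc, mul_inv_cancel₀ hq, one_mul]

theorem norm_conj {q : ℍ[ℝ]} (hq : q ≠ 0) (p : ℍ[ℝ]) : ‖q⁻¹ * p * q‖ = ‖p‖ := by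
  have := norm_ne_zero_iff.2 hq
  rw [norm_mul, norm_mul, norm_inv]; field_simp

/-- The square norms of both halves of a two-covector and `tr (α ∧ α)` are invariant under
conjugation by a quaternion. -/
theorem conj_invariants {α β : TwoCovector} {q : ℍ[ℝ]} (hq : q ≠ 0)
    (hα : ∀ i j, α j i = -α i j) (h : ∀ i j, β i j = q⁻¹ * α i j * q) :
    tripleNormSq (asdPart β) = tripleNormSq (asdPart α) ∧
    tripleNormSq (sdPart β) = tripleNormSq (sdPart α) ∧
    traceWedge β β = traceWedge α α := by
  have hβ : ∀ i j, β j i = -β i j := fun i j => by rw [h, h, hα]; simp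
  have c1 : ∀ p : ℍ[ℝ], q * (q⁻¹ * p) = p := fun p => by
    rw [← mul_assoc, mul_inv_cancel₀ hq, one_mul]
  have ha : ∀ a, asdPart β a = q⁻¹ * asdPart α a * q := fun a => by
    fin_cases a <;> simp [asdPart, h, mul_add, add_mul, mul_sub, sub_mul]
  have hs : ∀ a, sdPart β a = q⁻¹ * sdPart α a * q := fun a => by
    fin_cases a <;> simp [sdPart, h, mul_add, add_mul, mul_sub, sub_mul]
  refine ⟨?_, ?_, ?_⟩
  · simp only [tripleNormSq, ha, norm_conj hq]
  · simp only [tripleNormSq, hs, norm_conj hq]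
  · rw [traceWedge_self hα, traceWedge_self hβ,
      ← re_conj hq (α 0 1 * α 2 3 - α 0 2 * α 1 3 + α 0 3 * α 1 2)]
    simp only [h, mul_add, add_mul, mul_sub, sub_mul, mul_assoc, c1]

/-- The three densities that enter the energy comparison agree at a point near which two forms are
gauge equivalent. -/
theorem gauge_invariants {A B : OneForm} {g : R4 → ℍ[ℝ]} {x : R4} (hA : DifferentiableAt ℝ A x)
    (hB : DifferentiableAt ℝ B x) (hg : ContDiffAt ℝ 2 g x) (hx : g x ≠ 0)
    (h : ∀ᶠ y in 𝓝 x, ∀ v, B y v = (g y)⁻¹ * A y v * g y + (g y)⁻¹ * fderiv ℝ g y v) :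
    tripleNormSq (asdPart (curvature B x)) = tripleNormSq (asdPart (curvature A x)) ∧
    tripleNormSq (sdPart (curvature B x)) = tripleNormSq (sdPart (curvature A x)) ∧
    traceWedge (curvature B x) (curvature B x) = traceWedge (curvature A x) (curvature A x) :=
  conj_invariants hx (curvature_antisymm A x) fun _ _ => curvatureForm_gauge hA hB hg hx h _ _

theorem inv_eq_star {q : ℍ[ℝ]} (h : ‖q‖ = 1) : q⁻¹ = star q := by
  apply inv_eq_of_mul_eq_one_right
  rw [Quaternion.self_mul_star, Quaternion.normSq_eq_norm_mul_self, h]; simp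

/-- The gauge transform `g⁻¹ A g + g⁻¹ dg`. -/
def gaugeTransform (g : R4 → ℍ[ℝ]) (A : OneForm) : OneForm := fun x =>
  (ContinuousLinearMap.mulLeftRight ℝ ℍ[ℝ] (g x)⁻¹ (g x)).comp (A x) +
    (ContinuousLinearMap.mul ℝ ℍ[ℝ] (g x)⁻¹).comp (fderiv ℝ g x)

theorem gaugeTransform_apply (g : R4 → ℍ[ℝ]) (A : OneForm) (x v : R4) :
    gaugeTransform g A x v = (g x)⁻¹ * A x v * g x + (g x)⁻¹ * fderiv ℝ g x v := by
  simp [gaugeTransform]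

/-- Quaternionic conjugation as a continuous linear map. -/
def starCLM : ℍ[ℝ] →L[ℝ] ℍ[ℝ] :=
  LinearMap.toContinuousLinearMap
    { toFun := fun q => star q
      map_add' := star_add
      map_smul' := fun c q => by ext <;> simp }

@[simp] theorem starCLM_apply (q : ℍ[ℝ]) : starCLM q = star q := rfl

theorem contDiff_inv_of_norm_one {g : R4 → ℍ[ℝ]} {U : Set R4} (hg : ContDiffOn ℝ ∞ g U)
    (h1 : ∀ x ∈ U, ‖g x‖ = 1) : ContDiffOn ℝ ∞ (fun x => (g x)⁻¹) U :=
  (starCLM.contDiff.comp_contDiffOn hg).congr fun x hx => by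
    simp [inv_eq_star (h1 x hx)]

theorem re_inv_mul_fderiv {g : R4 → ℍ[ℝ]} {x : R4} (hg : DifferentiableAt ℝ g x)
    (h1 : ∀ᶠ y in 𝓝 x, ‖g y‖ = 1) (v : R4) : ((g x)⁻¹ * fderiv ℝ g x v).re = 0 := by
  have e := (hg.hasFDerivAt.norm_sq).unique
    ((hasFDerivAt_const (1 : ℝ) x).congr_of_eventuallyEq (h1.mono fun y hy => by simp [hy]))
  have e2 := congrArg (fun l => l v) e
  rw [inv_eq_star h1.self_of_nhds, re_mul_comm']
  simp [Quaternion.inner_def] at e2 ⊢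
  linarith

theorem IsConnectionForm.gaugeTransform {g : R4 → ℍ[ℝ]} {A : OneForm} (hA : IsConnectionForm A)
    (hg : ContDiff ℝ ∞ g) (h1 : ∀ x, ‖g x‖ = 1) : IsConnectionForm (gaugeTransform g A) := by
  have hi : ContDiff ℝ ∞ (fun x => (g x)⁻¹) :=
    contDiffOn_univ.1 (contDiff_inv_of_norm_one hg.contDiffOn fun x _ => h1 x)
  refine ⟨?_, fun x v => ?_⟩
  · have e1 : ContDiff ℝ ∞ (fderiv ℝ g) := hg.fderiv_right (by simp)
    refine contDiff_clm_apply_iff.2 fun v => ?_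
    simp only [gaugeTransform_apply]
    exact ((hi.mul (hA.1.clm_apply contDiff_const)).mul hg).add
      (hi.mul (e1.clm_apply contDiff_const))
  · have hx : g x ≠ 0 := fun h => by simpa [h] using h1 x
    have := re_inv_mul_fderiv (hg.differentiable (by simp) x) (.of_forall h1) v
    rw [gaugeTransform_apply, Quaternion.re_add, re_conj hx, this, hA.2, add_zero]

theorem gaugeEquivOn_gaugeTransform {g : R4 → ℍ[ℝ]} (A : OneForm)
    (hg : ContDiff ℝ ∞ g) (h1 : ∀ x, ‖g x‖ = 1) (S : Set R4) :
    GaugeEquivOn S A (gaugeTransform g A) :=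
  ⟨Set.univ, g, isOpen_univ, Set.subset_univ _, hg.contDiffOn, fun x _ => h1 x,
    fun x _ v => gaugeTransform_apply g A x v⟩

theorem GaugeEquivOn.trans {S : Set R4} {A B C : OneForm} (h : GaugeEquivOn S A B)
    (h' : GaugeEquivOn S B C) : GaugeEquivOn S A C := by
  obtain ⟨U, g, hU, hSU, hg, g1, hB⟩ := h
  obtain ⟨V, k, hV, hSV, hk, k1, hC⟩ := h'
  refine ⟨U ∩ V, fun x => g x * k x, hU.inter hV, Set.subset_inter hSU hSV, ?_,
    fun x hx => by rw [norm_mul, g1 x hx.1, k1 x hx.2, one_mul], fun x hx v => ?_⟩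
  · exact (hg.mono Set.inter_subset_left).mul (hk.mono Set.inter_subset_right)
  · have dg := ((hg.contDiffAt (hU.mem_nhds (hSU hx))).differentiableAt (by simp)).hasFDerivAt
    have dk := ((hk.contDiffAt (hV.mem_nhds (hSV hx))).differentiableAt (by simp)).hasFDerivAt
    have e : fderiv ℝ (fun y => g y * k y) x v = _ := congrArg (fun l => l v) (dg.mul' dk).fderiv
    have hgx : g x ≠ 0 := fun h => by simpa [h] using g1 x (hSU hx)
    have c1 : ∀ q, (g x)⁻¹ * (g x * q) = q := fun q => by
      rw [← mul_assoc, inv_mul_cancel₀ hgx, one_mul]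
    rw [hC x hx, hB x hx, e]
    simp [mul_add, add_mul, mul_assoc, c1]
    abel

theorem GaugeEquivOn.of_eqOn {S : Set R4} {A B : OneForm} (h : ∀ x ∈ S, A x = B x) :
    GaugeEquivOn S A B :=
  ⟨Set.univ, fun _ => 1, isOpen_univ, Set.subset_univ _, contDiffOn_const, fun _ _ => by simp,
    fun x hx v => by simp [h x hx]⟩

/-! ### Pull-back by a linear map -/

/-- The pull-back of a one-form by a linear map. -/
def pullback (S : R4 →L[ℝ] R4) (A : OneForm) : OneForm := fun x => (A (S x)).comp S

@[simp] theorem pullback_apply (S : R4 →L[ℝ] R4) (A : OneForm) (x v : R4) :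
    pullback S A x v = A (S x) (S v) := rfl

theorem IsConnectionForm.pullback {A : OneForm} (hA : IsConnectionForm A) (S : R4 →L[ℝ] R4) :
    IsConnectionForm (pullback S A) :=
  ⟨(hA.1.comp S.contDiff).clm_comp contDiff_const, fun _ _ => hA.2 _ _⟩

theorem fderiv_pullback {A : OneForm} (hA : IsConnectionForm A) (S : R4 →L[ℝ] R4) (x X Y : R4) :
    fderiv ℝ (pullback S A) x X Y = fderiv ℝ A (S x) (S X) (S Y) := by
  have e1 : HasFDerivAt (fun y => A (S y) (S Y)) _ x :=
    (hasFDerivAt_eval (hA.differentiable (S x)) (S Y)).comp x S.hasFDerivAt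
  have e2 := hasFDerivAt_eval ((hA.pullback S).differentiable x) Y
  exact congrArg (fun l => l X) (e2.unique e1)

theorem curvatureForm_pullback {A : OneForm} (hA : IsConnectionForm A) (S : R4 →L[ℝ] R4)
    (x X Y : R4) :
    curvatureForm (YangMills4.pullback S A) x X Y = curvatureForm A (S x) (S X) (S Y) := by
  simp only [curvatureForm, fderiv_pullback hA, pullback_apply]

theorem GaugeEquivOn.pullback {T : Set R4} {A B : OneForm} (h : GaugeEquivOn T A B)
    (S : R4 →L[ℝ] R4) :
    GaugeEquivOn (S ⁻¹' T) (pullback S A) (pullback S B) := by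
  obtain ⟨U, g, hU, hTU, hg, g1, hB⟩ := h
  refine ⟨S ⁻¹' U, g ∘ S, hU.preimage S.continuous, Set.preimage_mono hTU,
    hg.comp S.contDiff.contDiffOn (Set.mapsTo_preimage _ _), fun x hx => g1 _ hx,
    fun x hx v => ?_⟩
  have dg := ((hg.contDiffAt (hU.mem_nhds (hTU hx))).differentiableAt (by simp)).hasFDerivAt
  rw [(dg.comp x S.hasFDerivAt).fderiv]
  exact hB (S x) hx (S v)

/-! ### The Chern–Simons form -/

/-- The component `tr (A ∧ dA + (2/3) A ∧ A ∧ A)(e_j, e_k, e_l)` of the Chern–Simons form. -/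
def chernSimons (A : OneForm) (j k l : Fin 4) (x : R4) : ℝ :=
  2 * (A x (stdVec j) * (fderiv ℝ A x (stdVec k) (stdVec l) - fderiv ℝ A x (stdVec l) (stdVec k))
    + A x (stdVec k) * (fderiv ℝ A x (stdVec l) (stdVec j) - fderiv ℝ A x (stdVec j) (stdVec l))
    + A x (stdVec l) * (fderiv ℝ A x (stdVec j) (stdVec k) - fderiv ℝ A x (stdVec k) (stdVec j))
    + (2 : ℝ) • (A x (stdVec j) *
        (A x (stdVec k) * A x (stdVec l) - A x (stdVec l) * A x (stdVec k)))).re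

/-- The vector field dual to the Chern–Simons form. -/
def chernSimonsField (A : OneForm) (i : Fin 4) : R4 → ℝ :=
  ![chernSimons A 1 2 3, -chernSimons A 0 2 3, chernSimons A 0 1 3, -chernSimons A 0 1 2] i

theorem hasFDerivAt_chernSimons {A : OneForm} {x : R4} (hA : ContDiffAt ℝ 2 A x) (j k l : Fin 4) :
    ∃ L : R4 →L[ℝ] ℝ, HasFDerivAt (chernSimons A j k l) L x ∧ ∀ v, L v = 2 * (
      fderiv ℝ A x v (stdVec j) *
          (fderiv ℝ A x (stdVec k) (stdVec l) - fderiv ℝ A x (stdVec l) (stdVec k))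
        + fderiv ℝ A x v (stdVec k) *
          (fderiv ℝ A x (stdVec l) (stdVec j) - fderiv ℝ A x (stdVec j) (stdVec l))
        + fderiv ℝ A x v (stdVec l) *
          (fderiv ℝ A x (stdVec j) (stdVec k) - fderiv ℝ A x (stdVec k) (stdVec j))
        + (2 : ℝ) • (fderiv ℝ A x v (stdVec j) *
            (A x (stdVec k) * A x (stdVec l) - A x (stdVec l) * A x (stdVec k))
          + A x (stdVec j) * (fderiv ℝ A x v (stdVec k) * A x (stdVec l)
            + A x (stdVec k) * fderiv ℝ A x v (stdVec l)
            - (fderiv ℝ A x v (stdVec l) * A x (stdVec k)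
            + A x (stdVec l) * fderiv ℝ A x v (stdVec k))))).re
      + 2 * (A x (stdVec j) * (fderiv ℝ (fderiv ℝ A) x v (stdVec k) (stdVec l) -
            fderiv ℝ (fderiv ℝ A) x v (stdVec l) (stdVec k))
        + A x (stdVec k) * (fderiv ℝ (fderiv ℝ A) x v (stdVec l) (stdVec j) -
            fderiv ℝ (fderiv ℝ A) x v (stdVec j) (stdVec l))
        + A x (stdVec l) * (fderiv ℝ (fderiv ℝ A) x v (stdVec j) (stdVec k) -
            fderiv ℝ (fderiv ℝ A) x v (stdVec k) (stdVec j))).re := by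
  have ha : ∀ i, HasFDerivAt (fun y => A y (stdVec i)) ((fderiv ℝ A x).flip (stdVec i)) x :=
    fun i => hasFDerivAt_eval (hA.differentiableAt (by simp)) _
  have h2 : DifferentiableAt ℝ (fderiv ℝ A) x :=
    (hA.fderiv_right (m := 1) (by norm_num)).differentiableAt (by simp)
  have hd : ∀ i j, ∃ L : R4 →L[ℝ] ℍ[ℝ],
      HasFDerivAt (fun y => fderiv ℝ A y (stdVec i) (stdVec j)) L x ∧
      ∀ v, L v = fderiv ℝ (fderiv ℝ A) x v (stdVec i) (stdVec j) := fun i j =>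
    ⟨_, (h2.hasFDerivAt.clm_apply (hasFDerivAt_const (stdVec i) x)).clm_apply
      (hasFDerivAt_const (stdVec j) x), fun v => by simp⟩
  choose D hd hD using hd
  have e := ((reL.hasFDerivAt.comp x
    ((((ha j).mul' ((hd k l).sub (hd l k))).add ((ha k).mul' ((hd l j).sub (hd j l)))).add
      ((ha l).mul' ((hd j k).sub (hd k j))) |>.add
      (((ha j).mul' (((ha k).mul' (ha l)).sub ((ha l).mul' (ha k)))).const_smul (2 : ℝ))))).const_mul 2
  refine ⟨_, e, fun v => ?_⟩
  simp only [smul_apply, ContinuousLinearMap.comp_apply,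
    add_apply, sub_apply, ContinuousLinearMap.flip_apply, hD,
    smul_eq_mul, reL_apply, MulOpposite.smul_eq_mul_unop, MulOpposite.unop_op, Pi.mul_apply, Pi.sub_apply]
  rw [← mul_add, ← Quaternion.re_add]
  congr 2
  simp only [smul_add, smul_sub, mul_add, mul_sub]
  abel

/-- The part of the divergence of the Chern–Simons field without second derivatives, as an identity
in the components `a` of the form and `p` of its derivative. -/
theorem chernSimons_algebra (a : Fin 4 → ℍ[ℝ]) (p : Fin 4 → Fin 4 → ℍ[ℝ])
    (F : Fin 4 → Fin 4 → ℍ[ℝ]) (hF : ∀ i j, F i j = p i j - p j i + (a i * a j - a j * a i))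
    (P : Fin 4 → Fin 4 → Fin 4 → Fin 4 → ℍ[ℝ]) (hP : ∀ i j k l, P i j k l =
      p i j * (p k l - p l k) + p i k * (p l j - p j l) + p i l * (p j k - p k j)
      + (2 : ℝ) • (p i j * (a k * a l - a l * a k)
        + a j * (p i k * a l + a k * p i l - (p i l * a k + a l * p i k)))) :
    (P 0 1 2 3).re - (P 1 0 2 3).re + (P 2 0 1 3).re - (P 3 0 1 2).re =
      2 * (F 0 1 * F 2 3 - F 0 2 * F 1 3 + F 0 3 * F 1 2).re := by
  simp only [hF, hP, Quaternion.re_add, Quaternion.re_sub, Quaternion.re_mul, Quaternion.imI_mul,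
    Quaternion.imJ_mul, Quaternion.imK_mul, Quaternion.imI_sub, Quaternion.imJ_sub,
    Quaternion.imK_sub, Quaternion.imI_add, Quaternion.imJ_add, Quaternion.imK_add,
    Quaternion.re_smul, smul_eq_mul]
  ring

/-- The Chern–Weil form `tr (F ∧ F)` is the differential of the Chern–Simons form. -/
theorem traceWedge_eq_div_chernSimonsField {A : OneForm} {x : R4} (hA : ContDiffAt ℝ 2 A x) :
    traceWedge (curvature A x) (curvature A x) =
      ∑ i, fderiv ℝ (chernSimonsField A i) x (stdVec i) := by
  have hs : ∀ i j k, fderiv ℝ (fderiv ℝ A) x (stdVec i) (stdVec j) (stdVec k) =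
      fderiv ℝ (fderiv ℝ A) x (stdVec j) (stdVec i) (stdVec k) := fun i j k => by
    rw [(hA.isSymmSndFDerivAt (by simp)).eq]
  -- The second derivatives of the form cancel by symmetry.
  have hS : ∀ (a : Fin 4 → ℍ[ℝ]) (s : Fin 4 → Fin 4 → Fin 4 → ℍ[ℝ])
      (_ : ∀ i j k, s i j k = s j i k),
      (a 1 * (s 0 2 3 - s 0 3 2) + a 2 * (s 0 3 1 - s 0 1 3) + a 3 * (s 0 1 2 - s 0 2 1)).re
      - (a 0 * (s 1 2 3 - s 1 3 2) + a 2 * (s 1 3 0 - s 1 0 3) + a 3 * (s 1 0 2 - s 1 2 0)).re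
      + (a 0 * (s 2 1 3 - s 2 3 1) + a 1 * (s 2 3 0 - s 2 0 3) + a 3 * (s 2 0 1 - s 2 1 0)).re
      - (a 0 * (s 3 1 2 - s 3 2 1) + a 1 * (s 3 2 0 - s 3 0 2) + a 2 * (s 3 0 1 - s 3 1 0)).re
        = 0 := by
    intro a s hs
    rw [← Quaternion.re_sub, ← Quaternion.re_add, ← Quaternion.re_sub]
    refine Eq.trans ?_ Quaternion.re_zero
    apply congrArg
    rw [hs 1 0, hs 2 0, hs 3 0, hs 2 1, hs 3 1, hs 3 2, hs 1 0, hs 2 0, hs 3 0, hs 2 1, hs 3 1,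
      hs 3 2]
    simp only [mul_sub]
    abel
  choose L hL hLv using fun j k l => hasFDerivAt_chernSimons hA j k l
  have hneg : ∀ j k l, fderiv ℝ (-chernSimons A j k l) x = -L j k l := fun j k l =>
    (hL j k l).neg.fderiv
  rw [traceWedge_self (curvature_antisymm A x)]
  have key := chernSimons_algebra (fun i => A x (stdVec i))
    (fun i j => fderiv ℝ A x (stdVec i) (stdVec j)) (curvature A x) (fun i j => rfl) _
    (fun _ _ _ _ => rfl)
  have key2 := hS (fun i => A x (stdVec i))
    (fun i j k => fderiv ℝ (fderiv ℝ A) x (stdVec i) (stdVec j) (stdVec k)) hs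
  simp only [Fin.sum_univ_four, chernSimonsField, Matrix.cons_val, hneg, (hL _ _ _).fderiv,
    neg_apply, hLv]
  linarith

/-! ### Integrals over `ℝ⁴` -/

theorem integral_fderiv_eq_zero {f : R4 → ℝ} (hf : ContDiff ℝ 1 f) (hc : HasCompactSupport f)
    (v : R4) : ∫ x, fderiv ℝ f x v = 0 := by
  have h1 : Integrable (fun x => fderiv ℝ f x v) :=
    ((hf.continuous_fderiv one_ne_zero).clm_apply continuous_const).integrable_of_hasCompactSupport
      (hc.fderiv_apply ℝ v)
  have := integral_mul_fderiv_eq_neg_fderiv_mul_of_integrable (μ := volume) (𝕜 := ℝ)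
    (f := fun _ : R4 => (1 : ℝ)) (g := f) (v := v) (by simp) (by simpa using h1)
    (by simpa using hf.continuous.integrable_of_hasCompactSupport hc)
    (fun x _ => differentiableAt_const _) (fun x _ => hf.differentiable one_ne_zero x)
  simpa using this

/-- Integration of a radial function on `ℝ⁴` in the variable `w = ‖x‖²`. -/
theorem integral_radial (f : ℝ → ℝ) :
    ∫ x : R4, f (‖x‖ ^ 2) = Real.pi ^ 2 * ∫ w in Set.Ioi (0 : ℝ), w * f w := by
  have hv : (volume : Measure R4).real (Metric.ball 0 1) = Real.pi ^ 2 / 2 := by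
    rw [Measure.real, InnerProductSpace.volume_ball_of_dim_even (k := 2) (by simp)]
    have : (0 : ℝ) ≤ Real.pi ^ 2 / 2 := by positivity
    simp [this]
  have h1 := integral_fun_norm_addHaar (volume : Measure R4) (fun r => f (r ^ 2))
  have h2 := integral_comp_rpow_Ioi_of_pos (g := fun w => w * f w) (p := 2) (by norm_num)
  rw [h1, ← h2, hv, ← integral_const_mul, nsmul_eq_mul, smul_eq_mul, ← mul_assoc,
    ← integral_const_mul]
  refine setIntegral_congr_fun measurableSet_Ioi fun r hr => ?_
  simp
  norm_num
  ring

theorem norm_sq_coord (x : R4) : ‖x‖ ^ 2 = x 0 ^ 2 + x 1 ^ 2 + x 2 ^ 2 + x 3 ^ 2 := by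
  simp [EuclideanSpace.norm_sq_eq, Fin.sum_univ_four]

/-- A norm preserving endomorphism of `ℝ⁴`, as a linear isometry equivalence. -/
def isometryOfNorm (f : R4 →ₗ[ℝ] R4) (h : ∀ x, ‖f x‖ = ‖x‖) : R4 ≃ₗᵢ[ℝ] R4 :=
  LinearIsometry.toLinearIsometryEquiv ⟨f, h⟩ rfl

@[simp] theorem isometryOfNorm_apply (f : R4 →ₗ[ℝ] R4) (h : ∀ x, ‖f x‖ = ‖x‖) (x : R4) :
    isometryOfNorm f h x = f x := rfl

theorem norm_eq_of_coord {x y : R4} (h : x 0 ^ 2 + x 1 ^ 2 + x 2 ^ 2 + x 3 ^ 2 =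
    y 0 ^ 2 + y 1 ^ 2 + y 2 ^ 2 + y 3 ^ 2) : ‖x‖ = ‖y‖ := by
  rw [← sq_eq_sq₀ (norm_nonneg _) (norm_nonneg _), norm_sq_coord, norm_sq_coord, h]

/-- Left multiplication by the quaternion `i`. -/
def leftMulI : R4 ≃ₗᵢ[ℝ] R4 := isometryOfNorm
  { toFun := fun x => !₂[-x 1, x 0, -x 3, x 2]
    map_add' := fun x y => by ext i; fin_cases i <;> simp <;> ring
    map_smul' := fun c x => by ext i; fin_cases i <;> simp }
  fun x => norm_eq_of_coord (by simp; ring)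

/-- Left multiplication by the quaternion `j`. -/
def leftMulJ : R4 ≃ₗᵢ[ℝ] R4 := isometryOfNorm
  { toFun := fun x => !₂[-x 2, x 3, x 0, -x 1]
    map_add' := fun x y => by ext i; fin_cases i <;> simp <;> ring
    map_smul' := fun c x => by ext i; fin_cases i <;> simp }
  fun x => norm_eq_of_coord (by simp; ring)

/-- Left multiplication by the quaternion `k`. -/
def leftMulK : R4 ≃ₗᵢ[ℝ] R4 := isometryOfNorm
  { toFun := fun x => !₂[-x 3, -x 2, x 1, x 0]
    map_add' := fun x y => by ext i; fin_cases i <;> simp <;> ring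
    map_smul' := fun c x => by ext i; fin_cases i <;> simp }
  fun x => norm_eq_of_coord (by simp; ring)

theorem integral_comp_isometry (L : R4 ≃ₗᵢ[ℝ] R4) (G : R4 → ℝ) :
    ∫ x, G (L x) = ∫ x, G x :=
  L.measurePreserving.integral_comp L.toHomeomorph.measurableEmbedding G

/-- A function whose average over the orthonormal frame `x, ix, jx, kx` vanishes has integral zero.
A radial function times a quadratic form of trace zero is of this kind. -/
theorem integral_eq_zero_of_frame {G : R4 → ℝ} (hG : Integrable G)
    (h : ∀ x, G x + G (leftMulI x) + G (leftMulJ x) + G (leftMulK x) = 0) : ∫ x, G x = 0 := by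
  have hL : ∀ L : R4 ≃ₗᵢ[ℝ] R4, Integrable (fun x => G (L x)) := fun L =>
    (L.measurePreserving.integrable_comp_emb L.toHomeomorph.measurableEmbedding).2 hG
  have h0 : ∫ x, (G x + G (leftMulI x) + G (leftMulJ x) + G (leftMulK x)) = 0 := by simp [h]
  have h1 : Integrable fun x => G x + G (leftMulI x) := hG.add (hL _)
  have h2 : Integrable fun x => G x + G (leftMulI x) + G (leftMulJ x) := h1.add (hL _)
  rw [integral_add h2 (hL _), integral_add h1 (hL _), integral_add hG (hL _)] at h0
  simp only [integral_comp_isometry] at h0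
  linarith

/-! ### Cut-off functions -/

/-- A smooth step whose derivative is a prescribed multiple of a nonnegative density. -/
theorem exists_smooth_step {f : ℝ → ℝ} {a b : ℝ} (hf : ContDiff ℝ ∞ f)
    (h0 : ∀ t, t ∉ Set.Ioo a b → f t = 0) (hI : 0 < ∫ t in a..b, f t) :
    ∃ S : ℝ → ℝ, ContDiff ℝ ∞ S ∧ (∀ t ≤ a, S t = 0) ∧ (∀ t, b ≤ t → S t = 1) ∧
      ∀ t, deriv S t = f t / ∫ t in a..b, f t := by
  set I := ∫ t in a..b, f t with hIdef
  have hd : ∀ t, HasDerivAt (fun t => (∫ u in a..t, f u) / I) (f t / I) t := fun t =>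
    (hf.continuous.integral_hasStrictDerivAt a t).hasDerivAt.div_const I
  have hde : deriv (fun t => (∫ u in a..t, f u) / I) = fun t => f t / I :=
    funext fun t => (hd t).deriv
  refine ⟨fun t => (∫ u in a..t, f u) / I, ?_, fun t ht => ?_, fun t ht => ?_, fun t => (hd t).deriv⟩
  · rw [contDiff_infty_iff_deriv, hde]
    exact ⟨fun t => (hd t).differentiableAt, hf.div_const I⟩
  · have : ∫ u in a..t, f u = ∫ u in a..t, (0 : ℝ) :=
      intervalIntegral.integral_congr fun u hu => h0 u fun h => by
        rw [Set.uIcc_of_ge ht] at hu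
        exact absurd h.1 (not_lt.2 hu.2)
    simp [this]
  · have e : ∫ u in b..t, f u = ∫ u in b..t, (0 : ℝ) :=
      intervalIntegral.integral_congr fun u hu => h0 u fun h => by
        rw [Set.uIcc_of_le ht] at hu
        exact absurd h.2 (not_lt.2 hu.1)
    have e2 := intervalIntegral.integral_add_adjacent_intervals
      (hf.continuous.intervalIntegrable (μ := volume) a b)
      (hf.continuous.intervalIntegrable (μ := volume) b t)
    simp only [e, intervalIntegral.integral_zero, add_zero] at e2
    simp only [← e2]
    exact div_self hI.ne'

/-- A pair of cut-offs in the variable `w = ‖x‖²`: `Φ` switches the given connection on between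
`w = 0.31²` and `w = 0.26`, then `Ψ` switches the instanton off between `w = 0.27` and `w = 1`. -/
structure IsCutoffPair (Φ Ψ : ℝ → ℝ) : Prop where
  smooth_left : ContDiff ℝ ∞ Φ
  smooth_right : ContDiff ℝ ∞ Ψ
  left_eq_zero : ∀ w ≤ 961 / 10000, Φ w = 0
  left_eq_one : ∀ w, 26 / 100 ≤ w → Φ w = 1
  right_eq_one : ∀ w ≤ 27 / 100, Ψ w = 1
  right_eq_zero : ∀ w, 99 / 100 ≤ w → Ψ w = 0

theorem intervalIntegral_eq_of_support {f : ℝ → ℝ} {a b c d : ℝ} (hf : Continuous f)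
    (hca : c ≤ a) (hbd : b ≤ d) (h0 : ∀ t, t ∉ Set.Ioo a b → f t = 0) :
    ∫ t in c..d, f t = ∫ t in a..b, f t := by
  have e1 : ∫ u in c..a, f u = ∫ u in c..a, (0 : ℝ) :=
    intervalIntegral.integral_congr fun u hu => h0 u fun h => by
      rw [Set.uIcc_of_le hca] at hu
      exact absurd h.1 (not_lt.2 hu.2)
  have e2 : ∫ u in b..d, f u = ∫ u in b..d, (0 : ℝ) :=
    intervalIntegral.integral_congr fun u hu => h0 u fun h => by
      rw [Set.uIcc_of_le hbd] at hu
      exact absurd h.2 (not_lt.2 hu.1)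
  have hi : ∀ s t, IntervalIntegrable f volume s t := fun s t => hf.intervalIntegrable s t
  rw [← intervalIntegral.integral_add_adjacent_intervals (hi c a) (hi a d),
    ← intervalIntegral.integral_add_adjacent_intervals (hi a b) (hi b d), e1, e2]
  simp

/-- Cut-offs with small energies. The derivatives are proportional to a bump and to `w` times a
bump; what matters is that the product of the two bounds is less than `2 / 9`. -/
theorem exists_cutoffPair : ∃ Φ Ψ : ℝ → ℝ, IsCutoffPair Φ Ψ ∧
    ∫ w in (0 : ℝ)..1, w ^ 3 * deriv Φ w ^ 2 ≤ 52 / 1000 ∧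
    ∫ w in (0 : ℝ)..1, deriv Ψ w ^ 2 / w ≤ 5 / 2 := by
  let f : ContDiffBump (175 / 1000 : ℝ) := ⟨75 / 1000, 789 / 10000, by norm_num, by norm_num⟩
  let g : ContDiffBump (625 / 1000 : ℝ) := ⟨325 / 1000, 355 / 1000, by norm_num, by norm_num⟩
  have f0 : ∀ t, t ∉ Set.Ioo (961 / 10000 : ℝ) (26 / 100) → f t = 0 := fun t ht =>
    f.zero_of_le_dist <| by
      by_contra! h
      have h : |t - 175 / 1000| < 789 / 10000 := h
      rw [abs_lt] at h
      exact ht ⟨by linarith, by linarith⟩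
  have g0 : ∀ t, t ∉ Set.Ioo (27 / 100 : ℝ) (99 / 100) → t * g t = 0 := fun t ht => by
    rw [g.zero_of_le_dist, mul_zero]
    by_contra! h
    have h : |t - 625 / 1000| < 355 / 1000 := h
    rw [abs_lt] at h
    exact ht ⟨by linarith, by linarith⟩
  have fI : 15 / 100 ≤ ∫ t in (961 / 10000 : ℝ)..(26 / 100), f t := by
    calc (15 / 100 : ℝ) = ∫ t in (1 / 10 : ℝ)..(1 / 4), (1 : ℝ) := by norm_num
      _ = ∫ t in (1 / 10 : ℝ)..(1 / 4), f t := by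
        refine intervalIntegral.integral_congr fun t ht => (f.one_of_mem_closedBall ?_).symm
        rw [Set.uIcc_of_le (by norm_num)] at ht
        change |t - 175 / 1000| ≤ 75 / 1000
        exact abs_le.2 ⟨by linarith [ht.1], by linarith [ht.2]⟩
      _ ≤ _ := intervalIntegral.integral_mono_interval (by norm_num) (by norm_num) (by norm_num)
        (.of_forall fun t => f.nonneg) (f.continuous.intervalIntegrable _ _)
  have gI : 2 / 5 ≤ ∫ t in (27 / 100 : ℝ)..(99 / 100), t * g t := by
    have hc : Continuous fun t => t * g t := continuous_id.mul g.continuous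
    calc (2 / 5 : ℝ) ≤ ∫ t in (3 / 10 : ℝ)..(95 / 100), t := by norm_num [integral_id]
      _ = ∫ t in (3 / 10 : ℝ)..(95 / 100), t * g t := by
        refine intervalIntegral.integral_congr fun t ht => ?_
        rw [Set.uIcc_of_le (by norm_num)] at ht
        have : g t = 1 := g.one_of_mem_closedBall <| by
          change |t - 625 / 1000| ≤ 325 / 1000
          exact abs_le.2 ⟨by linarith [ht.1], by linarith [ht.2]⟩
        simp [this]
      _ ≤ _ := by
        refine intervalIntegral.integral_mono_interval (by norm_num) (by norm_num) (by norm_num)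
          ?_ (hc.intervalIntegrable _ _)
        filter_upwards [ae_restrict_mem measurableSet_Ioc] with t ht
        exact mul_nonneg (by linarith [ht.1]) g.nonneg
  obtain ⟨S, hS, S0, S1, dS⟩ := exists_smooth_step f.contDiff f0 (by linarith)
  obtain ⟨T, hT, T0, T1, dT⟩ := exists_smooth_step (contDiff_id.mul g.contDiff) g0 (by
    change 0 < ∫ t in (27 / 100 : ℝ)..(99 / 100), t * g t
    linarith)
  refine ⟨S, fun w => 1 - T w, ⟨hS, contDiff_const.sub hT, S0, S1, fun w hw => ?_,
    fun w hw => ?_⟩, ?_, ?_⟩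
  · simp [T0 w hw]
  · simp [T1 w hw]
  · set I := ∫ t in (961 / 10000 : ℝ)..(26 / 100), f t
    have hc : Continuous fun w => w ^ 3 * deriv S w ^ 2 := by
      simp only [dS]
      exact (continuous_pow 3).mul ((f.continuous.div_const I).pow 2)
    have hsub : ∫ w in (0 : ℝ)..1, w ^ 3 * deriv S w ^ 2 =
        ∫ w in (0 : ℝ)..(26 / 100), w ^ 3 * deriv S w ^ 2 := by
      have h : ∀ t, t ∉ Set.Ioo (961 / 10000 : ℝ) (26 / 100) → t ^ 3 * deriv S t ^ 2 = 0 :=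
        fun t ht => by simp [dS, f0 t ht]
      exact (intervalIntegral_eq_of_support hc (by norm_num) (by norm_num) h).trans
        (intervalIntegral_eq_of_support hc (by norm_num) le_rfl h).symm
    rw [hsub]
    calc ∫ w in (0 : ℝ)..(26 / 100), w ^ 3 * deriv S w ^ 2
        ≤ ∫ w in (0 : ℝ)..(26 / 100), w ^ 3 * (1 / (15 / 100)) ^ 2 := by
          refine intervalIntegral.integral_mono_on (by norm_num) (hc.intervalIntegrable _ _)
            (Continuous.intervalIntegrable (by fun_prop) _ _) fun w hw => ?_
          have hw0 : 0 ≤ w := hw.1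
          have h1 : f w / I ≤ 1 / (15 / 100) :=
            div_le_div₀ zero_le_one f.le_one (by norm_num) fI
          have h2 : 0 ≤ f w / I := div_nonneg f.nonneg (by linarith)
          rw [dS]
          gcongr
      _ ≤ 52 / 1000 := by
          rw [intervalIntegral.integral_mul_const, integral_pow]
          norm_num
  · set I := ∫ t in (27 / 100 : ℝ)..(99 / 100), t * g t with hI
    have dT' : ∀ t, deriv (fun w => 1 - T w) t = -(t * g t / I) := fun t => by
      rw [deriv_const_sub, dT]; rfl
    have hc : Continuous fun t => t * g t := continuous_id.mul g.continuous
    have e1 : (fun w => deriv (fun w => 1 - T w) w ^ 2 / w) = fun w => w * g w ^ 2 / I ^ 2 := by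
      funext w
      rw [dT']
      rcases eq_or_ne w 0 with rfl | hw
      · simp
      · field_simp
    rw [e1]
    calc ∫ w in (0 : ℝ)..1, w * g w ^ 2 / I ^ 2
        ≤ ∫ w in (0 : ℝ)..1, w * g w / I ^ 2 := by
          refine intervalIntegral.integral_mono_on (by norm_num)
            (((continuous_id.mul (g.continuous.pow 2)).div_const _).intervalIntegrable _ _)
            ((hc.div_const _).intervalIntegrable _ _) fun w hw => ?_
          have hw0 : 0 ≤ w := hw.1
          have : g w ^ 2 ≤ g w := by
            have := g.le_one (x := w)
            have := g.nonneg (x := w)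
            nlinarith
          gcongr
      _ = 1 / I := by
          rw [intervalIntegral.integral_div,
            intervalIntegral_eq_of_support hc (by norm_num) (by norm_num) g0, ← hI]
          have : I ≠ 0 := by linarith
          field_simp
      _ ≤ 5 / 2 := by
          rw [div_le_iff₀ (by linarith)]
          linarith

/-! ### Radial multiples of one-forms -/

/-- The components of `dA` for a form `A` with derivative `p` at the given point. -/
def extDeriv (p : R4 →L[ℝ] R4 →L[ℝ] ℍ[ℝ]) : TwoCovector := fun i j =>
  p (stdVec i) (stdVec j) - p (stdVec j) (stdVec i)

/-- The components of `⟨x, dx⟩ ∧ a`. -/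
def radialWedge (x : R4) (a : R4 →L[ℝ] ℍ[ℝ]) : TwoCovector := fun i j =>
  x i • a (stdVec j) - x j • a (stdVec i)

/-- The components of `a ∧ b`, the products being taken in the quaternions. -/
def mulWedge (a b : R4 →L[ℝ] ℍ[ℝ]) : TwoCovector := fun i j =>
  a (stdVec i) * b (stdVec j) - a (stdVec j) * b (stdVec i)

theorem asdPart_add (α β : TwoCovector) : asdPart (α + β) = asdPart α + asdPart β := by
  funext a
  fin_cases a <;> simp [asdPart] <;> abel

theorem asdPart_smul (c : ℝ) (α : TwoCovector) : asdPart (c • α) = c • asdPart α := by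
  funext a
  fin_cases a <;> simp [asdPart, smul_sub]

theorem curvature_eq (A : OneForm) (x : R4) :
    curvature A x = extDeriv (fderiv ℝ A x) + mulWedge (A x) (A x) := rfl

theorem hasFDerivAt_norm_sq_comp {f : ℝ → ℝ} {x : R4} (hf : DifferentiableAt ℝ f (‖x‖ ^ 2)) :
    HasFDerivAt (fun y : R4 => f (‖y‖ ^ 2)) ((2 * deriv f (‖x‖ ^ 2)) • innerSL ℝ x) x := by
  have := hf.hasDerivAt.comp_hasFDerivAt x (hasStrictFDerivAt_norm_sq x).hasFDerivAt
  refine this.congr_fderiv ?_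
  ext v
  simp
  ring

theorem inner_stdVec (x : R4) (i : Fin 4) : inner ℝ x (stdVec i) = x i := by
  simp [EuclideanSpace.inner_single_right]

/-- The curvature of `f A + h B` for radial functions `f` and `h`. -/
theorem curvature_radial_add {f h : ℝ → ℝ} {A B C : OneForm} {x : R4}
    (hC : ∀ y v, C y v = f (‖y‖ ^ 2) • A y v + h (‖y‖ ^ 2) • B y v)
    (hf : DifferentiableAt ℝ f (‖x‖ ^ 2)) (hA : DifferentiableAt ℝ A x)
    (hh : DifferentiableAt ℝ h (‖x‖ ^ 2)) (hB : DifferentiableAt ℝ B x)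
    (hCx : DifferentiableAt ℝ C x) :
    curvature C x =
      f (‖x‖ ^ 2) • extDeriv (fderiv ℝ A x) + (2 * deriv f (‖x‖ ^ 2)) • radialWedge x (A x)
      + f (‖x‖ ^ 2) ^ 2 • mulWedge (A x) (A x)
      + (h (‖x‖ ^ 2) • extDeriv (fderiv ℝ B x) + (2 * deriv h (‖x‖ ^ 2)) • radialWedge x (B x)
      + h (‖x‖ ^ 2) ^ 2 • mulWedge (B x) (B x))
      + (f (‖x‖ ^ 2) * h (‖x‖ ^ 2)) • (mulWedge (A x) (B x) + mulWedge (B x) (A x)) := by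
  have key : ∀ X Y, fderiv ℝ C x X Y =
      f (‖x‖ ^ 2) • fderiv ℝ A x X Y + (2 * deriv f (‖x‖ ^ 2) * inner ℝ x X) • A x Y
      + (h (‖x‖ ^ 2) • fderiv ℝ B x X Y + (2 * deriv h (‖x‖ ^ 2) * inner ℝ x X) • B x Y) := by
    intro X Y
    have e1 := ((hasFDerivAt_norm_sq_comp hf).smul (hasFDerivAt_eval hA Y)).add
      ((hasFDerivAt_norm_sq_comp hh).smul (hasFDerivAt_eval hB Y))
    have e2 := (hasFDerivAt_eval hCx Y).unique
      (e1.congr_of_eventuallyEq (.of_forall fun y => hC y Y))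
    have e3 := congrArg (fun l => l X) e2
    simpa using e3
  rw [curvature_eq]
  funext i j
  simp only [extDeriv, mulWedge, radialWedge, Pi.add_apply, Pi.smul_apply, key, hC, inner_stdVec,
    mul_add, add_mul, smul_mul_smul_comm, smul_sub, smul_add]
  simp only [smul_smul, sq, mul_comm (h (‖x‖ * ‖x‖)) (f (‖x‖ * ‖x‖))]
  abel

/-! ### The two basic one-forms -/

/-- The identification with the quaternions as a continuous linear map. -/
def toQuatL : R4 →L[ℝ] ℍ[ℝ] :=
  LinearMap.toContinuousLinearMap
    { toFun := toQuat, map_add' := toQuat_add, map_smul' := toQuat_smul }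

@[simp] theorem toQuatL_apply (x : R4) : toQuatL x = toQuat x := rfl

/-- The imaginary part as a continuous linear map. -/
def imL : ℍ[ℝ] →L[ℝ] ℍ[ℝ] :=
  LinearMap.toContinuousLinearMap
    { toFun := fun q => q.im, map_add' := fun p q => by simp, map_smul' := fun c q => by simp }

@[simp] theorem imL_apply (q : ℍ[ℝ]) : imL q = q.im := rfl

/-- The one-form `Im (x̄ dx)`, as a bilinear map. Its exterior derivative is anti-self-dual. -/
def asdForm : R4 →L[ℝ] R4 →L[ℝ] ℍ[ℝ] :=
  LinearMap.toContinuousLinearMap (LinearMap.toContinuousLinearMap.toLinearMap ∘ₗ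
    LinearMap.mk₂ ℝ (fun x v : R4 => (star (toQuat x) * toQuat v).im)
      (fun x y v => by simp [toQuat_add, add_mul]) (fun c x v => by simp [toQuat_smul])
      (fun x v w => by simp [toQuat_add, mul_add]) (fun c x v => by simp [toQuat_smul]))

@[simp] theorem asdForm_apply (x v : R4) : asdForm x v = (star (toQuat x) * toQuat v).im := rfl

/-- The one-form `Im (x dx̄)`, as a bilinear map. Its exterior derivative is self-dual. -/
def sdForm : R4 →L[ℝ] R4 →L[ℝ] ℍ[ℝ] :=
  LinearMap.toContinuousLinearMap (LinearMap.toContinuousLinearMap.toLinearMap ∘ₗ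
    LinearMap.mk₂ ℝ (fun x v : R4 => (toQuat x * star (toQuat v)).im)
      (fun x y v => by simp [toQuat_add, add_mul]) (fun c x v => by simp [toQuat_smul])
      (fun x v w => by simp [toQuat_add, mul_add]) (fun c x v => by simp [toQuat_smul]))

@[simp] theorem sdForm_apply (x v : R4) : sdForm x v = (toQuat x * star (toQuat v)).im := rfl

/-- The imaginary units `i, j, k`. -/
def imagUnit : Fin 3 → ℍ[ℝ] := ![⟨0, 1, 0, 0⟩, ⟨0, 0, 1, 0⟩, ⟨0, 0, 0, 1⟩]

@[simp] theorem toQuat_re (x : R4) : (toQuat x).re = x 0 := rfl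
@[simp] theorem toQuat_imI (x : R4) : (toQuat x).imI = x 1 := rfl
@[simp] theorem toQuat_imJ (x : R4) : (toQuat x).imJ = x 2 := rfl
@[simp] theorem toQuat_imK (x : R4) : (toQuat x).imK = x 3 := rfl

@[simp] theorem imagUnit_re (a : Fin 3) : (imagUnit a).re = 0 := by fin_cases a <;> rfl
@[simp] theorem imagUnit_imI (a : Fin 3) : (imagUnit a).imI = ![1, 0, 0] a := by
  fin_cases a <;> rfl
@[simp] theorem imagUnit_imJ (a : Fin 3) : (imagUnit a).imJ = ![0, 1, 0] a := by
  fin_cases a <;> rfl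
@[simp] theorem imagUnit_imK (a : Fin 3) : (imagUnit a).imK = ![0, 0, 1] a := by
  fin_cases a <;> rfl

/-- The anti-self-dual part of the curvature of `η Im (x̄ dx)`. -/
theorem asdPart_radial_asdForm (x : R4) (c c' : ℝ) :
    asdPart (c • extDeriv asdForm + (2 * c') • radialWedge x (asdForm x)
      + c ^ 2 • mulWedge (asdForm x) (asdForm x)) =
    (4 * (c + ‖x‖ ^ 2 * c' / 2 - ‖x‖ ^ 2 * c ^ 2 / 2)) • imagUnit := by
  funext a
  fin_cases a <;> ext <;>
    simp [asdPart, extDeriv, radialWedge, mulWedge, norm_sq_coord] <;> ring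

/-- The Chern–Weil density of `m Im (x dx̄)`. -/
theorem traceWedge_radial_sdForm {m : ℝ → ℝ} {C : OneForm} {x : R4}
    (hC : ∀ y v, C y v = m (‖y‖ ^ 2) • sdForm y v)
    (hm : DifferentiableAt ℝ m (‖x‖ ^ 2)) (hCx : DifferentiableAt ℝ C x) :
    traceWedge (curvature C x) (curvature C x) =
    -48 * (m (‖x‖ ^ 2) * (1 - ‖x‖ ^ 2 * m (‖x‖ ^ 2)) *
      (m (‖x‖ ^ 2) + ‖x‖ ^ 2 * deriv m (‖x‖ ^ 2))) := by
  have e := curvature_radial_add (f := fun _ => 0) (h := m) (A := fun _ => 0) (B := sdForm) (x := x)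
    (C := C) (fun y v => by rw [hC, zero_smul, zero_add])
    (differentiableAt_const _) (differentiableAt_const _) hm sdForm.differentiableAt hCx
  simp only [zero_smul, zero_add, ContinuousLinearMap.fderiv, deriv_const, mul_zero, zero_mul, ne_eq,
    OfNat.ofNat_ne_zero, not_false_eq_true, zero_pow, add_zero] at e
  rw [traceWedge_self (curvature_antisymm _ x), e]
  generalize m (‖x‖ ^ 2) = c
  generalize deriv m (‖x‖ ^ 2) = c'
  rw [norm_sq_coord]
  simp [extDeriv, radialWedge, mulWedge]
  ring

/-! ### The glued connection form -/

/-- The coefficient of `Im (x dx̄)` in the glued form, in the variable `w = ‖x‖²`. It equals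
`1 / (β + w)`, the coefficient of an instanton of scale `1 / √β`, as long as `Ψ = 1`, and `1 / w`,
which makes the form pure gauge, where `Ψ = 0`. -/
def gluedCoeff (Ψ : ℝ → ℝ) (β w : ℝ) : ℝ := (1 + β * ((1 - Ψ w) / w)) / (β + w)

/-- The coefficient of `Im (x̄ dx)` in the cut off instanton in singular gauge. -/
def tailCoeff (Ψ : ℝ → ℝ) (β w : ℝ) : ℝ := Ψ w * β / (w * (β + w))

/-- The glued connection form: the instanton of scale `1 / √β` near the origin, and the form `A`
conjugated by `x / ‖x‖` plus a pure gauge term for `‖x‖ ≥ 1`. -/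
def gluedForm (Φ Ψ : ℝ → ℝ) (β : ℝ) (A : OneForm) : OneForm := fun x =>
  LinearMap.toContinuousLinearMap
    { toFun := fun v => (Φ (‖x‖ ^ 2) / ‖x‖ ^ 2) • (toQuat x * A x v * star (toQuat x)) +
        gluedCoeff Ψ β (‖x‖ ^ 2) • sdForm x v
      map_add' := fun v w => by simp only [map_add, mul_add, add_mul, smul_add]; abel
      map_smul' := fun c v => by
        simp only [map_smul, mul_smul_comm, smul_mul_assoc, smul_add, RingHom.id_apply,
          smul_comm c] }

/-- The glued form in the gauge in which the instanton decays: the superposition of the cut off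
forms `Φ A` and `tailCoeff · Im (x̄ dx)`. It is singular at the origin. -/
def singularForm (Φ Ψ : ℝ → ℝ) (β : ℝ) (A : OneForm) : OneForm := fun x =>
  LinearMap.toContinuousLinearMap
    { toFun := fun v => Φ (‖x‖ ^ 2) • A x v + tailCoeff Ψ β (‖x‖ ^ 2) • asdForm x v
      map_add' := fun v w => by simp only [map_add, smul_add]; abel
      map_smul' := fun c v => by
        simp only [map_smul, smul_add, RingHom.id_apply, smul_comm c] }

theorem gluedForm_apply (Φ Ψ : ℝ → ℝ) (β : ℝ) (A : OneForm) (x v : R4) :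
    gluedForm Φ Ψ β A x v =
      (Φ (‖x‖ ^ 2) / ‖x‖ ^ 2) • (toQuat x * A x v * star (toQuat x)) +
        gluedCoeff Ψ β (‖x‖ ^ 2) • sdForm x v := rfl

theorem singularForm_apply (Φ Ψ : ℝ → ℝ) (β : ℝ) (A : OneForm) (x v : R4) :
    singularForm Φ Ψ β A x v =
      Φ (‖x‖ ^ 2) • A x v + tailCoeff Ψ β (‖x‖ ^ 2) • asdForm x v := rfl

/-- At `w = 0` the quotient has the value `0 / 0 = 0`, in agreement with its values nearby. -/
theorem contDiff_div_id {f : ℝ → ℝ} (hf : ContDiff ℝ ∞ f) {a : ℝ} (ha : 0 < a)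
    (h0 : ∀ w ≤ a, f w = 0) : ContDiff ℝ ∞ fun w => f w / w := by
  refine contDiff_iff_contDiffAt.2 fun w => ?_
  rcases eq_or_ne w 0 with rfl | hw
  · refine (contDiffAt_const (c := (0 : ℝ))).congr_of_eventuallyEq ?_
    filter_upwards [Iio_mem_nhds ha] with t ht
    simp [h0 t (le_of_lt ht)]
  · exact hf.contDiffAt.div contDiffAt_id hw

theorem contDiff_radial {f : ℝ → ℝ} (hf : ContDiff ℝ ∞ f) :
    ContDiff ℝ ∞ fun x : R4 => f (‖x‖ ^ 2) := hf.comp (contDiff_norm_sq ℝ)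

theorem norm_toQuat (x : R4) : ‖toQuat x‖ = ‖x‖ := by
  rw [← sq_eq_sq₀ (norm_nonneg _) (norm_nonneg _), norm_sq_coord, norm_sq_eq]
  rfl

theorem two_le_infty : (2 : WithTop ℕ∞) ≤ ∞ := WithTop.coe_le_coe.2 le_top

section glued

variable {Φ Ψ : ℝ → ℝ} {β : ℝ} {A : OneForm}

theorem contDiff_gluedCoeff (hc : IsCutoffPair Φ Ψ) (hβ : 0 < β) :
    ContDiff ℝ ∞ fun x : R4 => gluedCoeff Ψ β (‖x‖ ^ 2) := by
  have h1 : ContDiff ℝ ∞ fun x : R4 => (1 - Ψ (‖x‖ ^ 2)) / ‖x‖ ^ 2 :=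
    contDiff_radial (contDiff_div_id (contDiff_const.sub hc.smooth_right)
      (a := 27 / 100) (by norm_num) fun w hw => by simp [hc.right_eq_one w hw])
  exact (contDiff_const.add (contDiff_const.mul h1)).div
    (contDiff_const.add (contDiff_norm_sq ℝ)) fun x => by positivity

theorem isConnectionForm_gluedForm (hc : IsCutoffPair Φ Ψ) (hβ : 0 < β)
    (hA : IsConnectionForm A) : IsConnectionForm (gluedForm Φ Ψ β A) := by
  refine ⟨contDiff_clm_apply_iff.2 fun v => ?_, fun x v => ?_⟩
  · have h1 : ContDiff ℝ ∞ fun x : R4 => Φ (‖x‖ ^ 2) / ‖x‖ ^ 2 :=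
      contDiff_radial (contDiff_div_id hc.smooth_left (by norm_num) hc.left_eq_zero)
    have h2 : ContDiff ℝ ∞ fun x : R4 => toQuat x := toQuatL.contDiff
    have h3 : ContDiff ℝ ∞ fun x : R4 => star (toQuat x) := (starCLM.comp toQuatL).contDiff
    have h4 : ContDiff ℝ ∞ fun x : R4 => sdForm x v := (sdForm.flip v).contDiff
    simp only [gluedForm_apply]
    exact (h1.smul ((h2.mul (hA.1.clm_apply contDiff_const)).mul h3)).add
      ((contDiff_gluedCoeff hc hβ).smul h4)
  · have e : (toQuat x * A x v * star (toQuat x)).re = 0 := by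
      have h := hA.2 x v
      simp [h]
      ring
    rw [gluedForm_apply, Quaternion.re_add, Quaternion.re_smul, e]
    simp

theorem contDiffOn_singularForm (hc : IsCutoffPair Φ Ψ) (hβ : 0 < β)
    (hA : IsConnectionForm A) : ContDiffOn ℝ ∞ (singularForm Φ Ψ β A) {0}ᶜ := by
  refine contDiffOn_clm_apply.2 fun v => ?_
  have h1 : ContDiffOn ℝ ∞ (fun x : R4 => tailCoeff Ψ β (‖x‖ ^ 2)) {0}ᶜ := by
    refine ContDiffOn.div ((contDiff_radial hc.smooth_right).mul contDiff_const).contDiffOn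
      ((contDiff_norm_sq ℝ).mul (contDiff_const.add (contDiff_norm_sq ℝ))).contDiffOn
      fun x hx => ?_
    have : 0 < ‖x‖ := norm_pos_iff.2 hx
    positivity
  simp only [singularForm_apply]
  exact ((contDiff_radial hc.smooth_left).smul (hA.1.clm_apply contDiff_const)).contDiffOn.add
    (h1.smul (asdForm.flip v).contDiff.contDiffOn)

/-- The `SU(2)`-valued map `x̄ / ‖x‖`, of degree one on spheres, that relates the two gauges. -/
def radialGauge (x : R4) : ℍ[ℝ] := ‖x‖⁻¹ • star (toQuat x)

theorem norm_radialGauge {x : R4} (hx : x ≠ 0) : ‖radialGauge x‖ = 1 := by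
  rw [radialGauge, norm_smul, Quaternion.norm_star, norm_toQuat, norm_inv, norm_norm,
    inv_mul_cancel₀ (norm_ne_zero_iff.2 hx)]

theorem contDiffOn_radialGauge : ContDiffOn ℝ ∞ radialGauge {0}ᶜ := by
  have h : ContDiffOn ℝ ∞ (fun x : R4 => ‖x‖⁻¹) {0}ᶜ := fun x hx =>
    ((contDiffAt_norm ℝ hx).inv (norm_ne_zero_iff.2 hx)).contDiffWithinAt
  exact h.smul (starCLM.comp toQuatL).contDiff.contDiffOn

theorem radialGauge_inv {x : R4} (hx : x ≠ 0) : (radialGauge x)⁻¹ = ‖x‖⁻¹ • toQuat x := by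
  rw [inv_eq_star (norm_radialGauge hx), radialGauge]
  ext <;> simp

theorem radialGauge_inv_mul_fderiv {x : R4} (hx : x ≠ 0) (v : R4) :
    (radialGauge x)⁻¹ * fderiv ℝ radialGauge x v = (‖x‖ ^ 2)⁻¹ • sdForm x v := by
  have hU : ({0}ᶜ : Set R4) ∈ 𝓝 x := isOpen_compl_singleton.mem_nhds hx
  have hd : DifferentiableAt ℝ radialGauge x :=
    (contDiffOn_radialGauge.contDiffAt hU).differentiableAt (by simp)
  have hre := re_inv_mul_fderiv hd (Filter.mem_of_superset hU fun y hy => norm_radialGauge hy) v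
  have hn : HasFDerivAt (fun y : R4 => ‖y‖⁻¹) (fderiv ℝ (fun y : R4 => ‖y‖⁻¹) x) x :=
    (((contDiffAt_norm ℝ hx).inv (norm_ne_zero_iff.2 hx)).differentiableAt (n := 1)
      one_ne_zero).hasFDerivAt
  have e := congrArg (fun l => l v)
    (hd.hasFDerivAt.unique (hn.smul ((starCLM.comp toQuatL).hasFDerivAt (x := x))))
  generalize fderiv ℝ (fun y : R4 => ‖y‖⁻¹) x = l at e
  simp only [add_apply, smul_apply, ContinuousLinearMap.smulRight_apply,
    ContinuousLinearMap.comp_apply, toQuatL_apply, starCLM_apply] at e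
  rw [e, radialGauge_inv hx] at hre ⊢
  have h0 : ‖x‖ ≠ 0 := norm_ne_zero_iff.2 hx
  ext
  · rw [hre]; simp
  all_goals
    simp
    field_simp
    ring

/-- Away from the origin the glued form is the gauge transform of the singular form. -/
theorem gluedForm_eq_gauge (hβ : 0 < β) {x : R4} (hx : x ≠ 0) (v : R4) :
    gluedForm Φ Ψ β A x v = (radialGauge x)⁻¹ * singularForm Φ Ψ β A x v * radialGauge x +
      (radialGauge x)⁻¹ * fderiv ℝ radialGauge x v := by
  have h0 : 0 < ‖x‖ := norm_pos_iff.2 hx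
  have e1 : toQuat x * asdForm x v * star (toQuat x) = -(‖x‖ ^ 2) • sdForm x v := by
    ext <;> simp [norm_sq_coord] <;> ring
  have e2 : gluedCoeff Ψ β (‖x‖ ^ 2) = (‖x‖ ^ 2)⁻¹ - tailCoeff Ψ β (‖x‖ ^ 2) := by
    have : β + ‖x‖ ^ 2 ≠ 0 := by positivity
    rw [gluedCoeff, tailCoeff]
    field_simp
    ring
  rw [radialGauge_inv_mul_fderiv hx, radialGauge_inv hx, gluedForm_apply, singularForm_apply,
    radialGauge, e2]
  simp only [mul_add, add_mul, smul_mul_assoc, mul_smul_comm, smul_add, e1, smul_smul, sub_smul]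
  have e3 : ‖x‖⁻¹ * (Φ (‖x‖ ^ 2) * ‖x‖⁻¹) = Φ (‖x‖ ^ 2) / ‖x‖ ^ 2 := by field_simp
  have e4 : ‖x‖⁻¹ * (tailCoeff Ψ β (‖x‖ ^ 2) * ‖x‖⁻¹ * -‖x‖ ^ 2) =
    -tailCoeff Ψ β (‖x‖ ^ 2) := by field_simp
  rw [e3, e4, neg_smul]
  abel

theorem gluedForm_eq_sdInstanton (hc : IsCutoffPair Φ Ψ) {lam : ℝ} (hlam : lam ^ 2 * β = 1)
    {x : R4} (hx : ‖x‖ < 31 / 100) : sdInstanton lam x = gluedForm Φ Ψ β A x := by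
  have hw : ‖x‖ ^ 2 ≤ 961 / 10000 := by nlinarith [norm_nonneg x]
  have hl : lam ^ 2 ≠ 0 := fun h => by simp [h] at hlam
  have hβ : β = 1 / lam ^ 2 := eq_div_of_mul_eq hl (by linarith)
  ext v : 1
  rw [gluedForm_apply, hc.left_eq_zero _ hw, gluedCoeff, hc.right_eq_one _ (by linarith), hβ]
  change (lam ^ 2 / (1 + lam ^ 2 * ‖x‖ ^ 2)) • (toQuat x * star (toQuat v)).im = _
  rw [zero_div, zero_smul, zero_add, sdForm_apply]
  congr 1
  have h1 : 0 < lam ^ 2 := by positivity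
  have h2 : 1 / lam ^ 2 + ‖x‖ ^ 2 ≠ 0 := by positivity
  rw [sub_self, zero_div, mul_zero, add_zero, div_eq_div_iff (by positivity) h2, mul_add,
    mul_one_div_cancel hl, one_mul]

theorem singularForm_eq_self (hc : IsCutoffPair Φ Ψ) {x : R4} (hx : 99 / 100 ≤ ‖x‖ ^ 2) :
    singularForm Φ Ψ β A x = A x := by
  ext v : 1
  rw [singularForm_apply, hc.left_eq_one _ (by linarith), tailCoeff, hc.right_eq_zero _ hx]
  simp

theorem gaugeEquivOn_gluedForm (hc : IsCutoffPair Φ Ψ) (hβ : 0 < β) :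
    GaugeEquivOn (Metric.ball (0 : R4) 1)ᶜ A (gluedForm Φ Ψ β A) := by
  have hs : (Metric.ball (0 : R4) 1)ᶜ ⊆ {0}ᶜ :=
    Set.compl_subset_compl.2 (by simp)
  refine ⟨{0}ᶜ, radialGauge, isOpen_compl_singleton, hs, contDiffOn_radialGauge,
    fun x hx => norm_radialGauge hx, fun x hx v => ?_⟩
  have : 1 ≤ ‖x‖ := by simpa using hx
  rw [gluedForm_eq_gauge hβ (hs hx), singularForm_eq_self hc (by nlinarith)]

theorem gluedForm_invariants (hc : IsCutoffPair Φ Ψ) (hβ : 0 < β) (hA : IsConnectionForm A)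
    {x : R4} (hx : x ≠ 0) :
    tripleNormSq (asdPart (curvature (gluedForm Φ Ψ β A) x)) =
      tripleNormSq (asdPart (curvature (singularForm Φ Ψ β A) x)) ∧
    tripleNormSq (sdPart (curvature (gluedForm Φ Ψ β A) x)) =
      tripleNormSq (sdPart (curvature (singularForm Φ Ψ β A) x)) ∧
    traceWedge (curvature (gluedForm Φ Ψ β A) x) (curvature (gluedForm Φ Ψ β A) x) =
      traceWedge (curvature (singularForm Φ Ψ β A) x) (curvature (singularForm Φ Ψ β A) x) := by
  have hU : ({0}ᶜ : Set R4) ∈ 𝓝 x := isOpen_compl_singleton.mem_nhds hx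
  refine gauge_invariants (g := radialGauge)
    (((contDiffOn_singularForm hc hβ hA).contDiffAt hU).differentiableAt (by simp))
    ((isConnectionForm_gluedForm hc hβ hA).differentiable x)
    ((contDiffOn_radialGauge.contDiffAt hU).of_le two_le_infty)
    (fun h => by simpa [h] using norm_radialGauge hx)
    (Filter.mem_of_superset hU fun y hy v => gluedForm_eq_gauge hβ hy v)

/-- The anti-self-dual part of the curvature of the singular form. The instanton alone is
self-dual, so the coefficient of `imagUnit` involves the cut-off only. -/
theorem asdPart_singularForm (hc : IsCutoffPair Φ Ψ) (hβ : 0 < β) (hA : IsConnectionForm A)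
    {x : R4} (hx : x ≠ 0) :
    asdPart (curvature (singularForm Φ Ψ β A) x) =
      Φ (‖x‖ ^ 2) • asdPart (extDeriv (fderiv ℝ A x))
      + (2 * deriv Φ (‖x‖ ^ 2)) • asdPart (radialWedge x (A x))
      + Φ (‖x‖ ^ 2) ^ 2 • asdPart (mulWedge (A x) (A x))
      + (2 * (deriv Ψ (‖x‖ ^ 2) * β / (β + ‖x‖ ^ 2) +
          β ^ 2 * (Ψ (‖x‖ ^ 2) * (1 - Ψ (‖x‖ ^ 2))) / (‖x‖ ^ 2 * (β + ‖x‖ ^ 2) ^ 2))) • imagUnit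
      + (Φ (‖x‖ ^ 2) * tailCoeff Ψ β (‖x‖ ^ 2)) •
        asdPart (mulWedge (A x) (asdForm x) + mulWedge (asdForm x) (A x)) := by
  have hU : ({0}ᶜ : Set R4) ∈ 𝓝 x := isOpen_compl_singleton.mem_nhds hx
  have hw : 0 < ‖x‖ ^ 2 := by have := norm_pos_iff.2 hx; positivity
  have hd : HasDerivAt (tailCoeff Ψ β) _ (‖x‖ ^ 2) :=
    (((hc.smooth_right.differentiable (by simp) (‖x‖ ^ 2)).hasDerivAt).mul_const β).fun_div
      ((hasDerivAt_id' (‖x‖ ^ 2)).fun_mul ((hasDerivAt_id' (‖x‖ ^ 2)).const_add β)) (by positivity)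
  rw [curvature_radial_add (singularForm_apply Φ Ψ β A)
    (hc.smooth_left.differentiable (by simp) _) (hA.differentiable x) hd.differentiableAt
    asdForm.differentiableAt
    (((contDiffOn_singularForm hc hβ hA).contDiffAt hU).differentiableAt (by simp)),
    asdPart_add, asdPart_add, ContinuousLinearMap.fderiv, asdPart_radial_asdForm, asdPart_add,
    asdPart_add, asdPart_smul, asdPart_smul, asdPart_smul, asdPart_smul, hd.deriv]
  congr 3
  simp only [tailCoeff]
  have : 0 < β + ‖x‖ ^ 2 := by positivity
  field_simp
  ring

end glued

/-! ### Chern number and energy of the glued form -/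

theorem curvature_congr {A B : OneForm} {x : R4} (h : A =ᶠ[𝓝 x] B) :
    curvature A x = curvature B x := by
  rw [curvature_eq, curvature_eq, h.fderiv_eq, h.eq_of_nhds]

theorem chernSimonsField_congr {A B : OneForm} {x : R4} (h : A =ᶠ[𝓝 x] B) (i : Fin 4) :
    chernSimonsField A i x = chernSimonsField B i x := by
  have : ∀ j k l, chernSimons A j k l x = chernSimons B j k l x := fun j k l => by
    simp only [chernSimons, h.fderiv_eq, h.eq_of_nhds]
  fin_cases i <;> simp [chernSimonsField, this]

theorem chernSimonsField_zero (i : Fin 4) (x : R4) :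
    chernSimonsField (fun _ => 0) i x = 0 := by
  fin_cases i <;> simp [chernSimonsField, chernSimons]

theorem contDiffAt_chernSimonsField {A : OneForm} {x : R4} (hA : ContDiffAt ℝ 2 A x) (i : Fin 4) :
    ContDiffAt ℝ 1 (chernSimonsField A i) x := by
  have ha : ∀ i, ContDiffAt ℝ 1 (fun y => A y (stdVec i)) x := fun i =>
    (hA.of_le one_le_two).clm_apply contDiffAt_const
  have hd : ∀ i j, ContDiffAt ℝ 1 (fun y => fderiv ℝ A y (stdVec i) (stdVec j)) x := fun i j =>
    ((hA.fderiv_right (m := 1) (by norm_num)).clm_apply contDiffAt_const).clm_apply contDiffAt_const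
  have h : ∀ j k l, ContDiffAt ℝ 1 (chernSimons A j k l) x := fun j k l =>
    contDiffAt_const.mul (reL.contDiff.contDiffAt.comp x
      (((((ha j).mul ((hd k l).sub (hd l k))).add ((ha k).mul ((hd l j).sub (hd j l)))).add
        ((ha l).mul ((hd j k).sub (hd k j)))).add
        (((ha j).mul (((ha k).mul (ha l)).sub ((ha l).mul (ha k)))).const_smul (2 : ℝ))))
  fin_cases i
  · exact h 1 2 3
  · exact (h 0 2 3).neg
  · exact h 0 1 3
  · exact (h 0 1 2).neg

theorem IsConnectionForm.continuous_curvature {A : OneForm} (hA : IsConnectionForm A) (i j : Fin 4) :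
    Continuous fun x => curvature A x i j := by
  have ha : ∀ i, Continuous fun y => A y (stdVec i) := fun i =>
    hA.1.continuous.clm_apply continuous_const
  have hd : ∀ i j, Continuous fun y => fderiv ℝ A y (stdVec i) (stdVec j) := fun i j =>
    ((hA.1.continuous_fderiv (by simp)).clm_apply continuous_const).clm_apply continuous_const
  exact ((hd i j).sub (hd j i)).add (((ha i).mul (ha j)).sub ((ha j).mul (ha i)))

theorem IsConnectionForm.continuous_asd {A : OneForm} (hA : IsConnectionForm A) :
    Continuous fun x => tripleNormSq (asdPart (curvature A x)) := by
  have h := hA.continuous_curvature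
  simp only [tripleNormSq, asdPart, Fin.sum_univ_three, Matrix.cons_val]
  exact ((((h 0 1).sub (h 2 3)).norm.pow 2).add (((h 0 2).add (h 1 3)).norm.pow 2)).add
    (((h 0 3).sub (h 1 2)).norm.pow 2)

theorem IsConnectionForm.continuous_sd {A : OneForm} (hA : IsConnectionForm A) :
    Continuous fun x => tripleNormSq (sdPart (curvature A x)) := by
  have h := hA.continuous_curvature
  simp only [tripleNormSq, sdPart, Fin.sum_univ_three, Matrix.cons_val]
  exact ((((h 0 1).add (h 2 3)).norm.pow 2).add (((h 0 2).sub (h 1 3)).norm.pow 2)).add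
    (((h 0 3).add (h 1 2)).norm.pow 2)

theorem tripleNormSq_nonneg (q : Fin 3 → ℍ[ℝ]) : 0 ≤ tripleNormSq q :=
  Finset.sum_nonneg fun _ _ => by positivity

theorem IsConnectionForm.integrable_asd {A : OneForm} (hA : IsConnectionForm A)
    (h : FiniteEnergy A) : Integrable fun x => tripleNormSq (asdPart (curvature A x)) := by
  refine h.mono' hA.continuous_asd.aestronglyMeasurable (.of_forall fun x => ?_)
  rw [covNorm_sq_eq_sd_add_asd, Real.norm_of_nonneg (tripleNormSq_nonneg _)]
  linarith [tripleNormSq_nonneg (sdPart (curvature A x))]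

theorem IsConnectionForm.integrable_sd {A : OneForm} (hA : IsConnectionForm A)
    (h : FiniteEnergy A) : Integrable fun x => tripleNormSq (sdPart (curvature A x)) := by
  refine h.mono' hA.continuous_sd.aestronglyMeasurable (.of_forall fun x => ?_)
  rw [covNorm_sq_eq_sd_add_asd, Real.norm_of_nonneg (tripleNormSq_nonneg _)]
  linarith [tripleNormSq_nonneg (asdPart (curvature A x))]

theorem IsConnectionForm.integrable_traceWedge {A : OneForm} (hA : IsConnectionForm A)
    (h : FiniteEnergy A) : Integrable fun x => traceWedge (curvature A x) (curvature A x) := by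
  simp only [traceWedge_self_eq_asd_sub_sd (curvature_antisymm A _) (curvature_re hA _)]
  exact (hA.integrable_asd h).sub (hA.integrable_sd h)

/-- The integral over a half line of a function supported in the unit interval. -/
theorem setIntegral_Ioi_eq {f : ℝ → ℝ} (h : ∀ w, 1 < w → f w = 0) :
    ∫ w in Set.Ioi (0 : ℝ), f w = ∫ w in (0 : ℝ)..1, f w := by
  rw [intervalIntegral.integral_of_le zero_le_one]
  exact setIntegral_eq_of_subset_of_forall_sdiff_eq_zero measurableSet_Ioi
    Set.Ioc_subset_Ioi_self fun w hw => h w (not_le.1 fun hle => hw.2 ⟨hw.1, hle⟩)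

section glued

variable {Φ Ψ : ℝ → ℝ} {β : ℝ} {A : OneForm}

theorem isConnectionForm_zero : IsConnectionForm fun _ => 0 :=
  ⟨contDiff_const, fun _ _ => rfl⟩

theorem singularForm_eventuallyEq (hc : IsCutoffPair Φ Ψ) {x : R4} (hx : 1 ≤ ‖x‖) :
    singularForm Φ Ψ β A =ᶠ[𝓝 x] A := by
  have : {y : R4 | 99 / 100 < ‖y‖ ^ 2} ∈ 𝓝 x :=
    (isOpen_lt continuous_const (continuous_norm.pow 2)).mem_nhds (by
      change 99 / 100 < ‖x‖ ^ 2; nlinarith)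
  exact Filter.mem_of_superset this fun y hy => singularForm_eq_self hc (le_of_lt hy)

/-- Away from the unit ball the densities of the glued form are those of `A`. -/
theorem gluedForm_invariants_outside (hc : IsCutoffPair Φ Ψ) (hβ : 0 < β)
    (hA : IsConnectionForm A) {x : R4} (hx : 1 ≤ ‖x‖) :
    tripleNormSq (asdPart (curvature (gluedForm Φ Ψ β A) x)) =
      tripleNormSq (asdPart (curvature A x)) ∧
    tripleNormSq (sdPart (curvature (gluedForm Φ Ψ β A) x)) =
      tripleNormSq (sdPart (curvature A x)) := by
  have h0 : x ≠ 0 := norm_pos_iff.1 (by linarith)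
  obtain ⟨h1, h2, -⟩ := gluedForm_invariants hc hβ hA h0
  rw [h1, h2, curvature_congr (singularForm_eventuallyEq hc hx)]
  exact ⟨rfl, rfl⟩

theorem finiteEnergy_gluedForm (hc : IsCutoffPair Φ Ψ) (hβ : 0 < β) (hA : IsConnectionForm A)
    (hE : FiniteEnergy A) : FiniteEnergy (gluedForm Φ Ψ β A) := by
  have hG := isConnectionForm_gluedForm hc hβ hA
  have hcont : Continuous fun x => covNorm (curvature (gluedForm Φ Ψ β A) x) ^ 2 := by
    simp only [covNorm_sq_eq_sd_add_asd]
    exact hG.continuous_sd.add hG.continuous_asd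
  have h1 : IntegrableOn (fun x => covNorm (curvature (gluedForm Φ Ψ β A) x) ^ 2)
      (Metric.closedBall 0 1) := hcont.continuousOn.integrableOn_compact (isCompact_closedBall 0 1)
  have h2 : IntegrableOn (fun x => covNorm (curvature (gluedForm Φ Ψ β A) x) ^ 2)
      (Metric.closedBall 0 1)ᶜ :=
    (hE.integrableOn (s := (Metric.closedBall 0 1)ᶜ)).congr_fun (fun x hx => by
      have hx1 : 1 < ‖x‖ := by simpa using hx
      obtain ⟨e1, e2⟩ := gluedForm_invariants_outside hc hβ hA hx1.le
      simp only [covNorm_sq_eq_sd_add_asd, e1, e2]) measurableSet_closedBall.compl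
  have := h1.union h2
  rwa [Set.union_compl_self, integrableOn_univ] at this

theorem contDiffAt_gluedCoeff (hc : IsCutoffPair Φ Ψ) {w : ℝ} (hw : -β < w) :
    ContDiffAt ℝ ∞ (gluedCoeff Ψ β) w := by
  have h1 : ContDiff ℝ ∞ fun w => (1 - Ψ w) / w :=
    contDiff_div_id (contDiff_const.sub hc.smooth_right)
      (a := 27 / 100) (by norm_num) fun w hw => by simp [hc.right_eq_one w hw]
  exact (contDiffAt_const.add (contDiffAt_const.mul h1.contDiffAt)).div
    (contDiffAt_const.add contDiffAt_id) (by
      have h2 : 0 < β + w := by linarith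
      exact h2.ne')

/-- The instanton that is pure gauge outside the unit ball has `∫ tr (F ∧ F) = -8π²`. -/
theorem chernIntegral_gluedForm_zero (hc : IsCutoffPair Φ Ψ) (hβ : 0 < β) :
    chernIntegral (gluedForm Φ Ψ β fun _ => 0) = -8 * Real.pi ^ 2 := by
  set m := gluedCoeff Ψ β with hm
  have hd : ∀ w, -β < w → HasDerivAt m (deriv m w) w := fun w hw =>
    ((contDiffAt_gluedCoeff hc hw).differentiableAt (by simp)).hasDerivAt
  have hG := isConnectionForm_gluedForm hc hβ isConnectionForm_zero
  have hT : ∀ x : R4, traceWedge (curvature (gluedForm Φ Ψ β fun _ => 0) x)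
      (curvature (gluedForm Φ Ψ β fun _ => 0) x) = (fun w => -48 * (m w * (1 - w * m w) *
        (m w + w * deriv m w))) (‖x‖ ^ 2) := fun x =>
    traceWedge_radial_sdForm (m := m) (fun y v => by simp [gluedForm_apply, hm])
      ((contDiffAt_gluedCoeff hc (by nlinarith [sq_nonneg ‖x‖])).differentiableAt (by simp))
      (hG.differentiable x)
  have hK : ∀ w, 99 / 100 < w → w * m w = 1 := fun w hw => by
    rw [hm, gluedCoeff, hc.right_eq_zero w hw.le]
    have : 0 < w := by linarith
    field_simp
    ring
  -- The density times `w` is the derivative of a cubic polynomial in `w m(w)`, which runs from `0`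
  -- to `1`.
  have hKd : ∀ w, -β < w → HasDerivAt (fun w => -24 * (w * m w) ^ 2 + 16 * (w * m w) ^ 3)
      (w * (-48 * (m w * (1 - w * m w) * (m w + w * deriv m w)))) w := fun w hw => by
    have e := (hasDerivAt_id' w).fun_mul (hd w hw)
    exact (((e.fun_pow 2).const_mul (-24)).fun_add ((e.fun_pow 3).const_mul 16)).congr_deriv
      (by push_cast; ring)
  rw [chernIntegral, integral_congr_ae (.of_forall hT), integral_radial (fun w =>
    -48 * (m w * (1 - w * m w) * (m w + w * deriv m w))), setIntegral_Ioi_eq,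
    intervalIntegral.integral_eq_sub_of_hasDerivAt fun w hw => hKd w ?_]
  · simp only [hK 1 (by norm_num)]
    norm_num
    ring
  · have hmc : ContinuousOn m (Set.Ioi (-β)) := fun w hw =>
      (hd w hw).continuousAt.continuousWithinAt
    have hmd : ContinuousOn (deriv m) (Set.Ioi (-β)) :=
      ContDiffOn.continuousOn_deriv_of_isOpen (n := ∞)
        (fun w hw => (contDiffAt_gluedCoeff hc hw).contDiffWithinAt) isOpen_Ioi (by simp)
    refine ContinuousOn.intervalIntegrable ?_
    refine ContinuousOn.mono (s := Set.Ioi (-β)) ?_ fun w hw => ?_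
    · fun_prop
    · rw [Set.uIcc_of_le zero_le_one] at hw
      exact lt_of_lt_of_le (by linarith) hw.1
  · rw [Set.uIcc_of_le zero_le_one] at hw
    exact lt_of_lt_of_le (by linarith) hw.1
  · intro w hw
    simp [hK w (by linarith)]

/-- Gluing lowers `∫ tr (F ∧ F)` by `8π²`: the densities of the glued form, of the instanton and of
`A` are related by the divergence of a compactly supported vector field. -/
theorem chernIntegral_gluedForm (hc : IsCutoffPair Φ Ψ) (hβ : 0 < β) (hA : IsConnectionForm A)
    (hE : FiniteEnergy A) :
    chernIntegral (gluedForm Φ Ψ β A) = chernIntegral A - 8 * Real.pi ^ 2 := by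
  set O : OneForm := fun _ => 0 with hO
  set S := singularForm Φ Ψ β A with hS
  set S0 := singularForm Φ Ψ β O with hS0
  have hO' : IsConnectionForm O := isConnectionForm_zero
  have hEO : FiniteEnergy O := by
    simp [FiniteEnergy, covNorm_sq, hO, curvature, curvatureForm]
  set Z : Fin 4 → R4 → ℝ := fun i x =>
    chernSimonsField S i x - chernSimonsField S0 i x - chernSimonsField A i x with hZ
  have hU : ∀ x : R4, x ≠ 0 → ({0}ᶜ : Set R4) ∈ 𝓝 x := fun x hx =>
    isOpen_compl_singleton.mem_nhds hx
  have hS2 : ∀ x : R4, x ≠ 0 → ContDiffAt ℝ 2 S x := fun x hx =>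
    ((contDiffOn_singularForm hc hβ hA).contDiffAt (hU x hx)).of_le two_le_infty
  have hS02 : ∀ x : R4, x ≠ 0 → ContDiffAt ℝ 2 S0 x := fun x hx =>
    ((contDiffOn_singularForm hc hβ hO').contDiffAt (hU x hx)).of_le two_le_infty
  have hA2 : ∀ x : R4, ContDiffAt ℝ 2 A x := fun x => hA.1.contDiffAt.of_le two_le_infty
  -- Near the origin `Φ = 0`, so that the two singular forms agree and cancel.
  have hnear : ∀ i, ∀ x : R4, ‖x‖ ^ 2 < 961 / 10000 → Z i x = -chernSimonsField A i x := by
    intro i x hx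
    have : S =ᶠ[𝓝 x] S0 := by
      filter_upwards [(isOpen_lt (continuous_norm.pow 2) continuous_const).mem_nhds hx] with y hy
      have hy' : ‖y‖ ^ 2 < 961 / 10000 := hy
      ext v : 1
      simp [hS, hS0, singularForm_apply, hc.left_eq_zero _ hy'.le]
    simp only [hZ, chernSimonsField_congr this]
    ring
  have hZsmooth : ∀ i, ContDiff ℝ 1 (Z i) := by
    refine fun i => contDiff_iff_contDiffAt.2 fun x => ?_
    rcases eq_or_ne x 0 with rfl | hx
    · refine (contDiffAt_chernSimonsField (hA2 0) i).neg.congr_of_eventuallyEq ?_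
      filter_upwards [(isOpen_lt ((continuous_norm (E := R4)).pow 2) continuous_const).mem_nhds
        (show ‖(0 : R4)‖ ^ 2 < 961 / 10000 by norm_num)] with y hy
      exact hnear i y hy
    · exact ((contDiffAt_chernSimonsField (hS2 x hx) i).sub
        (contDiffAt_chernSimonsField (hS02 x hx) i)).sub (contDiffAt_chernSimonsField (hA2 x) i)
  have hZsupp : ∀ i, HasCompactSupport (Z i) := fun i =>
    HasCompactSupport.intro (isCompact_closedBall (0 : R4) 1) fun x hx => by
      have hx1 : 1 < ‖x‖ := by simpa using hx
      simp only [hZ, chernSimonsField_congr (singularForm_eventuallyEq hc hx1.le) i, hS, hS0]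
      rw [hO, chernSimonsField_zero]
      ring
  have hdiv : ∀ x : R4, x ≠ 0 →
      traceWedge (curvature (gluedForm Φ Ψ β A) x) (curvature (gluedForm Φ Ψ β A) x)
      - traceWedge (curvature (gluedForm Φ Ψ β O) x) (curvature (gluedForm Φ Ψ β O) x)
      - traceWedge (curvature A x) (curvature A x) = ∑ i, fderiv ℝ (Z i) x (stdVec i) := by
    intro x hx
    rw [(gluedForm_invariants hc hβ hA hx).2.2, (gluedForm_invariants hc hβ hO' hx).2.2,
      traceWedge_eq_div_chernSimonsField (hS2 x hx),
      traceWedge_eq_div_chernSimonsField (hS02 x hx),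
      traceWedge_eq_div_chernSimonsField (hA2 x), ← Finset.sum_sub_distrib,
      ← Finset.sum_sub_distrib]
    refine Finset.sum_congr rfl fun i _ => ?_
    have d : ∀ {B : OneForm}, ContDiffAt ℝ 2 B x → HasFDerivAt (chernSimonsField B i)
        (fderiv ℝ (chernSimonsField B i) x) x := fun hB =>
      ((contDiffAt_chernSimonsField hB i).differentiableAt one_ne_zero).hasFDerivAt
    have e : fderiv ℝ (Z i) x = _ :=
      (((d (hS2 x hx)).fun_sub (d (hS02 x hx))).fun_sub (d (hA2 x))).fderiv
    rw [e]
    rfl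
  have hint : ∀ {B : OneForm}, IsConnectionForm B → FiniteEnergy B →
      Integrable fun x => traceWedge (curvature B x) (curvature B x) := fun hB h =>
    hB.integrable_traceWedge h
  have i1 := hint (isConnectionForm_gluedForm hc hβ hA) (finiteEnergy_gluedForm hc hβ hA hE)
  have i2 := hint (isConnectionForm_gluedForm hc hβ hO') (finiteEnergy_gluedForm hc hβ hO' hEO)
  have i3 := hint hA hE
  have key : ∫ x, (traceWedge (curvature (gluedForm Φ Ψ β A) x) (curvature (gluedForm Φ Ψ β A) x)
      - traceWedge (curvature (gluedForm Φ Ψ β O) x) (curvature (gluedForm Φ Ψ β O) x)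
      - traceWedge (curvature A x) (curvature A x)) = 0 := by
    have hae : ∀ᵐ x : R4, x ≠ 0 := by simp [ae_iff]
    rw [integral_congr_ae (hae.mono hdiv), integral_finsetSum]
    · exact Finset.sum_eq_zero fun i _ => integral_fderiv_eq_zero (hZsmooth i) (hZsupp i) _
    · exact fun i _ => (((hZsmooth i).continuous_fderiv one_ne_zero).clm_apply
        continuous_const).integrable_of_hasCompactSupport ((hZsupp i).fderiv_apply ℝ _)
  have i4 : Integrable fun x =>
      traceWedge (curvature (gluedForm Φ Ψ β A) x) (curvature (gluedForm Φ Ψ β A) x)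
      - traceWedge (curvature (gluedForm Φ Ψ β O) x) (curvature (gluedForm Φ Ψ β O) x) := i1.sub i2
  rw [integral_sub i4 i3, integral_sub i1 i2] at key
  have h0 := chernIntegral_gluedForm_zero hc hβ
  simp only [chernIntegral] at h0 ⊢
  linarith

/-- The energy of the glued form in terms of anti-self-dual parts in the unit ball, by
`|F|² = -tr (F ∧ F) + 2 |P₋F|²`. -/
theorem energy_gluedForm (hc : IsCutoffPair Φ Ψ) (hβ : 0 < β) (hA : IsConnectionForm A)
    (hE : FiniteEnergy A) :
    energy (gluedForm Φ Ψ β A) = energy A + 8 * Real.pi ^ 2 +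
      2 * ∫ x in Metric.ball (0 : R4) 1,
        (tripleNormSq (asdPart (curvature (gluedForm Φ Ψ β A) x)) -
          tripleNormSq (asdPart (curvature A x))) := by
  have hG := isConnectionForm_gluedForm hc hβ hA
  have hGE := finiteEnergy_gluedForm hc hβ hA hE
  have hen : ∀ {B : OneForm}, IsConnectionForm B → FiniteEnergy B → energy B =
      -chernIntegral B + 2 * ∫ x, tripleNormSq (asdPart (curvature B x)) := fun hB h => by
    simp only [energy, chernIntegral, covNorm_curvature_sq hB]
    have i1 := (hB.integrable_traceWedge h).fun_neg
    rw [integral_add i1 ((hB.integrable_asd h).const_mul 2), integral_neg, integral_const_mul]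
  rw [hen hG hGE, hen hA hE, chernIntegral_gluedForm hc hβ hA hE,
    setIntegral_eq_integral_of_forall_compl_eq_zero, integral_sub (hG.integrable_asd hGE)
      (hA.integrable_asd hE)]
  · ring
  · intro x hx
    rw [(gluedForm_invariants_outside hc hβ hA (by simpa using hx)).1, sub_self]

end glued

/-! ### The interaction of the leading terms -/

/-- The anti-self-dual part of the curvature of the glued form to leading order, for a connection
form with linear part `D` and an instanton of strength `s`, after scaling to the unit ball. -/
def leadingPart (Φ Ψ : ℝ → ℝ) (s : ℝ) (D : R4 →L[ℝ] R4 →L[ℝ] ℍ[ℝ]) (y : R4) : Fin 3 → ℍ[ℝ] :=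
  Φ (‖y‖ ^ 2) • asdPart (extDeriv D) + (2 * deriv Φ (‖y‖ ^ 2)) • asdPart (radialWedge y (D y))
    + (2 * s * (deriv Ψ (‖y‖ ^ 2) / ‖y‖ ^ 2)) • imagUnit

/-- The anti-self-dual part of `⟨y, dy⟩ ∧ ι_y dA` for `dA = 2 D`, minus its average over rotations
of `y`. Only the self-dual part of `dA` contributes to it. -/
def mixedPart (D : R4 →L[ℝ] R4 →L[ℝ] ℍ[ℝ]) (y : R4) : Fin 3 → ℍ[ℝ] :=
  (2 : ℝ) • asdPart (radialWedge y (D y)) - (‖y‖ ^ 2 / 2) • asdPart (extDeriv D)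

/-- The inner product of triples of quaternions. -/
def tripleInner (p q : Fin 3 → ℍ[ℝ]) : ℝ := ∑ a, inner ℝ (p a) (q a)

theorem clm_apply_coord (l : R4 →L[ℝ] ℍ[ℝ]) (y : R4) :
    l y = y 0 • l (stdVec 0) + y 1 • l (stdVec 1) + y 2 • l (stdVec 2) + y 3 • l (stdVec 3) := by
  have : y = y 0 • stdVec 0 + y 1 • stdVec 1 + y 2 • stdVec 2 + y 3 • stdVec 3 := by
    ext i; fin_cases i <;> simp
  conv_lhs => rw [this]
  simp only [map_add, map_smul]

theorem clm_apply_coord' (D : R4 →L[ℝ] R4 →L[ℝ] ℍ[ℝ]) (y : R4) (v : R4) :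
    D y v = y 0 • D (stdVec 0) v + y 1 • D (stdVec 1) v + y 2 • D (stdVec 2) v
      + y 3 • D (stdVec 3) v := clm_apply_coord (D.flip v) y

theorem tripleNormSq_combination (p q r : Fin 3 → ℍ[ℝ]) (a b c : ℝ) :
    tripleNormSq (a • p + b • q + c • r) = a ^ 2 * tripleNormSq p + b ^ 2 * tripleNormSq q
      + c ^ 2 * tripleNormSq r + 2 * (a * b) * tripleInner p q + 2 * (a * c) * tripleInner p r
      + 2 * (b * c) * tripleInner q r := by
  simp only [tripleNormSq, tripleInner, Fin.sum_univ_three, Pi.add_apply, Pi.smul_apply, norm_sq_eq,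
    Quaternion.inner_def]
  simp
  ring

theorem tripleNormSq_imagUnit : tripleNormSq imagUnit = 3 := by
  simp [tripleNormSq, Fin.sum_univ_three, norm_sq_eq]
  norm_num

theorem tripleNormSq_mixedPart {D : R4 →L[ℝ] R4 →L[ℝ] ℍ[ℝ]} (hD : ∀ X Y, D Y X = -D X Y)
    (y : R4) : tripleNormSq (mixedPart D y) =
    (‖y‖ ^ 2) ^ 2 / 4 * tripleNormSq (sdPart (extDeriv D)) := by
  have hd : ∀ i, D (stdVec i) (stdVec i) = 0 := fun i => eq_zero_of_eq_neg (hD _ _)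
  simp only [tripleNormSq, mixedPart, asdPart, sdPart, Fin.sum_univ_three, radialWedge, extDeriv,
    clm_apply_coord' D y, hd, hD (stdVec 0) (stdVec 1), hD (stdVec 0) (stdVec 2),
    hD (stdVec 0) (stdVec 3), hD (stdVec 1) (stdVec 2), hD (stdVec 1) (stdVec 3),
    hD (stdVec 2) (stdVec 3), norm_sq_coord, norm_sq_eq]
  generalize D (stdVec 0) (stdVec 1) = a
  generalize D (stdVec 0) (stdVec 2) = b
  generalize D (stdVec 0) (stdVec 3) = c
  generalize D (stdVec 1) (stdVec 2) = d
  generalize D (stdVec 1) (stdVec 3) = e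
  generalize D (stdVec 2) (stdVec 3) = f
  simp
  ring

/-- The components of `mixedPart` are trace-free quadratic forms in `y`. -/
theorem mixedPart_frame {D : R4 →L[ℝ] R4 →L[ℝ] ℍ[ℝ]} (hD : ∀ X Y, D Y X = -D X Y) (y : R4) :
    mixedPart D y + mixedPart D (leftMulI y) + mixedPart D (leftMulJ y) +
      mixedPart D (leftMulK y) = 0 := by
  have hd : ∀ i, D (stdVec i) (stdVec i) = 0 := fun i => eq_zero_of_eq_neg (hD _ _)
  have c : ∀ z : R4, ∀ i, D z (stdVec i) = z 0 • D (stdVec 0) (stdVec i)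
      + z 1 • D (stdVec 1) (stdVec i) + z 2 • D (stdVec 2) (stdVec i)
      + z 3 • D (stdVec 3) (stdVec i) := fun z i => clm_apply_coord' D z _
  have i0 : leftMulI y 0 = -y 1 := rfl
  have i1 : leftMulI y 1 = y 0 := rfl
  have i2 : leftMulI y 2 = -y 3 := rfl
  have i3 : leftMulI y 3 = y 2 := rfl
  have j0 : leftMulJ y 0 = -y 2 := rfl
  have j1 : leftMulJ y 1 = y 3 := rfl
  have j2 : leftMulJ y 2 = y 0 := rfl
  have j3 : leftMulJ y 3 = -y 1 := rfl
  have k0 : leftMulK y 0 = -y 3 := rfl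
  have k1 : leftMulK y 1 = -y 2 := rfl
  have k2 : leftMulK y 2 = y 1 := rfl
  have k3 : leftMulK y 3 = y 0 := rfl
  funext n
  simp only [mixedPart, Pi.add_apply, Pi.sub_apply, Pi.smul_apply, LinearIsometryEquiv.norm_map,
    norm_sq_coord y, Pi.zero_apply]
  fin_cases n <;>
  · simp only [asdPart, radialWedge, extDeriv, Fin.zero_eta, Fin.mk_one, Fin.reduceFinMk,
      Matrix.cons_val]
    simp only [c y, c (leftMulI y), c (leftMulJ y), c (leftMulK y), i0, i1, i2, i3, j0, j1, j2, j3, k0, k1, k2, k3, hd, hD (stdVec 0) (stdVec 1),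
      hD (stdVec 0) (stdVec 2), hD (stdVec 0) (stdVec 3), hD (stdVec 1) (stdVec 2),
      hD (stdVec 1) (stdVec 3), hD (stdVec 2) (stdVec 3)]
    module

theorem leadingPart_eq (Φ Ψ : ℝ → ℝ) (s : ℝ) (D : R4 →L[ℝ] R4 →L[ℝ] ℍ[ℝ]) (y : R4) :
    leadingPart Φ Ψ s D y =
      (Φ (‖y‖ ^ 2) + ‖y‖ ^ 2 * deriv Φ (‖y‖ ^ 2) / 2) • asdPart (extDeriv D)
      + deriv Φ (‖y‖ ^ 2) • mixedPart D y
      + (2 * s * (deriv Ψ (‖y‖ ^ 2) / ‖y‖ ^ 2)) • imagUnit := by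
  rw [leadingPart, mixedPart]
  module

theorem IsCutoffPair.deriv_left_of_gt {Φ Ψ : ℝ → ℝ} (hc : IsCutoffPair Φ Ψ) {w : ℝ}
    (hw : 26 / 100 < w) : deriv Φ w = 0 := by
  have : Φ =ᶠ[𝓝 w] fun _ => 1 := by
    filter_upwards [Ioi_mem_nhds hw] with t ht using hc.left_eq_one t (le_of_lt ht)
  rw [this.deriv_eq, deriv_const]

theorem IsCutoffPair.deriv_left_of_lt {Φ Ψ : ℝ → ℝ} (hc : IsCutoffPair Φ Ψ) {w : ℝ}
    (hw : w < 961 / 10000) : deriv Φ w = 0 := by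
  have : Φ =ᶠ[𝓝 w] fun _ => 0 := by
    filter_upwards [Iio_mem_nhds hw] with t ht using hc.left_eq_zero t (le_of_lt ht)
  rw [this.deriv_eq, deriv_const]

theorem IsCutoffPair.deriv_right_of_lt {Φ Ψ : ℝ → ℝ} (hc : IsCutoffPair Φ Ψ) {w : ℝ}
    (hw : w < 27 / 100) : deriv Ψ w = 0 := by
  have : Ψ =ᶠ[𝓝 w] fun _ => 1 := by
    filter_upwards [Iio_mem_nhds hw] with t ht using hc.right_eq_one t (le_of_lt ht)
  rw [this.deriv_eq, deriv_const]

theorem IsCutoffPair.deriv_right_of_gt {Φ Ψ : ℝ → ℝ} (hc : IsCutoffPair Φ Ψ) {w : ℝ}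
    (hw : 99 / 100 < w) : deriv Ψ w = 0 := by
  have : Ψ =ᶠ[𝓝 w] fun _ => 0 := by
    filter_upwards [Ioi_mem_nhds hw] with t ht using hc.right_eq_zero t (le_of_lt ht)
  rw [this.deriv_eq, deriv_const]

/-- The excess of the leading energy density over that of the linear form: a radial part, in the
variable `w = ‖y‖²`, and a multiple of a trace-free quadratic form. -/
theorem tripleNormSq_leadingPart {Φ Ψ : ℝ → ℝ} (hc : IsCutoffPair Φ Ψ) (s : ℝ)
    {D : R4 →L[ℝ] R4 →L[ℝ] ℍ[ℝ]} (hD : ∀ X Y, D Y X = -D X Y) (y : R4) :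
    tripleNormSq (leadingPart Φ Ψ s D y) - tripleNormSq (asdPart (extDeriv D)) =
      (fun w => ((Φ w + w * deriv Φ w / 2) ^ 2 - 1) * tripleNormSq (asdPart (extDeriv D))
        + (w * deriv Φ w) ^ 2 / 4 * tripleNormSq (sdPart (extDeriv D))
        + 12 * s ^ 2 * (deriv Ψ w / w) ^ 2
        + 4 * s * (deriv Ψ w / w) * tripleInner (asdPart (extDeriv D)) imagUnit) (‖y‖ ^ 2)
      + (fun w => 2 * (Φ w + w * deriv Φ w / 2) * deriv Φ w) (‖y‖ ^ 2) *
        tripleInner (asdPart (extDeriv D)) (mixedPart D y) := by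
  rw [leadingPart_eq, tripleNormSq_combination, tripleNormSq_mixedPart hD, tripleNormSq_imagUnit]
  beta_reduce
  set w := ‖y‖ ^ 2
  -- The supports of `Φ'` and `Ψ'` are disjoint, and `Φ = 1` on the latter.
  rcases lt_or_ge w (27 / 100) with h | h
  · rw [hc.deriv_right_of_lt h]
    ring
  · rw [hc.deriv_left_of_gt (by linarith), hc.left_eq_one w (by linarith)]
    ring

/-- The excess of the leading anti-self-dual energy. The last term, the interaction of the instanton
with the form, comes from the boundary values of `Ψ` only. -/
theorem integral_leadingPart {Φ Ψ : ℝ → ℝ} (hc : IsCutoffPair Φ Ψ) (s : ℝ)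
    {D : R4 →L[ℝ] R4 →L[ℝ] ℍ[ℝ]} (hD : ∀ X Y, D Y X = -D X Y) :
    ∫ y in Metric.ball (0 : R4) 1,
      (tripleNormSq (leadingPart Φ Ψ s D y) - tripleNormSq (asdPart (extDeriv D))) =
    Real.pi ^ 2 * ((tripleNormSq (asdPart (extDeriv D)) + tripleNormSq (sdPart (extDeriv D))) / 4 *
        (∫ w in (0 : ℝ)..1, w ^ 3 * deriv Φ w ^ 2)
      + 12 * s ^ 2 * (∫ w in (0 : ℝ)..1, deriv Ψ w ^ 2 / w)
      - 4 * s * tripleInner (asdPart (extDeriv D)) imagUnit) := by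
  set M := tripleNormSq (asdPart (extDeriv D))
  set P := tripleNormSq (sdPart (extDeriv D))
  set T := tripleInner (asdPart (extDeriv D)) imagUnit
  set h : ℝ → ℝ := fun w => ((Φ w + w * deriv Φ w / 2) ^ 2 - 1) * M
        + (w * deriv Φ w) ^ 2 / 4 * P + 12 * s ^ 2 * (deriv Ψ w / w) ^ 2
        + 4 * s * (deriv Ψ w / w) * T with hh
  set k : ℝ → ℝ := fun w => 2 * (Φ w + w * deriv Φ w / 2) * deriv Φ w with hk
  set q : R4 → ℝ := fun y => tripleInner (asdPart (extDeriv D)) (mixedPart D y) with hq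
  have hΦ : Continuous Φ := hc.smooth_left.continuous
  have hΦ' : Continuous (deriv Φ) := hc.smooth_left.continuous_deriv (by simp)
  have hΨ' : Continuous (deriv Ψ) := hc.smooth_right.continuous_deriv (by simp)
  have hΨw : Continuous fun w => deriv Ψ w / w :=
    (contDiff_div_id (contDiff_infty_iff_deriv.1 hc.smooth_right).2 (a := 26 / 100) (by norm_num)
      fun w hw => hc.deriv_right_of_lt (by linarith)).continuous
  have hhc : Continuous h := by fun_prop
  have hkc : Continuous k := by fun_prop
  have hqc : Continuous q := by
    have hi : ∀ i, Continuous fun y : R4 => D y (stdVec i) := fun i => (D.flip (stdVec i)).continuous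
    have hyi : ∀ i, Continuous fun y : R4 => y i := fun i => by fun_prop
    have hr : ∀ i j, Continuous fun y : R4 => radialWedge y (D y) i j := fun i j =>
      ((hyi i).smul (hi j)).sub ((hyi j).smul (hi i))
    have hm : Continuous fun y : R4 => mixedPart D y := by
      refine continuous_pi fun a => ?_
      have : Continuous fun y : R4 => asdPart (radialWedge y (D y)) a := by
        fin_cases a
        · exact (hr 0 1).sub (hr 2 3)
        · exact (hr 0 2).add (hr 1 3)
        · exact (hr 0 3).sub (hr 1 2)
      exact (this.const_smul (2 : ℝ)).sub
        (((continuous_norm.pow 2).div_const 2).smul continuous_const)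
    exact continuous_finsetSum _ fun a _ =>
      continuous_const.inner ((continuous_apply a).comp hm)
  have h1 : ∀ w, 99 / 100 < w → h w = 0 := fun w hw => by
    simp only [hh]
    rw [hc.left_eq_one w (by linarith), hc.deriv_left_of_gt (by linarith),
      hc.deriv_right_of_gt hw]
    ring
  have k1 : ∀ w, 99 / 100 < w → k w = 0 := fun w hw => by
    simp only [hk]
    rw [hc.deriv_left_of_gt (by linarith), mul_zero]
  have hs : ∀ {f : R4 → ℝ}, (∀ y, 99 / 100 < ‖y‖ ^ 2 → f y = 0) → HasCompactSupport f :=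
    fun hf => HasCompactSupport.intro (isCompact_closedBall (0 : R4) 1) fun y hy => by
      have hy1 : 1 < ‖y‖ := by simpa using hy
      exact hf y (by nlinarith)
  have i1 : Integrable fun y : R4 => h (‖y‖ ^ 2) :=
    (hhc.comp (continuous_norm.pow 2)).integrable_of_hasCompactSupport (hs fun y hy => h1 _ hy)
  have i2 : Integrable fun y : R4 => k (‖y‖ ^ 2) * q y :=
    ((hkc.comp (continuous_norm.pow 2)).mul hqc).integrable_of_hasCompactSupport
      (hs fun y hy => by simp [k1 _ hy])
  have hq0 : ∫ y : R4, k (‖y‖ ^ 2) * q y = 0 := by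
    refine integral_eq_zero_of_frame i2 fun y => ?_
    simp only [LinearIsometryEquiv.norm_map]
    have := congrArg (tripleInner (asdPart (extDeriv D))) (mixedPart_frame hD y)
    simp only [tripleInner, Pi.add_apply, inner_add_right, Finset.sum_add_distrib, Pi.zero_apply,
      inner_zero_right, Finset.sum_const_zero] at this
    simp only [hq, tripleInner]
    linear_combination k (‖y‖ ^ 2) * this
  have heq : ∀ y : R4, tripleNormSq (leadingPart Φ Ψ s D y) - M = h (‖y‖ ^ 2) + k (‖y‖ ^ 2) * q y :=
    fun y => tripleNormSq_leadingPart hc s hD y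
  have hi : ∀ {f : ℝ → ℝ}, Continuous f → IntervalIntegrable f volume 0 1 := fun hf =>
    hf.intervalIntegrable _ _
  rw [setIntegral_eq_integral_of_forall_compl_eq_zero, integral_congr_ae (.of_forall heq),
    integral_add i1 i2, hq0, add_zero, integral_radial h, setIntegral_Ioi_eq]
  · congr 1
    have hC2 : Continuous fun w => deriv Ψ w ^ 2 / w := by
      refine (hΨ'.mul hΨw).congr fun w => ?_
      simp only [Pi.mul_apply]
      ring
    have e : ∀ w ∈ Set.uIcc (0 : ℝ) 1, w * h w = M * (w * Φ w ^ 2 + w ^ 2 * Φ w * deriv Φ w - w)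
        + (M + P) / 4 * (w ^ 3 * deriv Φ w ^ 2) + 12 * s ^ 2 * (deriv Ψ w ^ 2 / w)
        + 4 * s * T * deriv Ψ w := fun w _ => by
      rcases eq_or_ne w 0 with rfl | hw
      · simp [hc.deriv_right_of_lt (show (0 : ℝ) < 27 / 100 by norm_num)]
      · simp only [hh]
        field_simp
        ring
    -- Up to the square of `Φ'`, the contribution of the cut-off of the form is a total derivative.
    have e1 : ∫ w in (0 : ℝ)..1, (w * Φ w ^ 2 + w ^ 2 * Φ w * deriv Φ w - w) = 0 := by
      have hd : ∀ w ∈ Set.uIcc (0 : ℝ) 1, HasDerivAt (fun w => (w ^ 2 * Φ w ^ 2 - w ^ 2) / 2)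
          (w * Φ w ^ 2 + w ^ 2 * Φ w * deriv Φ w - w) w := fun w _ => by
        have d := (hc.smooth_left.differentiable (by simp) w).hasDerivAt
        exact ((((hasDerivAt_pow 2 w).fun_mul (d.fun_pow 2)).fun_sub
          (hasDerivAt_pow 2 w)).div_const 2).congr_deriv (by push_cast; ring)
      rw [intervalIntegral.integral_eq_sub_of_hasDerivAt hd (hi (by fun_prop)),
        hc.left_eq_one 1 (by norm_num)]
      norm_num
    have e2 : ∫ w in (0 : ℝ)..1, deriv Ψ w = -1 := by
      rw [intervalIntegral.integral_deriv_eq_sub (fun w _ => hc.smooth_right.differentiable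
        (by simp) w) (hi hΨ'), hc.right_eq_zero 1 (by norm_num), hc.right_eq_one 0 (by norm_num)]
      norm_num
    rw [intervalIntegral.integral_congr e, intervalIntegral.integral_add (hi (by fun_prop))
      (hi (by fun_prop)), intervalIntegral.integral_add (hi (by fun_prop)) (hi (by fun_prop)),
      intervalIntegral.integral_add (hi (by fun_prop)) (hi (by fun_prop))]
    simp only [intervalIntegral.integral_const_mul]
    rw [e1, e2]
    ring
  · intro w hw
    rw [h1 w (by linarith), mul_zero]
  · intro y hy
    have hy1 : 1 ≤ ‖y‖ := by simpa using hy
    rw [heq, h1 _ (by nlinarith), k1 _ (by nlinarith)]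
    ring

/-! ### The limit of small scales -/

theorem IsConnectionForm.continuous_fderiv_apply {A : OneForm} (hA : IsConnectionForm A) (v : R4) :
    Continuous fun q : R4 × R4 => fderiv ℝ A q.1 q.2 v :=
  (((hA.1.continuous_fderiv (by simp)).comp continuous_fst).clm_apply continuous_snd).clm_apply
    continuous_const

/-- The quotient `ρ⁻¹ A(ρy)` for a form `A` that vanishes at the origin, extended continuously to
`ρ = 0`. -/
def quotientForm (A : OneForm) (hA : IsConnectionForm A) (p : ℝ × R4) : R4 →L[ℝ] ℍ[ℝ] :=
  have hi : ∀ v, IntervalIntegrable (fun t : ℝ => fderiv ℝ A ((t * p.1) • p.2) p.2 v) volume 0 1 :=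
    fun v => ((hA.continuous_fderiv_apply v).comp
      (by fun_prop : Continuous fun t : ℝ => ((t * p.1) • p.2, p.2))).intervalIntegrable 0 1
  LinearMap.toContinuousLinearMap
    { toFun := fun v => ∫ t in (0 : ℝ)..1, fderiv ℝ A ((t * p.1) • p.2) p.2 v
      map_add' := fun v w => by
        simp only [map_add]
        exact intervalIntegral.integral_add (hi v) (hi w)
      map_smul' := fun c v => by
        simp only [map_smul, RingHom.id_apply]
        exact intervalIntegral.integral_smul c _ }

theorem quotientForm_apply {A : OneForm} (hA : IsConnectionForm A) (p : ℝ × R4) (v : R4) :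
    quotientForm A hA p v = ∫ t in (0 : ℝ)..1, fderiv ℝ A ((t * p.1) • p.2) p.2 v := rfl

theorem continuous_quotientForm {A : OneForm} (hA : IsConnectionForm A) (v : R4) :
    Continuous fun p => quotientForm A hA p v := by
  simp only [quotientForm_apply]
  refine intervalIntegral.continuous_parametric_intervalIntegral_of_continuous'
    (f := fun (p : ℝ × R4) (t : ℝ) => fderiv ℝ A ((t * p.1) • p.2) p.2 v) ?_ 0 1
  exact (hA.continuous_fderiv_apply v).comp
    (by fun_prop : Continuous fun q : (ℝ × R4) × ℝ => ((q.2 * q.1.1) • q.1.2, q.1.2))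

theorem smul_quotientForm {A : OneForm} (hA : IsConnectionForm A) (h0 : A 0 = 0) (ρ : ℝ)
    (y v : R4) : ρ • quotientForm A hA (ρ, y) v = A (ρ • y) v := by
  have hd : ∀ t ∈ Set.uIcc (0 : ℝ) 1, HasDerivAt (fun t : ℝ => A ((t * ρ) • y) v)
      (ρ • fderiv ℝ A ((t * ρ) • y) y v) t := fun t _ => by
    have e : HasDerivAt (fun t : ℝ => (t * ρ) • y) (ρ • y) t := by
      simpa using ((hasDerivAt_id t).mul_const ρ).smul_const y
    have := (hasFDerivAt_eval (hA.differentiable ((t * ρ) • y)) v).comp_hasDerivAt t e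
    rwa [map_smul] at this
  have hc : Continuous fun t : ℝ => ρ • fderiv ℝ A ((t * ρ) • y) y v :=
    ((hA.continuous_fderiv_apply v).comp
      (by fun_prop : Continuous fun t : ℝ => ((t * ρ) • y, y))).const_smul ρ
  have := intervalIntegral.integral_eq_sub_of_hasDerivAt hd (hc.intervalIntegrable 0 1)
  rw [intervalIntegral.integral_smul] at this
  simpa [quotientForm_apply, h0] using this

theorem quotientForm_zero {A : OneForm} (hA : IsConnectionForm A) (y : R4) :
    quotientForm A hA (0, y) = fderiv ℝ A 0 y := by
  ext1 v
  simp [quotientForm_apply]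

theorem continuous_asdPart {X : Type*} [TopologicalSpace X] {f : X → TwoCovector}
    (h : ∀ i j, Continuous fun p => f p i j) : Continuous fun p => asdPart (f p) := by
  refine continuous_pi fun a => ?_
  fin_cases a
  · exact (h 0 1).sub (h 2 3)
  · exact (h 0 2).add (h 1 3)
  · exact (h 0 3).sub (h 1 2)

theorem continuous_tripleNormSq : Continuous tripleNormSq :=
  continuous_finsetSum _ fun a _ => (continuous_apply a).norm.pow 2

/-- The dilation by the factor `ρ`. -/
def dilation (ρ : ℝ) : R4 →L[ℝ] R4 := ρ • ContinuousLinearMap.id ℝ R4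

@[simp] theorem dilation_apply (ρ : ℝ) (x : R4) : dilation ρ x = ρ • x := rfl

/-- The anti-self-dual part of the curvature of the glued form (in singular gauge), for the form `A`
rescaled from the ball of radius `ρ` and an instanton of strength `s ρ²`, divided by `ρ²`. The
denominators are cut off below `1 / 20`, where all coefficients vanish, so that this is continuous
down to `ρ = 0`. -/
def rescaledPart (Φ Ψ : ℝ → ℝ) (s : ℝ) (A : OneForm) (hA : IsConnectionForm A)
    (p : ℝ × R4) : Fin 3 → ℍ[ℝ] :=
  let ρ := p.1
  let y := p.2
  let b := quotientForm A hA p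
  let w := ‖y‖ ^ 2
  let m := max w (1 / 20)
  Φ w • asdPart (extDeriv (fderiv ℝ A (ρ • y))) + (2 * deriv Φ w) • asdPart (radialWedge y b)
    + (ρ ^ 2 * Φ w ^ 2) • asdPart (mulWedge b b)
    + (2 * (s * deriv Ψ w / (s * ρ ^ 2 + m)
      + s ^ 2 * ρ ^ 2 * (Ψ w * (1 - Ψ w)) / (m * (s * ρ ^ 2 + m) ^ 2))) • imagUnit
    + (Φ w * (Ψ w * (s * ρ ^ 2) / (m * (s * ρ ^ 2 + m)))) •
      asdPart (mulWedge b (asdForm y) + mulWedge (asdForm y) b)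

theorem continuous_rescaledPart {Φ Ψ : ℝ → ℝ} (hc : IsCutoffPair Φ Ψ) {s : ℝ} (hs : 0 ≤ s)
    {A : OneForm} (hA : IsConnectionForm A) : Continuous (rescaledPart Φ Ψ s A hA) := by
  have hΦ : Continuous Φ := hc.smooth_left.continuous
  have hΨ : Continuous Ψ := hc.smooth_right.continuous
  have hΦ' : Continuous (deriv Φ) := hc.smooth_left.continuous_deriv (by simp)
  have hΨ' : Continuous (deriv Ψ) := hc.smooth_right.continuous_deriv (by simp)
  have hb : ∀ i, Continuous fun p => quotientForm A hA p (stdVec i) := fun i =>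
    continuous_quotientForm hA _
  have hD : ∀ i j, Continuous fun p : ℝ × R4 => fderiv ℝ A (p.1 • p.2) (stdVec i) (stdVec j) :=
    fun i j => (((hA.1.continuous_fderiv (by simp)).comp (by fun_prop :
      Continuous fun p : ℝ × R4 => p.1 • p.2)).clm_apply continuous_const).clm_apply
        continuous_const
  have hω : ∀ i, Continuous fun p : ℝ × R4 => asdForm p.2 (stdVec i) := fun i =>
    (asdForm.flip (stdVec i)).continuous.comp continuous_snd
  have hy : ∀ i, Continuous fun p : ℝ × R4 => p.2 i := fun i => by fun_prop
  have hw : Continuous fun p : ℝ × R4 => ‖p.2‖ ^ 2 := by fun_prop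
  have hm : Continuous fun p : ℝ × R4 => max (‖p.2‖ ^ 2) (1 / 20) := hw.max continuous_const
  have mpos : ∀ p : ℝ × R4, 0 < max (‖p.2‖ ^ 2) (1 / 20) := fun p => lt_max_of_lt_right (by norm_num)
  have d1 : Continuous fun p : ℝ × R4 => s * p.1 ^ 2 + max (‖p.2‖ ^ 2) (1 / 20) := by fun_prop
  have d1pos : ∀ p : ℝ × R4, 0 < s * p.1 ^ 2 + max (‖p.2‖ ^ 2) (1 / 20) := fun p => by
    have := mpos p
    positivity
  have c1 := continuous_asdPart (f := fun p : ℝ × R4 => extDeriv (fderiv ℝ A (p.1 • p.2)))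
    fun i j => (hD i j).sub (hD j i)
  have c2 := continuous_asdPart (f := fun p : ℝ × R4 => radialWedge p.2 (quotientForm A hA p))
    fun i j => ((hy i).smul (hb j)).sub ((hy j).smul (hb i))
  have c3 := continuous_asdPart
    (f := fun p : ℝ × R4 => mulWedge (quotientForm A hA p) (quotientForm A hA p))
    fun i j => ((hb i).mul (hb j)).sub ((hb j).mul (hb i))
  have c5 := continuous_asdPart
    (f := fun p : ℝ × R4 => mulWedge (quotientForm A hA p) (asdForm p.2) +
      mulWedge (asdForm p.2) (quotientForm A hA p))
    fun i j => (((hb i).mul (hω j)).sub ((hb j).mul (hω i))).add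
      (((hω i).mul (hb j)).sub ((hω j).mul (hb i)))
  have k4 : Continuous fun p : ℝ × R4 => 2 * (s * deriv Ψ (‖p.2‖ ^ 2) /
      (s * p.1 ^ 2 + max (‖p.2‖ ^ 2) (1 / 20)) + s ^ 2 * p.1 ^ 2 * (Ψ (‖p.2‖ ^ 2) *
      (1 - Ψ (‖p.2‖ ^ 2))) / (max (‖p.2‖ ^ 2) (1 / 20) *
        (s * p.1 ^ 2 + max (‖p.2‖ ^ 2) (1 / 20)) ^ 2)) := by
    refine continuous_const.mul (.add (.div (by fun_prop) d1 fun p => (d1pos p).ne')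
      (.div (by fun_prop) (hm.mul (d1.pow 2)) fun p => ?_))
    exact (mul_pos (mpos p) (pow_pos (d1pos p) 2)).ne'
  have k5 : Continuous fun p : ℝ × R4 => Φ (‖p.2‖ ^ 2) * (Ψ (‖p.2‖ ^ 2) * (s * p.1 ^ 2) /
      (max (‖p.2‖ ^ 2) (1 / 20) * (s * p.1 ^ 2 + max (‖p.2‖ ^ 2) (1 / 20)))) := by
    refine (hΦ.comp hw).mul (.div (by fun_prop) (hm.mul d1) fun p => ?_)
    exact (mul_pos (mpos p) (d1pos p)).ne'
  exact (((((hΦ.comp hw).smul c1).add ((continuous_const.mul (hΦ'.comp hw)).smul c2)).add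
    (((continuous_fst.pow 2).mul ((hΦ.comp hw).pow 2)).smul c3)).add
      (k4.smul continuous_const)).add (k5.smul c5)

theorem rescaledPart_zero {Φ Ψ : ℝ → ℝ} (hc : IsCutoffPair Φ Ψ) (s : ℝ) {A : OneForm}
    (hA : IsConnectionForm A) (y : R4) :
    rescaledPart Φ Ψ s A hA (0, y) = leadingPart Φ Ψ s (fderiv ℝ A 0) y := by
  have e : deriv Ψ (‖y‖ ^ 2) / max (‖y‖ ^ 2) (1 / 20) = deriv Ψ (‖y‖ ^ 2) / ‖y‖ ^ 2 := by
    rcases le_or_gt (1 / 20) (‖y‖ ^ 2) with h | h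
    · rw [max_eq_left h]
    · rw [hc.deriv_right_of_lt (by linarith), zero_div, zero_div]
  simp only [rescaledPart, leadingPart, quotientForm_zero, mul_div_assoc]
  simp [mul_assoc, e, -one_div]

theorem radialWedge_smul (c : ℝ) (x : R4) (a : R4 →L[ℝ] ℍ[ℝ]) :
    radialWedge x (c • a) = c • radialWedge x a := by
  funext i j
  simp [radialWedge, smul_sub, smul_comm c]

theorem mulWedge_smul_left (c : ℝ) (a b : R4 →L[ℝ] ℍ[ℝ]) :
    mulWedge (c • a) b = c • mulWedge a b := by
  funext i j
  simp [mulWedge, smul_sub]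

theorem mulWedge_smul_right (c : ℝ) (a b : R4 →L[ℝ] ℍ[ℝ]) :
    mulWedge a (c • b) = c • mulWedge a b := by
  funext i j
  simp [mulWedge, smul_sub]

theorem asdPart_singularForm_dilation {Φ Ψ : ℝ → ℝ} (hc : IsCutoffPair Φ Ψ) {s ρ : ℝ} (hs : 0 < s)
    (hρ : 0 < ρ) {A : OneForm} (hA : IsConnectionForm A) (h0 : A 0 = 0) {y : R4} (hy : y ≠ 0) :
    asdPart (curvature (singularForm Φ Ψ (s * ρ ^ 2) (pullback (dilation ρ) A)) y) =
      ρ ^ 2 • rescaledPart Φ Ψ s A hA (ρ, y) := by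
  have hA' := hA.pullback (dilation ρ)
  have e1 : pullback (dilation ρ) A y = ρ ^ 2 • quotientForm A hA (ρ, y) := by
    ext1 v
    simp [← smul_quotientForm hA h0 ρ y v, smul_smul, pow_two]
  have e2 : extDeriv (fderiv ℝ (pullback (dilation ρ) A) y) =
      ρ ^ 2 • extDeriv (fderiv ℝ A (ρ • y)) := by
    funext i j
    simp [extDeriv, fderiv_pullback hA, smul_sub, smul_smul, pow_two]
  rw [asdPart_singularForm hc (by positivity) hA' hy, e1, e2, radialWedge_smul,
    mulWedge_smul_left, mulWedge_smul_right, mulWedge_smul_left, mulWedge_smul_right, ← smul_add]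
  simp only [asdPart_smul, rescaledPart]
  have hw : 0 < ‖y‖ ^ 2 := by have := norm_pos_iff.2 hy; positivity
  set w := ‖y‖ ^ 2
  rcases le_or_gt (1 / 20) w with h | h
  · rw [max_eq_left h, tailCoeff]
    have : 0 < s * ρ ^ 2 + w := by positivity
    have e3 : 2 * (deriv Ψ w * (s * ρ ^ 2) / (s * ρ ^ 2 + w) +
        (s * ρ ^ 2) ^ 2 * (Ψ w * (1 - Ψ w)) / (w * (s * ρ ^ 2 + w) ^ 2)) =
        ρ ^ 2 * (2 * (s * deriv Ψ w / (s * ρ ^ 2 + w)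
      + s ^ 2 * ρ ^ 2 * (Ψ w * (1 - Ψ w)) / (w * (s * ρ ^ 2 + w) ^ 2))) := by
      field_simp
    rw [e3]
    module
  · rw [hc.deriv_right_of_lt (by linarith), hc.deriv_left_of_lt (by linarith),
      hc.left_eq_zero w (by linarith), hc.right_eq_one w (by linarith)]
    simp

theorem asdPart_curvature_dilation {A : OneForm} (hA : IsConnectionForm A) (ρ : ℝ) (y : R4) :
    asdPart (curvature (pullback (dilation ρ) A) y) = ρ ^ 2 • asdPart (curvature A (ρ • y)) := by
  rw [← asdPart_smul]
  congr 1
  funext i j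
  simp [curvature_eq, extDeriv, mulWedge, fderiv_pullback hA, smul_smul, pow_two, smul_sub,
    smul_add]

theorem tripleNormSq_smul (c : ℝ) (q : Fin 3 → ℍ[ℝ]) :
    tripleNormSq (c • q) = c ^ 2 * tripleNormSq q := by
  simp [tripleNormSq, norm_smul, mul_pow, Finset.mul_sum]

/-- The excess of anti-self-dual energy in the glued form at scale `ρ` is `ρ⁴` times a continuous
function of `ρ`, whose value at `0` is the excess of the leading terms. -/
theorem exists_continuous_excess {Φ Ψ : ℝ → ℝ} (hc : IsCutoffPair Φ Ψ) {s : ℝ} (hs : 0 < s)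
    {A : OneForm} (hA : IsConnectionForm A) (h0 : A 0 = 0) :
    ∃ e : ℝ → ℝ, Continuous e ∧
      (∀ ρ, 0 < ρ → ∫ y in Metric.ball (0 : R4) 1,
        (tripleNormSq (asdPart (curvature
            (gluedForm Φ Ψ (s * ρ ^ 2) (pullback (dilation ρ) A)) y)) -
          tripleNormSq (asdPart (curvature (pullback (dilation ρ) A) y))) = ρ ^ 4 * e ρ) ∧
      e 0 = ∫ y in Metric.ball (0 : R4) 1,
        (tripleNormSq (leadingPart Φ Ψ s (fderiv ℝ A 0) y) -
          tripleNormSq (asdPart (curvature A 0))) := by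
  have hball : Metric.closedBall (0 : R4) 1 =ᵐ[volume] Metric.ball (0 : R4) 1 := by
    rw [← Metric.ball_union_sphere]
    exact union_ae_eq_left_of_ae_eq_empty (by
      simpa using Measure.addHaar_sphere volume (0 : R4) 1)
  refine ⟨fun ρ => ∫ y in Metric.closedBall (0 : R4) 1,
    (tripleNormSq (rescaledPart Φ Ψ s A hA (ρ, y)) -
      tripleNormSq (asdPart (curvature A (ρ • y)))), ?_, fun ρ hρ => ?_, ?_⟩
  · refine continuous_parametric_integral_of_continuous (f := fun (ρ : ℝ) (y : R4) =>
      tripleNormSq (rescaledPart Φ Ψ s A hA (ρ, y)) - tripleNormSq (asdPart (curvature A (ρ • y))))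
      ?_ (isCompact_closedBall _ _)
    exact (continuous_tripleNormSq.comp (continuous_rescaledPart hc hs.le hA)).sub
      (hA.continuous_asd.comp (by fun_prop : Continuous fun p : ℝ × R4 => p.1 • p.2))
  · beta_reduce
    rw [setIntegral_congr_set hball, ← integral_const_mul]
    refine integral_congr_ae (ae_restrict_of_ae ?_)
    filter_upwards [compl_mem_ae_iff.2 (measure_singleton (0 : R4))] with y hy
    rw [(gluedForm_invariants hc (by positivity) (hA.pullback _) hy).1,
      asdPart_singularForm_dilation hc hs hρ hA h0 hy, asdPart_curvature_dilation hA,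
      tripleNormSq_smul, tripleNormSq_smul]
    ring
  · simp only [rescaledPart_zero hc, zero_smul]
    exact setIntegral_congr_set hball

/-! ### A gauge adapted to the origin -/

/-- The map `(1 + p) / |1 + p|` to the unit quaternions, for a map `p` to the imaginary quaternions.
It serves as a substitute for the exponential of `p`, with which it agrees to second order. -/
def cayleyGauge (p : R4 → ℍ[ℝ]) (x : R4) : ℍ[ℝ] := (√(1 + ‖p x‖ ^ 2))⁻¹ • (1 + p x)

theorem norm_one_add_sq {q : ℍ[ℝ]} (h : q.re = 0) : ‖1 + q‖ ^ 2 = 1 + ‖q‖ ^ 2 := by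
  simp [norm_sq_eq, h]
  ring

theorem norm_cayleyGauge {p : R4 → ℍ[ℝ]} (h : ∀ x, (p x).re = 0) (x : R4) :
    ‖cayleyGauge p x‖ = 1 := by
  have h0 : 0 < 1 + ‖p x‖ ^ 2 := by positivity
  rw [cayleyGauge, norm_smul, Real.norm_of_nonneg (by positivity), ← Real.sqrt_sq (norm_nonneg (1 + _)),
    norm_one_add_sq (h x), inv_mul_cancel₀ (Real.sqrt_pos.2 h0).ne']

theorem star_real_smul (c : ℝ) (q : ℍ[ℝ]) : star (c • q) = c • star q := by
  ext <;> simp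

theorem contDiff_sqrt_inv {p : R4 → ℍ[ℝ]} (hp : ContDiff ℝ ∞ p) :
    ContDiff ℝ ∞ fun x => (√(1 + ‖p x‖ ^ 2))⁻¹ := by
  have h0 : ∀ x, 0 < 1 + ‖p x‖ ^ 2 := fun x => by positivity
  exact ((contDiff_const.add (hp.norm_sq ℝ)).sqrt fun x => (h0 x).ne').inv
    fun x => (Real.sqrt_pos.2 (h0 x)).ne'

theorem contDiff_cayleyGauge {p : R4 → ℍ[ℝ]} (hp : ContDiff ℝ ∞ p) :
    ContDiff ℝ ∞ (cayleyGauge p) :=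
  (contDiff_sqrt_inv hp).smul (contDiff_const.add hp)

theorem gaugeTransform_cayleyGauge {p : R4 → ℍ[ℝ]} (hp : ContDiff ℝ ∞ p) (h : ∀ x, (p x).re = 0)
    {A : OneForm} (hA : IsConnectionForm A) (x v : R4) :
    gaugeTransform (cayleyGauge p) A x v = (1 + ‖p x‖ ^ 2)⁻¹ •
      imL ((1 - p x) * A x v * (1 + p x) + (1 - p x) * fderiv ℝ p x v) := by
  have hg := contDiff_cayleyGauge hp
  have h1 := norm_cayleyGauge h
  have hB := hA.gaugeTransform hg h1
  have him : gaugeTransform (cayleyGauge p) A x v = imL (gaugeTransform (cayleyGauge p) A x v) := by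
    ext <;> simp [hB.2]
  have dp := (hp.differentiable (by simp) x).hasFDerivAt
  have dc := ((contDiff_sqrt_inv hp).differentiable (by simp) x).hasFDerivAt
  have dg : fderiv ℝ (cayleyGauge p) x v = _ := congrArg (fun l => l v)
    (dc.fun_smul ((hasFDerivAt_const (1 : ℍ[ℝ]) x).fun_add dp)).fderiv
  have h0 : 0 < 1 + ‖p x‖ ^ 2 := by positivity
  have hs : (√(1 + ‖p x‖ ^ 2))⁻¹ * (√(1 + ‖p x‖ ^ 2))⁻¹ = (1 + ‖p x‖ ^ 2)⁻¹ := by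
    rw [← mul_inv, Real.mul_self_sqrt h0.le]
  have hst : star (1 + p x) = 1 - p x := by
    ext <;> simp [h x]
  have hn : (1 - p x) * (1 + p x) = ((1 + ‖p x‖ ^ 2 : ℝ) : ℍ[ℝ]) := by
    rw [← hst, Quaternion.star_mul_self, Quaternion.normSq_eq_norm_mul_self, ← pow_two,
      norm_one_add_sq (h x)]
  rw [him, gaugeTransform_apply, inv_eq_star (h1 x), dg, cayleyGauge, star_real_smul, hst, ← hs]
  generalize (√(1 + ‖p x‖ ^ 2))⁻¹ = n
  generalize fderiv ℝ (fun x => (√(1 + ‖p x‖ ^ 2))⁻¹) x = l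
  have e : ∀ a b c d : ℍ[ℝ], ∀ r : ℝ, n • a * c * n • b + n • a * (n • d + r • b) =
      (n * n) • (a * c * b + a * d) + (n * r) • (a * b) := fun a b c d r => by
    simp only [smul_mul_assoc, mul_smul_comm, mul_add, smul_add, smul_smul]
    module
  have e1 := e (1 - p x) (1 + p x) (A x v) (fderiv ℝ p x v) (l v)
  rw [hn] at e1
  have e2 : (n • (0 + fderiv ℝ p x) + l.smulRight (1 + p x)) v =
      n • fderiv ℝ p x v + l v • (1 + p x) := by
    simp
  rw [e2, e1]
  generalize (1 - p x) * A x v * (1 + p x) + (1 - p x) * fderiv ℝ p x v = q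
  generalize 1 + ‖p x‖ ^ 2 = r
  ext <;> simp

theorem mul_imagUnit_conj (a b : Fin 3) :
    imagUnit b + imagUnit a * imagUnit b * star (imagUnit a) = if b = a then (2 : ℝ) • imagUnit a else 0 := by
  fin_cases a <;> fin_cases b <;> ext <;> simp <;> norm_num

theorem imagUnit_mul_self (a : Fin 3) : imagUnit a * imagUnit a = -1 := by
  fin_cases a <;> ext <;> simp

theorem norm_imagUnit (a : Fin 3) : ‖imagUnit a‖ = 1 := by
  have : ‖imagUnit a‖ ^ 2 = 1 := by
    rw [norm_sq_eq]; fin_cases a <;> simp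
  nlinarith [norm_nonneg (imagUnit a)]

theorem mul_self_of_re_eq_zero {u : ℍ[ℝ]} (h : u.re = 0) (h1 : ‖u‖ = 1) : u * u = -1 := by
  have e : star u = -u := by ext <;> simp [h]
  have := Quaternion.star_mul_self u
  rw [e, Quaternion.normSq_eq_norm_mul_self, h1] at this
  simpa using congrArg Neg.neg this

/-- The unit quaternions act transitively by conjugation on the imaginary units. -/
theorem exists_conj_eq {u : ℍ[ℝ]} (h : u.re = 0) (h1 : ‖u‖ = 1) (a : Fin 3) :
    ∃ c : ℍ[ℝ], ‖c‖ = 1 ∧ c * imagUnit a * star c = u := by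
  -- For every `z`, the quaternion `k = z - u z e` satisfies `k e = u k`. It vanishes for `z = 1` only
  -- if `u = -e`, and in that case it does not vanish for a unit orthogonal to `e`.
  obtain ⟨z, hz⟩ : ∃ z : ℍ[ℝ], z - u * z * imagUnit a ≠ 0 := by
    by_contra! hcon
    have e1 := hcon 1
    obtain ⟨b, hb⟩ : ∃ b, imagUnit b * imagUnit a = -(imagUnit a * imagUnit b) := by
      refine ⟨a + 1, ?_⟩
      fin_cases a <;> ext <;> simp
    have e2 := hcon (imagUnit b)
    have e3 : u * imagUnit a = 1 := by rw [mul_one] at e1; exact (sub_eq_zero.1 e1).symm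
    rw [mul_assoc, hb, mul_neg, ← mul_assoc, e3, one_mul, sub_neg_eq_add] at e2
    have := norm_imagUnit b
    rw [eq_zero_of_eq_neg (eq_neg_of_add_eq_zero_left e2)] at this
    simp at this
  set k := z - u * z * imagUnit a with hk
  have e : k * imagUnit a = u * k := by
    rw [hk, sub_mul, mul_sub, mul_assoc (u * z), imagUnit_mul_self, ← mul_assoc u (u * z),
      ← mul_assoc u u, mul_self_of_re_eq_zero h h1]
    noncomm_ring
  have hk0 : ‖k‖ ≠ 0 := norm_ne_zero_iff.2 hz
  refine ⟨‖k‖⁻¹ • k, by rw [norm_smul, norm_inv, norm_norm, inv_mul_cancel₀ hk0], ?_⟩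
  rw [smul_mul_assoc, e, star_real_smul, smul_mul_assoc, mul_smul_comm, mul_assoc,
    Quaternion.self_mul_star, Quaternion.normSq_eq_norm_mul_self, smul_smul,
    ← Quaternion.coe_commutes, Quaternion.coe_mul_eq_smul, smul_smul]
  field_simp
  simp

theorem inner_conj {c : ℍ[ℝ]} (hc : ‖c‖ = 1) (p q : ℍ[ℝ]) :
    inner ℝ (c⁻¹ * p * c) q = inner ℝ p (c * q * star c) := by
  rw [Quaternion.inner_def, Quaternion.inner_def, inv_eq_star hc, mul_assoc, mul_assoc,
    re_mul_comm']
  simp [mul_assoc]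

/-- A rotation that aligns a triple of imaginary quaternions with the imaginary units: the longest
member is made a positive multiple of its unit, and of the two choices that differ by a half turn
about it, the one with the larger trace is taken. -/
theorem exists_rotation (m : Fin 3 → ℍ[ℝ]) (hm : ∀ a, (m a).re = 0) :
    ∃ c : ℍ[ℝ], ‖c‖ = 1 ∧ 0 ≤ tripleInner (fun a => c⁻¹ * m a * c) imagUnit ∧
      tripleNormSq m ≤ 3 * tripleInner (fun a => c⁻¹ * m a * c) imagUnit ^ 2 := by
  obtain ⟨a, ha⟩ := Finite.exists_max fun a => ‖m a‖
  have hM : tripleNormSq m ≤ 3 * ‖m a‖ ^ 2 := by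
    have : ∀ b, ‖m b‖ ^ 2 ≤ ‖m a‖ ^ 2 := fun b => by gcongr; exact ha b
    rw [tripleNormSq, Fin.sum_univ_three]
    linarith [this 0, this 1, this 2]
  obtain ⟨c, hc, hca⟩ : ∃ c : ℍ[ℝ], ‖c‖ = 1 ∧
      inner ℝ (m a) (c * imagUnit a * star c) = ‖m a‖ := by
    rcases eq_or_ne (m a) 0 with h | h
    · exact ⟨1, by simp, by simp [h]⟩
    · have h0 : ‖m a‖ ≠ 0 := norm_ne_zero_iff.2 h
      obtain ⟨c, hc, e⟩ := exists_conj_eq (u := ‖m a‖⁻¹ • m a) (by simp [hm])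
        (by rw [norm_smul, norm_inv, norm_norm, inv_mul_cancel₀ h0]) a
      refine ⟨c, hc, ?_⟩
      rw [e, inner_smul_right, real_inner_self_eq_norm_sq]
      field_simp
  have hc' : ‖c * imagUnit a‖ = 1 := by rw [norm_mul, hc, norm_imagUnit, one_mul]
  -- In the sum over the two choices, all contributions but that of the longest member cancel.
  have hsum : tripleInner (fun a => c⁻¹ * m a * c) imagUnit +
      tripleInner (fun b => (c * imagUnit a)⁻¹ * m b * (c * imagUnit a)) imagUnit
      = 2 * ‖m a‖ := by
    simp only [tripleInner, inner_conj hc, inner_conj hc']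
    rw [← Finset.sum_add_distrib, Finset.sum_eq_single a]
    · rw [← inner_add_right, star_mul, ← hca]
      have := mul_imagUnit_conj a a
      rw [if_pos rfl] at this
      rw [show c * imagUnit a * star c + c * imagUnit a * imagUnit a * (star (imagUnit a) * star c) =
        c * (imagUnit a + imagUnit a * imagUnit a * star (imagUnit a)) * star c by noncomm_ring,
        this, mul_smul_comm, smul_mul_assoc, inner_smul_right]
    · intro b _ hb
      have := mul_imagUnit_conj a b
      rw [if_neg hb] at this
      rw [← inner_add_right, star_mul,
        show c * imagUnit b * star c + c * imagUnit a * imagUnit b * (star (imagUnit a) * star c) =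
        c * (imagUnit b + imagUnit a * imagUnit b * star (imagUnit a)) * star c by noncomm_ring,
        this]
      simp
    · simp
  rcases le_total ‖m a‖ (tripleInner (fun a => c⁻¹ * m a * c) imagUnit) with h | h
  · exact ⟨c, hc, (norm_nonneg _).trans h, hM.trans (by gcongr)⟩
  · have h' : ‖m a‖ ≤ tripleInner (fun b => (c * imagUnit a)⁻¹ * m b * (c * imagUnit a)) imagUnit := by
      linarith
    exact ⟨_, hc', (norm_nonneg _).trans h', hM.trans (by gcongr)⟩

theorem imL_of_re_eq_zero {q : ℍ[ℝ]} (h : q.re = 0) : imL q = q := by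
  ext <;> simp [h]

theorem GaugeEquivOn.mono {S T : Set R4} {A B : OneForm} (h : GaugeEquivOn T A B) (hST : S ⊆ T) :
    GaugeEquivOn S A B := by
  obtain ⟨U, g, hU, hTU, hg, h1, hB⟩ := h
  exact ⟨U, g, hU, hST.trans hTU, hg, h1, fun x hx => hB x (hST hx)⟩

/-- The gauge transformation by `cayleyGauge` of `-A(0)x` makes `A` vanish at the origin. -/
theorem exists_gauge_eq_zero {A : OneForm} (hA : IsConnectionForm A) :
    ∃ B, IsConnectionForm B ∧ GaugeEquivOn Set.univ A B ∧ B 0 = 0 := by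
  have hp : ContDiff ℝ ∞ fun x => -A 0 x := (A 0).contDiff.neg
  have hre : ∀ x, (-A 0 x).re = 0 := fun x => by simp [hA.2]
  refine ⟨_, hA.gaugeTransform (contDiff_cayleyGauge hp) (norm_cayleyGauge hre),
    gaugeEquivOn_gaugeTransform A (contDiff_cayleyGauge hp) (norm_cayleyGauge hre) _, ?_⟩
  ext1 v
  rw [gaugeTransform_cayleyGauge hp hre hA]
  have e : fderiv ℝ (fun x => -A 0 x) 0 v = -A 0 v :=
    congrArg (fun l => l v) (A 0).hasFDerivAt.neg.fderiv
  rw [e]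
  simp

/-- The gauge transformation by `cayleyGauge` of `-DA(0)(x)(x) / 2` removes the symmetric part of the
derivative at the origin, if `A` vanishes there. -/
theorem exists_gauge_antisymm {A : OneForm} (hA : IsConnectionForm A) (h0 : A 0 = 0) :
    ∃ B, IsConnectionForm B ∧ GaugeEquivOn Set.univ A B ∧ B 0 = 0 ∧
      ∀ X Y, fderiv ℝ B 0 Y X = -fderiv ℝ B 0 X Y := by
  set D := fderiv ℝ A 0 with hD
  set p : R4 → ℍ[ℝ] := fun x => (-1 / 2 : ℝ) • D x x with hp'
  have hDre : ∀ x y, (D x y).re = 0 := fun x y => by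
    have := fderiv_re hA 0 x y
    exact this
  have hp : ContDiff ℝ ∞ p := contDiff_const.fun_smul (D.contDiff.clm_apply contDiff_id)
  have hre : ∀ x, (p x).re = 0 := fun x => by simp [hp', hDre]
  have dp : ∀ x v, fderiv ℝ p x v = (-1 / 2 : ℝ) • (D x v + D v x) := fun x v => by
    have e : HasFDerivAt p _ x :=
      (D.hasFDerivAt.clm_apply (hasFDerivAt_id x)).fun_const_smul (-1 / 2 : ℝ)
    rw [e.fderiv]
    simp
  set B := gaugeTransform (cayleyGauge p) A with hB
  have hBc : IsConnectionForm B :=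
    hA.gaugeTransform (contDiff_cayleyGauge hp) (norm_cayleyGauge hre)
  have hBf : ∀ x v, B x v = (1 + ‖p x‖ ^ 2)⁻¹ • imL ((1 - p x) * A x v * (1 + p x) +
      (1 - p x) * ((-1 / 2 : ℝ) • (D x v + D v x))) := fun x v => by
    rw [← dp]
    exact gaugeTransform_cayleyGauge hp hre hA x v
  have p0 : p 0 = 0 := by simp [hp']
  have key : ∀ X Y, fderiv ℝ B 0 X Y = (1 / 2 : ℝ) • (D X Y - D Y X) := fun X Y => by
    have dp0 : HasFDerivAt p (0 : R4 →L[ℝ] ℍ[ℝ]) 0 := by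
      have e := (hp.differentiable (by simp) 0).hasFDerivAt
      refine e.congr_fderiv ?_
      ext1 v
      rw [dp]
      simp
    have dn := (((contDiff_const.add (hp.norm_sq ℝ)).inv (fun x => by positivity) :
      ContDiff ℝ ∞ fun x => (1 + ‖p x‖ ^ 2)⁻¹).differentiable (by simp) 0).hasFDerivAt
    have dA := hasFDerivAt_eval (hA.differentiable 0) Y
    have dl : HasFDerivAt (fun x => (-1 / 2 : ℝ) • (D x Y + D Y x))
        ((-1 / 2 : ℝ) • (D.flip Y + D Y)) 0 := ((-1 / 2 : ℝ) • (D.flip Y + D Y)).hasFDerivAt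
    have dm := (hasFDerivAt_const (1 : ℍ[ℝ]) (0 : R4)).fun_sub dp0
    have da := (hasFDerivAt_const (1 : ℍ[ℝ]) (0 : R4)).fun_add dp0
    have e := dn.fun_smul (imL.hasFDerivAt.comp (0 : R4)
      (((dm.mul' dA).mul' da).fun_add (dm.mul' dl)))
    have e2 := (hasFDerivAt_eval (hBc.differentiable 0) Y).unique
      (e.congr_of_eventuallyEq (.of_forall fun x => hBf x Y))
    have e3 := congrArg (fun l => l X) e2
    simp only [ContinuousLinearMap.flip_apply] at e3
    rw [e3]
    simp [p0, h0, ← hD]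
    have him : ∀ X Y, (D X Y).im = D X Y := fun X Y => imL_of_re_eq_zero (hDre X Y)
    rw [him, him]
    module
  refine ⟨B, hBc, gaugeEquivOn_gaugeTransform A (contDiff_cayleyGauge hp) (norm_cayleyGauge hre) _,
    ?_, fun X Y => ?_⟩
  · ext1 v
    rw [hBf]
    simp [p0, h0]
  · rw [key, key]
    module

/-- In a suitable global gauge a connection form vanishes at the origin, its derivative there is
antisymmetric, and the anti-self-dual part of its curvature at the origin is aligned with the
imaginary units. -/
theorem exists_adapted_gauge {A : OneForm} (hA : IsConnectionForm A) :
    ∃ B, IsConnectionForm B ∧ GaugeEquivOn Set.univ A B ∧ B 0 = 0 ∧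
      (∀ X Y, fderiv ℝ B 0 Y X = -fderiv ℝ B 0 X Y) ∧
      0 ≤ tripleInner (asdPart (extDeriv (fderiv ℝ B 0))) imagUnit ∧
      tripleNormSq (asdPart (extDeriv (fderiv ℝ B 0))) ≤
        3 * tripleInner (asdPart (extDeriv (fderiv ℝ B 0))) imagUnit ^ 2 := by
  obtain ⟨A₁, hA₁, g₁, z₁⟩ := exists_gauge_eq_zero hA
  obtain ⟨A₂, hA₂, g₂, z₂, anti⟩ := exists_gauge_antisymm hA₁ z₁
  set m := asdPart (extDeriv (fderiv ℝ A₂ 0)) with hm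
  have hDre : ∀ X Y, (fderiv ℝ A₂ 0 X Y).re = 0 := fun X Y => fderiv_re hA₂ 0 X Y
  obtain ⟨c, hc, ht, hM⟩ := exists_rotation m fun a => by
    fin_cases a <;> simp [hm, asdPart, extDeriv, hDre]
  have hcc : ContDiff ℝ ∞ fun _ : R4 => c := contDiff_const
  set B := gaugeTransform (fun _ => c) A₂ with hB
  have hBc : IsConnectionForm B := hA₂.gaugeTransform hcc fun _ => hc
  have hBf : ∀ x v, B x v = c⁻¹ * A₂ x v * c := fun x v => by
    rw [hB, gaugeTransform_apply]
    simp
  have hBd : ∀ X Y, fderiv ℝ B 0 X Y = c⁻¹ * fderiv ℝ A₂ 0 X Y * c := fun X Y => by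
    have e := (ContinuousLinearMap.mulLeftRight ℝ ℍ[ℝ] c⁻¹ c).hasFDerivAt.comp (0 : R4)
      (hasFDerivAt_eval (hA₂.differentiable 0) Y)
    have e2 := (hasFDerivAt_eval (hBc.differentiable 0) Y).unique
      (e.congr_of_eventuallyEq (.of_forall fun x => by simp [hBf]))
    simpa using congrArg (fun l => l X) e2
  have hasd : asdPart (extDeriv (fderiv ℝ B 0)) = fun a => c⁻¹ * m a * c := by
    funext a
    fin_cases a <;> simp [hm, asdPart, extDeriv, hBd, mul_sub, sub_mul, mul_add, add_mul]
  have hc0 : c ≠ 0 := fun h => by simp [h] at hc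
  refine ⟨B, hBc, (g₁.trans g₂).trans (gaugeEquivOn_gaugeTransform A₂ hcc (fun _ => hc) _), ?_,
    fun X Y => ?_, ?_, ?_⟩
  · ext1 v
    simp [hBf, z₂]
  · rw [hBd, hBd, anti X Y]
    simp
  · rwa [hasd]
  · rw [hasd]
    have : tripleNormSq (fun a => c⁻¹ * m a * c) = tripleNormSq m := by
      simp only [tripleNormSq, norm_conj hc0]
    rwa [this]

/-! ### Invariance under gauge transformations, dilations and reflections -/

theorem GaugeEquivOn.invariants {A B : OneForm} (h : GaugeEquivOn Set.univ A B)
    (hA : IsConnectionForm A) (hB : IsConnectionForm B) (x : R4) :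
    tripleNormSq (asdPart (curvature B x)) = tripleNormSq (asdPart (curvature A x)) ∧
    tripleNormSq (sdPart (curvature B x)) = tripleNormSq (sdPart (curvature A x)) ∧
    traceWedge (curvature B x) (curvature B x) = traceWedge (curvature A x) (curvature A x) := by
  obtain ⟨U, g, hU, hSU, hg, h1, hgB⟩ := h
  have hx : x ∈ U := hSU (Set.mem_univ x)
  exact gauge_invariants (hA.differentiable x) (hB.differentiable x)
    ((hg.contDiffAt (hU.mem_nhds hx)).of_le two_le_infty)
    (fun h0 => by simpa [h0] using h1 x hx) (.of_forall fun y => hgB y (Set.mem_univ y))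

theorem GaugeEquivOn.covNorm_sq_eq {A B : OneForm} (h : GaugeEquivOn Set.univ A B)
    (hA : IsConnectionForm A) (hB : IsConnectionForm B) (x : R4) :
    covNorm (curvature B x) ^ 2 = covNorm (curvature A x) ^ 2 := by
  obtain ⟨e1, e2, -⟩ := h.invariants hA hB x
  rw [covNorm_sq_eq_sd_add_asd, covNorm_sq_eq_sd_add_asd, e1, e2]

theorem pullback_dilation_inv {ρ : ℝ} (hρ : ρ ≠ 0) (A : OneForm) :
    pullback (dilation ρ⁻¹) (pullback (dilation ρ) A) = A := by
  funext x
  ext1 v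
  simp [smul_smul, hρ]

theorem curvature_dilation {A : OneForm} (hA : IsConnectionForm A) (ρ : ℝ) (y : R4) :
    curvature (pullback (dilation ρ) A) y = ρ ^ 2 • curvature A (ρ • y) := by
  funext i j
  simp [curvature_eq, extDeriv, mulWedge, fderiv_pullback hA, smul_smul, pow_two, smul_sub,
    smul_add]

theorem covNorm_smul_sq (c : ℝ) (α : TwoCovector) : covNorm (c • α) ^ 2 = c ^ 2 * covNorm α ^ 2 := by
  simp only [covNorm_sq, Pi.smul_apply, norm_smul, Real.norm_eq_abs, mul_pow, sq_abs]
  ring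

theorem traceWedge_smul_smul (c : ℝ) (α : TwoCovector) :
    traceWedge (c • α) (c • α) = c ^ 2 * traceWedge α α := by
  simp only [traceWedge, Finset.mul_sum, Pi.smul_apply, quatTrace, smul_mul_assoc, mul_smul_comm,
    Quaternion.re_smul, smul_eq_mul]
  refine Finset.sum_congr rfl fun i _ => Finset.sum_congr rfl fun j _ =>
    Finset.sum_congr rfl fun k _ => Finset.sum_congr rfl fun l _ => by ring

theorem integral_dilation {ρ : ℝ} (hρ : 0 < ρ) (f : R4 → ℝ) :
    ∫ x : R4, (ρ ^ 2) ^ 2 * f (ρ • x) = ∫ x, f x := by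
  rw [integral_const_mul, Measure.integral_comp_smul, finrank_euclideanSpace_fin,
    abs_of_pos (by positivity), smul_eq_mul]
  field_simp

theorem energy_dilation {A : OneForm} (hA : IsConnectionForm A) {ρ : ℝ} (hρ : 0 < ρ) :
    energy (pullback (dilation ρ) A) = energy A := by
  simp only [energy, curvature_dilation hA, covNorm_smul_sq]
  exact integral_dilation hρ fun x => covNorm (curvature A x) ^ 2

theorem chernIntegral_dilation {A : OneForm} (hA : IsConnectionForm A) {ρ : ℝ} (hρ : 0 < ρ) :
    chernIntegral (pullback (dilation ρ) A) = chernIntegral A := by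
  simp only [chernIntegral, curvature_dilation hA, traceWedge_smul_smul]
  exact integral_dilation hρ fun x => traceWedge (curvature A x) (curvature A x)

theorem finiteEnergy_dilation {A : OneForm} (hA : IsConnectionForm A) (hE : FiniteEnergy A)
    {ρ : ℝ} (hρ : 0 < ρ) : FiniteEnergy (pullback (dilation ρ) A) := by
  simp only [FiniteEnergy, curvature_dilation hA, covNorm_smul_sq]
  exact (Integrable.comp_smul hE hρ.ne').const_mul _

theorem pullback_dilation_sdInstanton (c lam : ℝ) :
    pullback (dilation c) (sdInstanton lam) = sdInstanton (lam * c) := by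
  funext x
  ext1 v
  change (lam ^ 2 / (1 + lam ^ 2 * ‖c • x‖ ^ 2)) • (toQuat (c • x) * star (toQuat (c • v))).im =
    ((lam * c) ^ 2 / (1 + (lam * c) ^ 2 * ‖x‖ ^ 2)) • (toQuat x * star (toQuat v)).im
  have e : (toQuat (c • x) * star (toQuat (c • v))).im =
      c ^ 2 • (toQuat x * star (toQuat v)).im := by
    rw [toQuat_smul, toQuat_smul, star_real_smul, smul_mul_smul_comm, ← pow_two,
      Quaternion.im_smul]
  rw [e, smul_smul, norm_smul, mul_pow, Real.norm_eq_abs, sq_abs, mul_pow]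
  congr 1
  ring

/-- Quaternionic conjugation as an isometry, which reverses the orientation. -/
def conjIsometry : R4 ≃ₗᵢ[ℝ] R4 := isometryOfNorm
  { toFun := fun x => !₂[x 0, -x 1, -x 2, -x 3]
    map_add' := fun x y => by ext i; fin_cases i <;> simp <;> ring
    map_smul' := fun c x => by ext i; fin_cases i <;> simp }
  fun x => norm_eq_of_coord (by simp)

/-- Quaternionic conjugation as a linear map. -/
def conjMap : R4 →L[ℝ] R4 := conjIsometry.toContinuousLinearEquiv.toContinuousLinearMap

theorem conjMap_apply (x : R4) : conjMap x = !₂[x 0, -x 1, -x 2, -x 3] := rfl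

theorem norm_conjMap (x : R4) : ‖conjMap x‖ = ‖x‖ := conjIsometry.norm_map x

@[simp] theorem conjMap_conjMap (x : R4) : conjMap (conjMap x) = x := by
  ext i
  fin_cases i <;> simp [conjMap_apply]

theorem toQuat_conjMap (x : R4) : toQuat (conjMap x) = star (toQuat x) := by
  ext <;> simp [conjMap_apply]

theorem pullback_conjMap_conjMap (A : OneForm) : pullback conjMap (pullback conjMap A) = A := by
  funext x
  ext1 v
  simp

theorem curvature_conjMap {A : OneForm} (hA : IsConnectionForm A) (x : R4) (i j : Fin 4) :
    curvature (pullback conjMap A) x i j =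
      ((![1, -1, -1, -1] i * ![1, -1, -1, -1] j : ℝ)) • curvature A (conjMap x) i j := by
  have hs : ∀ i, conjMap (stdVec i) = (![1, -1, -1, -1] i : ℝ) • stdVec i := fun i => by
    ext k
    fin_cases i <;> fin_cases k <;> simp [conjMap_apply]
  have h : ∀ (p q : ℝ) (X Y : R4), curvatureForm A (conjMap x) (p • X) (q • Y) =
      (p * q) • curvatureForm A (conjMap x) X Y := fun p q X Y => by
    simp only [curvatureForm, map_smul, smul_apply, smul_mul_smul_comm, smul_add, smul_sub,
      smul_smul, mul_comm q p]
  change curvatureForm _ x (stdVec i) (stdVec j) = _ • curvatureForm A _ (stdVec i) (stdVec j)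
  rw [curvatureForm_pullback hA, hs, hs, h]

theorem asdPart_conjMap {A : OneForm} (hA : IsConnectionForm A) (x : R4) :
    asdPart (curvature (pullback conjMap A) x) = -sdPart (curvature A (conjMap x)) := by
  funext a
  fin_cases a <;> simp [asdPart, sdPart, curvature_conjMap hA] <;> abel

theorem sdPart_conjMap {A : OneForm} (hA : IsConnectionForm A) (x : R4) :
    sdPart (curvature (pullback conjMap A) x) = -asdPart (curvature A (conjMap x)) := by
  funext a
  fin_cases a <;> simp [asdPart, sdPart, curvature_conjMap hA] <;> abel

theorem tripleNormSq_neg (q : Fin 3 → ℍ[ℝ]) : tripleNormSq (-q) = tripleNormSq q := by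
  simp [tripleNormSq]

theorem covNorm_conjMap_sq {A : OneForm} (hA : IsConnectionForm A) (x : R4) :
    covNorm (curvature (pullback conjMap A) x) ^ 2 = covNorm (curvature A (conjMap x)) ^ 2 := by
  rw [covNorm_sq_eq_sd_add_asd, covNorm_sq_eq_sd_add_asd, asdPart_conjMap hA, sdPart_conjMap hA,
    tripleNormSq_neg, tripleNormSq_neg, add_comm]

theorem energy_conjMap {A : OneForm} (hA : IsConnectionForm A) :
    energy (pullback conjMap A) = energy A := by
  simp only [energy, covNorm_conjMap_sq hA]
  exact integral_comp_isometry conjIsometry fun x => covNorm (curvature A x) ^ 2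

theorem finiteEnergy_conjMap {A : OneForm} (hA : IsConnectionForm A) (hE : FiniteEnergy A) :
    FiniteEnergy (pullback conjMap A) := by
  simp only [FiniteEnergy, covNorm_conjMap_sq hA]
  exact (conjIsometry.measurePreserving.integrable_comp_emb
    conjIsometry.toHomeomorph.measurableEmbedding).2 hE

theorem chernIntegral_conjMap {A : OneForm} (hA : IsConnectionForm A) :
    chernIntegral (pullback conjMap A) = -chernIntegral A := by
  have e : ∀ x, traceWedge (curvature (pullback conjMap A) x) (curvature (pullback conjMap A) x) =
      -traceWedge (curvature A (conjMap x)) (curvature A (conjMap x)) := fun x => by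
    rw [traceWedge_self_eq_asd_sub_sd (curvature_antisymm _ _) (curvature_re (hA.pullback _) _),
      traceWedge_self_eq_asd_sub_sd (curvature_antisymm _ _) (curvature_re hA _),
      asdPart_conjMap hA, sdPart_conjMap hA, tripleNormSq_neg, tripleNormSq_neg]
    ring
  simp only [chernIntegral, e, integral_neg]
  exact congrArg Neg.neg (integral_comp_isometry conjIsometry fun x =>
    traceWedge (curvature A x) (curvature A x))

theorem pullback_conjMap_sdInstanton (lam : ℝ) :
    pullback conjMap (sdInstanton lam) = asdInstanton lam := by
  funext x
  ext1 v
  change (lam ^ 2 / (1 + lam ^ 2 * ‖conjMap x‖ ^ 2)) •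
      (toQuat (conjMap x) * star (toQuat (conjMap v))).im =
    (lam ^ 2 / (1 + lam ^ 2 * ‖x‖ ^ 2)) • (star (toQuat x) * toQuat v).im
  rw [norm_conjMap, toQuat_conjMap, toQuat_conjMap, star_star]

/-! ### Gluing in an instanton -/

/-- The gluing in an adapted gauge. The strength `t / 15` of the instanton minimizes a bound for the
quadratic polynomial in `s` that `integral_leadingPart` gives. -/
theorem exists_gluing_of_adapted {Φ Ψ : ℝ → ℝ} (hc : IsCutoffPair Φ Ψ)
    (hC1 : ∫ w in (0 : ℝ)..1, w ^ 3 * deriv Φ w ^ 2 ≤ 52 / 1000)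
    (hC2 : ∫ w in (0 : ℝ)..1, deriv Ψ w ^ 2 / w ≤ 5 / 2)
    {A : OneForm} (hA : IsConnectionForm A) (hE : FiniteEnergy A) (h0 : A 0 = 0)
    (hD : ∀ X Y, fderiv ℝ A 0 Y X = -fderiv ℝ A 0 X Y)
    (ht : 0 ≤ tripleInner (asdPart (extDeriv (fderiv ℝ A 0))) imagUnit)
    (hM : tripleNormSq (asdPart (extDeriv (fderiv ℝ A 0))) ≤
        3 * tripleInner (asdPart (extDeriv (fderiv ℝ A 0))) imagUnit ^ 2)
    (hle : tripleNormSq (sdPart (curvature A 0)) ≤ tripleNormSq (asdPart (curvature A 0)))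
    (hpos : 0 < tripleNormSq (asdPart (curvature A 0))) :
    ∃ ρ₀ : ℝ, 0 < ρ₀ ∧ ∀ ρ : ℝ, 0 < ρ → ρ < ρ₀ →
      ∃ A' : OneForm, IsConnectionForm A' ∧ FiniteEnergy A' ∧
        GaugeEquivOn (Metric.ball (0 : R4) ρ)ᶜ A A' ∧
        (∃ lam : ℝ, 0 < lam ∧
          GaugeEquivOn (Metric.ball (0 : R4) (31 / 100 * ρ)) (sdInstanton lam) A') ∧
        chernIntegral A' = chernIntegral A - 8 * Real.pi ^ 2 ∧
        energy A' ≤ energy A + 8 * Real.pi ^ 2 - 1 / 100 * covNorm (curvature A 0) ^ 2 * ρ ^ 4 := by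
  have hF : curvature A 0 = extDeriv (fderiv ℝ A 0) := by
    rw [curvature_eq, h0]
    funext i j
    simp [mulWedge]
  rw [hF] at hle hpos
  set t := tripleInner (asdPart (extDeriv (fderiv ℝ A 0))) imagUnit with ht'
  set M := tripleNormSq (asdPart (extDeriv (fderiv ℝ A 0))) with hM'
  set P := tripleNormSq (sdPart (extDeriv (fderiv ℝ A 0))) with hP'
  have hcov : covNorm (curvature A 0) ^ 2 = P + M := by rw [covNorm_sq_eq_sd_add_asd, hF]
  have htpos : 0 < t := by
    rcases ht.lt_or_eq with h | h
    · exact h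
    · rw [← h] at hM
      linarith
  set s := t / 15 with hs'
  have hs : 0 < s := by positivity
  obtain ⟨e, he, heq, he0⟩ := exists_continuous_excess hc hs hA h0
  -- As `|P₊F| ≤ |P₋F|` and `t² ≥ |P₋F|² / 3`, the excess is at most
  -- `-π² (2 / 45 - 26 / 1000) |P₋F|²`.
  have hneg : 2 * e 0 < -(1 / 100 * (P + M)) := by
    rw [he0, hF, integral_leadingPart hc s hD]
    have hP0 : 0 ≤ P := tripleNormSq_nonneg _
    have hpi : 9 ≤ Real.pi ^ 2 := by nlinarith [Real.pi_gt_three]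
    have b1 : (M + P) / 4 * (∫ w in (0 : ℝ)..1, w ^ 3 * deriv Φ w ^ 2) ≤
        (M + P) / 4 * (52 / 1000) := by gcongr
    have b2 : 12 * s ^ 2 * (∫ w in (0 : ℝ)..1, deriv Ψ w ^ 2 / w) ≤ 12 * s ^ 2 * (5 / 2) := by
      gcongr
    have b3 : 12 * s ^ 2 * (5 / 2) - 4 * s * t = -(2 / 15) * t ^ 2 := by rw [hs']; ring
    have b4 : (M + P) / 4 * (∫ w in (0 : ℝ)..1, w ^ 3 * deriv Φ w ^ 2)
      + 12 * s ^ 2 * (∫ w in (0 : ℝ)..1, deriv Ψ w ^ 2 / w) - 4 * s * t ≤ -(18 / 1000) * M := by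
      linarith
    have b5 : Real.pi ^ 2 * ((M + P) / 4 * (∫ w in (0 : ℝ)..1, w ^ 3 * deriv Φ w ^ 2)
      + 12 * s ^ 2 * (∫ w in (0 : ℝ)..1, deriv Ψ w ^ 2 / w) - 4 * s * t) ≤
        Real.pi ^ 2 * (-(18 / 1000) * M) := by gcongr
    nlinarith
  obtain ⟨δ, hδ, hball⟩ := Metric.eventually_nhds_iff.1
    ((continuous_const.mul he).continuousAt.eventually_lt continuousAt_const hneg :
      ∀ᶠ ρ in 𝓝 (0 : ℝ), 2 * e ρ < -(1 / 100 * (P + M)))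
  refine ⟨δ, hδ, fun ρ hρ hρδ => ?_⟩
  have hsmall : 2 * e ρ < -(1 / 100 * (P + M)) :=
    hball (y := ρ) (by rwa [Real.dist_eq, sub_zero, abs_of_pos hρ])
  have hβ : 0 < s * ρ ^ 2 := by positivity
  have hAρ := hA.pullback (dilation ρ)
  have hEρ := finiteEnergy_dilation hA hE hρ
  have hG := isConnectionForm_gluedForm hc hβ hAρ
  set G := gluedForm Φ Ψ (s * ρ ^ 2) (pullback (dilation ρ) A) with hG'
  have hρi : 0 < ρ⁻¹ := by positivity
  refine ⟨pullback (dilation ρ⁻¹) G, hG.pullback _,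
    finiteEnergy_dilation hG (finiteEnergy_gluedForm hc hβ hAρ hEρ) hρi, ?_, ?_, ?_, ?_⟩
  · have h := (gaugeEquivOn_gluedForm (A := pullback (dilation ρ) A) hc hβ).pullback
      (dilation ρ⁻¹)
    rw [pullback_dilation_inv hρ.ne'] at h
    refine h.mono fun x hx => ?_
    simp only [Set.mem_compl_iff, mem_ball_zero_iff, not_lt] at hx
    simp only [Set.mem_preimage, Set.mem_compl_iff, mem_ball_zero_iff, not_lt, dilation_apply,
      norm_smul, norm_inv, Real.norm_of_nonneg hρ.le]
    rwa [le_inv_mul_iff₀ hρ, mul_one]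
  · refine ⟨(√(s * ρ ^ 2))⁻¹ * ρ⁻¹, by positivity, .of_eqOn fun x hx => ?_⟩
    rw [← pullback_dilation_sdInstanton]
    have hx' : ‖ρ⁻¹ • x‖ < 31 / 100 := by
      rw [mem_ball_zero_iff] at hx
      rw [norm_smul, norm_inv, Real.norm_of_nonneg hρ.le, inv_mul_lt_iff₀ hρ]
      linarith
    have hlam : (√(s * ρ ^ 2))⁻¹ ^ 2 * (s * ρ ^ 2) = 1 := by
      rw [inv_pow, Real.sq_sqrt hβ.le, inv_mul_cancel₀ hβ.ne']
    ext1 v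
    rw [pullback_apply, pullback_apply, dilation_apply, gluedForm_eq_sdInstanton hc hlam hx']
  · rw [chernIntegral_dilation hG hρi, chernIntegral_gluedForm hc hβ hAρ hEρ,
      chernIntegral_dilation hA hρ]
  · rw [energy_dilation hG hρi, energy_gluedForm hc hβ hAρ hEρ, energy_dilation hA hρ, heq ρ hρ,
      hcov]
    have h4 : 0 < ρ ^ 4 := by positivity
    linarith [mul_lt_mul_of_pos_right hsmall h4]

/-- Gluing in a self-dual instanton, without restriction on the gauge. -/
theorem exists_selfDual_gluing {A : OneForm} (hA : IsConnectionForm A) (hE : FiniteEnergy A)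
    (hle : tripleNormSq (sdPart (curvature A 0)) ≤ tripleNormSq (asdPart (curvature A 0)))
    (hpos : 0 < tripleNormSq (asdPart (curvature A 0))) :
    ∃ ρ₀ : ℝ, 0 < ρ₀ ∧ ∀ ρ : ℝ, 0 < ρ → ρ < ρ₀ →
      ∃ A' : OneForm, IsConnectionForm A' ∧ FiniteEnergy A' ∧
        GaugeEquivOn (Metric.ball (0 : R4) ρ)ᶜ A A' ∧
        (∃ lam : ℝ, 0 < lam ∧
          GaugeEquivOn (Metric.ball (0 : R4) (31 / 100 * ρ)) (sdInstanton lam) A') ∧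
        chernIntegral A' = chernIntegral A - 8 * Real.pi ^ 2 ∧
        energy A' ≤ energy A + 8 * Real.pi ^ 2 - 1 / 100 * covNorm (curvature A 0) ^ 2 * ρ ^ 4 := by
  obtain ⟨Φ, Ψ, hc, hC1, hC2⟩ := exists_cutoffPair
  obtain ⟨B, hB, hAB, h0, hD, ht, hM⟩ := exists_adapted_gauge hA
  have hinv := hAB.invariants hA hB
  have hcov := hAB.covNorm_sq_eq hA hB
  have hEB : FiniteEnergy B := by
    simp only [FiniteEnergy, hcov]
    exact hE
  have e1 : energy B = energy A := by simp only [energy, hcov]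
  have e2 : chernIntegral B = chernIntegral A := by simp only [chernIntegral, (hinv _).2.2]
  obtain ⟨ρ₀, hρ₀, h⟩ := exists_gluing_of_adapted hc hC1 hC2 hB hEB h0 hD ht hM
    (by rwa [(hinv 0).1, (hinv 0).2.1]) (by rwa [(hinv 0).1])
  refine ⟨ρ₀, hρ₀, fun ρ hρ hρ' => ?_⟩
  obtain ⟨A', h1, h2, h3, h4, h5, h6⟩ := h ρ hρ hρ'
  refine ⟨A', h1, h2, (hAB.mono (Set.subset_univ _)).trans h3, h4, by rw [h5, e2], ?_⟩
  rwa [e1, hcov] at h6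

/-- Gluing in an anti-self-dual instanton, as the image of the self-dual case under quaternionic
conjugation. -/
theorem exists_antiSelfDual_gluing {A : OneForm} (hA : IsConnectionForm A) (hE : FiniteEnergy A)
    (hle : tripleNormSq (asdPart (curvature A 0)) ≤ tripleNormSq (sdPart (curvature A 0)))
    (hpos : 0 < tripleNormSq (sdPart (curvature A 0))) :
    ∃ ρ₀ : ℝ, 0 < ρ₀ ∧ ∀ ρ : ℝ, 0 < ρ → ρ < ρ₀ →
      ∃ A' : OneForm, IsConnectionForm A' ∧ FiniteEnergy A' ∧
        GaugeEquivOn (Metric.ball (0 : R4) ρ)ᶜ A A' ∧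
        (∃ lam : ℝ, 0 < lam ∧
          GaugeEquivOn (Metric.ball (0 : R4) (31 / 100 * ρ)) (asdInstanton lam) A') ∧
        chernIntegral A' = chernIntegral A + 8 * Real.pi ^ 2 ∧
        energy A' ≤ energy A + 8 * Real.pi ^ 2 - 1 / 100 * covNorm (curvature A 0) ^ 2 * ρ ^ 4 := by
  have hA' := hA.pullback conjMap
  obtain ⟨ρ₀, hρ₀, h⟩ := exists_selfDual_gluing hA' (finiteEnergy_conjMap hA hE)
    (by rwa [asdPart_conjMap hA, sdPart_conjMap hA, tripleNormSq_neg, tripleNormSq_neg, map_zero])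
    (by rwa [asdPart_conjMap hA, tripleNormSq_neg, map_zero])
  refine ⟨ρ₀, hρ₀, fun ρ hρ hρ' => ?_⟩
  obtain ⟨B, hB, hEB, h3, ⟨lam, hlam, h4⟩, h5, h6⟩ := h ρ hρ hρ'
  have hball : ∀ r, conjMap ⁻¹' Metric.ball (0 : R4) r = Metric.ball 0 r := fun r => by
    ext x
    simp [norm_conjMap]
  refine ⟨pullback conjMap B, hB.pullback _, finiteEnergy_conjMap hB hEB, ?_, ⟨lam, hlam, ?_⟩,
    ?_, ?_⟩
  · have := h3.pullback conjMap
    rwa [Set.preimage_compl, hball, pullback_conjMap_conjMap] at this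
  · have := h4.pullback conjMap
    rwa [hball, pullback_conjMap_sdInstanton] at this
  · rw [chernIntegral_conjMap hB, h5, chernIntegral_conjMap hA]
    ring
  · rwa [energy_conjMap hA, covNorm_conjMap_sq hA, map_zero, ← energy_conjMap hB] at h6

theorem covNorm_nonneg (α : TwoCovector) : 0 ≤ covNorm α := Real.sqrt_nonneg _

theorem eq_zero_of_covNorm_sq_eq_zero {α : TwoCovector} (h : ∀ i j, α j i = -α i j)
    (h0 : covNorm α ^ 2 = 0) : α = 0 := by
  rw [covNorm_sq] at h0
  have n : ∀ i j, 0 ≤ ‖α i j‖ ^ 2 := fun i j => sq_nonneg _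
  have e : ∀ i j, ‖α i j‖ ^ 2 ≤ 0 → α i j = 0 := fun i j hij => by
    simpa using le_antisymm hij (n i j)
  have n01 := n 0 1
  have n02 := n 0 2
  have n03 := n 0 3
  have n12 := n 1 2
  have n13 := n 1 3
  have n23 := n 2 3
  have e01 := e 0 1 (by linarith)
  have e02 := e 0 2 (by linarith)
  have e03 := e 0 3 (by linarith)
  have e12 := e 1 2 (by linarith)
  have e13 := e 1 3 (by linarith)
  have e23 := e 2 3 (by linarith)
  funext i j
  have hd : ∀ i, α i i = 0 := fun i => eq_zero_of_eq_neg (h i i)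
  fin_cases i <;> fin_cases j <;>
    simp [hd, e01, e02, e03, e12, e13, e23, h 0 1, h 0 2, h 0 3, h 1 2, h 1 3, h 2 3]

end

end YangMills4

theorem theorem1p1 :
    ∃ τ : ℝ, 0.3 < τ ∧ τ < 0.4 ∧ ∃ ε₀ : ℝ, 0 < ε₀ ∧
      ∀ A : OneForm, IsConnectionForm A → FiniteEnergy A → curvature A 0 ≠ 0 →
        (covNorm (projPlus (curvature A 0)) ≤ covNorm (projMinus (curvature A 0)) →
          ∃ ρ₀ : ℝ, 0 < ρ₀ ∧ ∀ ρ : ℝ, 0 < ρ → ρ < ρ₀ →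
            ∃ A' : OneForm, IsConnectionForm A' ∧ FiniteEnergy A' ∧
              GaugeEquivOn (Metric.ball (0 : R4) ρ)ᶜ A A' ∧
              (∃ lam : ℝ, 0 < lam ∧
                GaugeEquivOn (Metric.ball (0 : R4) (τ * ρ)) (sdInstanton lam) A') ∧
              chernIntegral A' = chernIntegral A - 8 * Real.pi ^ 2 ∧
              energy A' ≤ energy A + 8 * Real.pi ^ 2
                - ε₀ * covNorm (curvature A 0) ^ 2 * ρ ^ 4) ∧
        (covNorm (projMinus (curvature A 0)) ≤ covNorm (projPlus (curvature A 0)) →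
          ∃ ρ₀ : ℝ, 0 < ρ₀ ∧ ∀ ρ : ℝ, 0 < ρ → ρ < ρ₀ →
            ∃ A' : OneForm, IsConnectionForm A' ∧ FiniteEnergy A' ∧
              GaugeEquivOn (Metric.ball (0 : R4) ρ)ᶜ A A' ∧
              (∃ lam : ℝ, 0 < lam ∧
                GaugeEquivOn (Metric.ball (0 : R4) (τ * ρ)) (asdInstanton lam) A') ∧
              chernIntegral A' = chernIntegral A + 8 * Real.pi ^ 2 ∧
              energy A' ≤ energy A + 8 * Real.pi ^ 2
                - ε₀ * covNorm (curvature A 0) ^ 2 * ρ ^ 4) := by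
  refine ⟨31 / 100, by norm_num, by norm_num, 1 / 100, by norm_num, fun A hA hE hF => ?_⟩
  have hanti := curvature_antisymm A 0
  have hsum : 0 < tripleNormSq (sdPart (curvature A 0)) + tripleNormSq (asdPart (curvature A 0)) := by
    rw [← covNorm_sq_eq_sd_add_asd]
    exact lt_of_le_of_ne (sq_nonneg _) fun h => hF (eq_zero_of_covNorm_sq_eq_zero hanti h.symm)
  constructor
  · intro h
    have h2 := (sq_le_sq₀ (covNorm_nonneg _) (covNorm_nonneg _)).2 h
    rw [covNorm_projPlus_sq hanti, covNorm_projMinus_sq hanti] at h2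
    exact exists_selfDual_gluing hA hE h2 (by linarith)
  · intro h
    have h2 := (sq_le_sq₀ (covNorm_nonneg _) (covNorm_nonneg _)).2 h
    rw [covNorm_projPlus_sq hanti, covNorm_projMinus_sq hanti] at h2
    exact exists_antiSelfDual_gluing hA hE h2 (by linarith)
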